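/- Let $B$ be the boundary complex of the stacked $4$-polytope with vertices $1,\dots,13$ that is built from the nine $4$-simplices $\langle i,i+1,i+2,i+3,i+4\rangle$, $1\le i\le 9$; thus the facets of $B$ are the tetrahedra that lie in exactly one of these nine $4$-simplices. Let $M^3$ be the $9$-vertex simplicial complex obtained from $B$ by one combinatorial handle addition: the two tetrahedra $\langle 1,2,3,4\rangle$ and $\langle 10,11,12,13\rangle$ are removed, and the vertex $i+9$ is identified with the vertex $i$ for $1\le i\le 4$. (This is Walkup's $9$-vertex complex.) **Lemma.** $M^3$ is a combinatorial $3$-manifold (the link of each vertex is PL homeomorphic to the boundary of a $3$-simplex) that triangulates the twisted $S^2$-bundle over $S^1$, i.e. its underlying space $|M^3|$ is homeomorphic to $S^2\times[0,1]/\big((x,0)\sim(-x,1)\big)$. Moreover, $M^3$ is tight: in the canonical embedding $|M^3|\subset\Delta^8$, as a subcomplex of the $8$-simplex spanned by its nine vertices, the homomorphism $$H_i(|M^3|\cap h;\mathbb F_2)\longrightarrow H_i(|M^3|;\mathbb F_2)$$ induced by inclusion is injective for every open or closed half-space $h$ and every $i\ge 0$. -/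

import Mathlib

namespace TightTriangulation

noncomputable section

open CategoryTheory

/-! ### Tightness of subsets of Euclidean space -/

/-- The map `H_i(A; 𝔽) → H_i(B; 𝔽)` induced by an inclusion `A ⊆ B`, in singular homology. -/
def homologyInclusion (𝔽 : Type) [Field 𝔽] {E : Type} [TopologicalSpace E] {A B : Set E}
    (hAB : A ⊆ B) (i : ℕ) :
    ((AlgebraicTopology.singularHomologyFunctor (ModuleCat.{0} 𝔽) i).obj
        (ModuleCat.of 𝔽 𝔽)).obj (TopCat.of A) ⟶
      ((AlgebraicTopology.singularHomologyFunctor (ModuleCat.{0} 𝔽) i).obj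
        (ModuleCat.of 𝔽 𝔽)).obj (TopCat.of B) :=
  ((AlgebraicTopology.singularHomologyFunctor (ModuleCat.{0} 𝔽) i).obj (ModuleCat.of 𝔽 𝔽)).map
    (TopCat.ofHom ⟨Set.inclusion hAB, continuous_inclusion hAB⟩)

/-- `h` is an open or a closed half-space, bounded by an affine hyperplane. -/
def IsHalfSpace {E : Type} [NormedAddCommGroup E] [NormedSpace ℝ E] (h : Set E) : Prop :=
  ∃ (l : E →L[ℝ] ℝ) (c : ℝ), l ≠ 0 ∧ (h = {x | l x < c} ∨ h = {x | l x ≤ c})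

/-- `M ⊆ E` is `k`-tight with respect to `𝔽`: for every open or closed half-space `h` and every
`i ≤ k`, the map `H_i(M ∩ h; 𝔽) → H_i(M; 𝔽)` is injective. -/
def IsKTight (𝔽 : Type) [Field 𝔽] {E : Type} [NormedAddCommGroup E] [NormedSpace ℝ E] (k : ℕ)
    (M : Set E) : Prop :=
  ∀ h : Set E, IsHalfSpace h → ∀ i ≤ k,
    Function.Injective (homologyInclusion 𝔽 (Set.inter_subset_left : M ∩ h ⊆ M) i)

/-- `M ⊆ E` is `𝔽`-tight: it is `k`-tight with respect to `𝔽` for all `k`. -/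
def IsTight (𝔽 : Type) [Field 𝔽] {E : Type} [NormedAddCommGroup E] [NormedSpace ℝ E]
    (M : Set E) : Prop :=
  ∀ k : ℕ, IsKTight 𝔽 k M

/-! ### Simplicial complexes and combinatorial manifolds -/

/-- The complex whose faces are the nonempty subsets of the members of `F`. -/
def complexOf {V : Type} (F : Finset (Finset V)) : PreAbstractSimplicialComplex V where
  faces := {s | s.Nonempty ∧ ∃ t ∈ F, s ⊆ t}
  isRelLowerSet_faces := by
    rintro s ⟨hs, t, ht, hst⟩
    exact ⟨hs, fun u hu hne => ⟨hne, t, ht, hu.trans hst⟩⟩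

/-- The link of the vertex `v`. -/
def link {V : Type} [DecidableEq V] (K : PreAbstractSimplicialComplex V) (v : V) :
    PreAbstractSimplicialComplex V where
  faces := {s | s.Nonempty ∧ v ∉ s ∧ insert v s ∈ K.faces}
  isRelLowerSet_faces := by
    rintro s ⟨hs, hv, hvs⟩
    exact ⟨hs, fun u hu hne => ⟨hne, fun h => hv (hu h),
      (K.isRelLowerSet_faces hvs).2 (Finset.insert_subset_insert v hu)
        (Finset.insert_nonempty v u)⟩⟩

/-- The boundary complex of the simplex with vertex set `Fin n`. -/
def simplexBoundary (n : ℕ) : PreAbstractSimplicialComplex (Fin n) where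
  faces := {s | s.Nonempty ∧ s ≠ Finset.univ}
  isRelLowerSet_faces := by
    rintro s ⟨hs, hne⟩
    refine ⟨hs, fun u hu hu' => ⟨hu', ?_⟩⟩
    rintro rfl
    exact hne (Finset.univ_subset_iff.mp hu)

/-- The underlying set `|K|` in its canonical embedding: the vertices are the unit vectors, and
`|K|` is a subset of the standard simplex which they span. -/
def realization {V : Type} [Fintype V] (K : PreAbstractSimplicialComplex V) :
    Set (EuclideanSpace ℝ V) :=
  {x | (∀ v, 0 ≤ x v) ∧ ∑ v, x v = 1 ∧ ∃ s ∈ K.faces, ∀ v, v ∉ s → x v = 0}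

/-- A compact polyhedron: a finite union of convex hulls of finite sets. -/
def IsCompactPolyhedron {E : Type} [AddCommGroup E] [Module ℝ E] (S : Set E) : Prop :=
  ∃ F : Finset (Set E), (∀ A ∈ F, A.Finite) ∧ S = ⋃ A ∈ F, convexHull ℝ A

/-- `X` and `Y` are PL homeomorphic (for compact polyhedra `X`, `Y`, a map is PL exactly if its
graph is a compact polyhedron). -/
def PLHomeomorphic {E E' : Type} [AddCommGroup E] [Module ℝ E] [TopologicalSpace E]
    [AddCommGroup E'] [Module ℝ E'] [TopologicalSpace E'] (X : Set E) (Y : Set E') : Prop :=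
  ∃ f : X ≃ₜ Y, IsCompactPolyhedron {p : E × E' | ∃ x : X, p = ((x : E), (f x : E'))}

/-- `K` is a combinatorial manifold of dimension `d`: the link of every vertex is a
PL `(d-1)`-sphere, that is, PL homeomorphic to the boundary of the `d`-simplex. -/
def IsCombinatorialManifold {V : Type} [Fintype V] [DecidableEq V] (d : ℕ)
    (K : PreAbstractSimplicialComplex V) : Prop :=
  ∀ v : V, {v} ∈ K.faces →
    PLHomeomorphic (realization (link K v)) (realization (simplexBoundary (d + 1)))

/-! ### The twisted `S²`-bundle over `S¹` -/

/-- The unit sphere `S²`. -/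
abbrev S2 : Type := Metric.sphere (0 : EuclideanSpace ℝ (Fin 3)) 1

/-- `(x, 0)` is glued to `(-x, 1)`; the antipodal map of `S²` reverses the orientation. -/
inductive TwistedGluing : S2 × unitInterval → S2 × unitInterval → Prop
  | glue (x : S2) : TwistedGluing (x, 0) (-x, 1)

/-- The total space of the twisted (non-orientable) `S²`-bundle over `S¹`, with the quotient
topology of `S² × [0, 1]`. -/
abbrev TwistedSphereBundle : Type := Quot TwistedGluing

end

/-! ### The 9-vertex triangulation -/

/-- The nine 4-simplices `⟨i, i+1, i+2, i+3, i+4⟩`, `1 ≤ i ≤ 9`, of the stacked 4-polytope with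
vertices `1, …, 13`. -/
def stackedSimplices : Finset (Finset ℕ) :=
  (Finset.Icc 1 9).image fun i => Finset.Icc i (i + 4)

/-- The tetrahedra of the boundary complex of the stacked polytope: those which lie in exactly one
of its 4-simplices. -/
def boundaryTetrahedra : Finset (Finset ℕ) :=
  (stackedSimplices.biUnion fun P => P.powersetCard 4).filter fun t =>
    (stackedSimplices.filter fun P => t ⊆ P).card = 1

/-- The tetrahedra after the handle addition: `⟨1,2,3,4⟩` and `⟨10,11,12,13⟩` are removed, and the
vertex `i + 9` is identified with the vertex `i`, for `1 ≤ i ≤ 4`. Vertices are recorded modulo `9`,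
so that the vertex `9` is `0 : Fin 9`. -/
def walkupTetrahedra : Finset (Finset (Fin 9)) :=
  (boundaryTetrahedra \ {Finset.Icc 1 4, Finset.Icc 10 13}).image fun t => t.image (Fin.ofNat 9)

/-- The handle addition leaves the tetrahedra which arise from the cyclic intervals
`{i, i+1, i+2, i+3, i+4}` by omitting one of the three inner vertices. -/
theorem walkupTetrahedra_eq :
    walkupTetrahedra = (Finset.univ : Finset (Fin 9)).biUnion fun i =>
      {{i, i + 2, i + 3, i + 4}, {i, i + 1, i + 3, i + 4}, {i, i + 1, i + 2, i + 4}} := by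
  decide +kernel

theorem singleton_mem_walkup (v : Fin 9) : {v} ∈ (complexOf walkupTetrahedra).faces := by
  refine ⟨Finset.singleton_nonempty v, {v, v + 2, v + 3, v + 4}, ?_, by simp⟩
  rw [walkupTetrahedra_eq]
  simp only [Finset.mem_biUnion, Finset.mem_univ, true_and]
  exact ⟨v, by simp⟩

/-- Walkup's 9-vertex complex `M³`. -/
def walkup : AbstractSimplicialComplex (Fin 9) :=
  { complexOf walkupTetrahedra with singleton_mem := singleton_mem_walkup }

end TightTriangulation

namespace TightTriangulation

noncomputable section

open Finset

/-! ### Singular chains modulo 2, graded by the number of vertices -/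

/-! Everything rests on the cyclic description of the complex: its tetrahedra are the windows `{i,
…, i+4}` of ℤ/9 with one of the three inner vertices omitted.

Manifold. Rotations of ℤ/9 are automorphisms, so only the link of `0` matters. It is the boundary of
the stack of tetrahedra 5678, 6781, 7812, 8123, 1234, hence arises from the boundary of 5678 by four
stellar subdivisions of triangles (`vertexLink_eq`). The linear map that sends the new vertex to the
barycenter of the subdivided face carries the subdivision bijectively onto the original complex
(`linearlyBijective_stellar`). The resulting homeomorphism is thus the restriction of one linear
map, and its graph is a polyhedron.

Topology. Unroll the complex to the infinite stack on ℤ with windows `{i, …, i+4}`. A boundary point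
`z` of the stack is determined by its sums over the residue classes mod 4, which form a point `Y` of
the boundary of a tetrahedron, and by its height `∑ k * z k`; this is S² × ℝ. Translation by 9
generates the deck group and, as 9 ≡ 1 mod 4, permutes the four coordinates of `Y` cyclically. On
the tetrahedron this is a rotary reflection, the antipodal map composed with a quarter turn.
Rotating the tetrahedron by a quarter turn along the interval (`wave`) absorbs the turn and leaves
the antipodal gluing (`wave_neg`). The outcome is a continuous bijection from the compact bundle
onto a Hausdorff space.

Tightness. The part of the complex in a half-space deforms along faces onto the subcomplex induced
on the set `U` of vertices in the half-space. Since singular and simplicial chains have the same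
homology (`relAcyclic`), it remains to show that the induced subcomplex on each `U` injects in
simplicial homology mod 2 (`simpliciallyTight_isFace`). In degree 0 this holds because any two
vertices span an edge. In degree 1, vertices outside `U` are removed from a bounding 2-chain one by
one: the link of such a vertex in the chain is a cycle, and a perfect elimination ordering fills it
without that vertex. In degree 2, a bounding 3-chain is constant on the tetrahedra not inside `U`,
so adding a multiple of the fundamental cycle moves it into `U`. In higher degrees there are no
simplices to bound with.

The comparison theorem is proved by induction on the vertices: a complex is the union of the closed
star of a vertex, which is a cone, and of the faces avoiding it. Excision for this union combines
barycentric subdivision with a map that stretches the star, and a Mayer–Vietoris chase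
(`RelAcyclic.union`) finishes the step. -/

/-- Singular chains mod 2 on simplices with `n` vertices; `n = 0` is the augmentation degree. -/
abbrev SChain (X : Type*) [TopologicalSpace X] (n : ℕ) :=
  C(stdSimplex ℝ (Fin n), X) →₀ ZMod 2

/-- The inclusion of the `i`-th face. -/
def faceMap {n : ℕ} (i : Fin (n + 1)) : C(stdSimplex ℝ (Fin n), stdSimplex ℝ (Fin (n + 1))) :=
  ⟨stdSimplex.map i.succAbove, stdSimplex.continuous_map _⟩

section SChain

variable {X Y Z : Type*} [TopologicalSpace X] [TopologicalSpace Y] [TopologicalSpace Z]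

/-- The boundary operator. -/
def bd {n : ℕ} : SChain X (n + 1) →ₗ[ZMod 2] SChain X n :=
  Finsupp.linearCombination (ZMod 2) fun σ => ∑ i, Finsupp.single (σ.comp (faceMap i)) 1

/-- The pushforward of singular chains. -/
def push (f : C(X, Y)) {n : ℕ} : SChain X n →ₗ[ZMod 2] SChain Y n :=
  Finsupp.lmapDomain _ _ fun σ => f.comp σ

theorem bd_single {n : ℕ} (σ : C(stdSimplex ℝ (Fin (n + 1)), X)) :
    bd (Finsupp.single σ 1) = ∑ i, Finsupp.single (σ.comp (faceMap i)) (1 : ZMod 2) := by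
  simp [bd]

theorem push_single (f : C(X, Y)) {n : ℕ} (σ : C(stdSimplex ℝ (Fin n), X)) (a : ZMod 2) :
    push f (Finsupp.single σ a) = Finsupp.single (f.comp σ) a := by
  simp [push]

theorem SChain.hom_ext {M : Type*} [AddCommMonoid M] [Module (ZMod 2) M] {α : Type*}
    {f g : (α →₀ ZMod 2) →ₗ[ZMod 2] M}
    (h : ∀ a, f (Finsupp.single a 1) = g (Finsupp.single a 1)) (c : α →₀ ZMod 2) : f c = g c := by
  have : f = g := Finsupp.lhom_ext' fun a => LinearMap.ext_ring (h a)
  rw [this]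

theorem bd_push (f : C(X, Y)) {n : ℕ} (c : SChain X (n + 1)) : bd (push f c) = push f (bd c) := by
  refine SChain.hom_ext (f := bd ∘ₗ push f) (g := push f ∘ₗ bd) (fun σ => ?_) c
  simp [bd_single, push_single, ContinuousMap.comp_assoc]

theorem push_push (g : C(Y, Z)) (f : C(X, Y)) {n : ℕ} (c : SChain X n) :
    push g (push f c) = push (g.comp f) c := by
  refine SChain.hom_ext (f := push g ∘ₗ push f) (g := push (g.comp f)) (fun σ => ?_) c
  simp [push_single, ContinuousMap.comp_assoc]

end SChain

/-! ### Chains of vertex tuples -/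

section TupleChains

variable {P Q : Type*}

/-- Chains mod 2 on `n`-tuples of points. -/
abbrev AChain (P : Type*) (n : ℕ) := (Fin n → P) →₀ ZMod 2

/-- The boundary of a chain of tuples. -/
def abd {n : ℕ} : AChain P (n + 1) →ₗ[ZMod 2] AChain P n :=
  Finsupp.linearCombination (ZMod 2) fun p => ∑ i, Finsupp.single (p ∘ Fin.succAbove i) 1

/-- The cone over a chain of tuples. -/
def cone (b : P) {n : ℕ} : AChain P n →ₗ[ZMod 2] AChain P (n + 1) :=
  Finsupp.lmapDomain _ _ fun p => (Fin.cons b p : Fin (n + 1) → P)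

/-- The image of a chain of tuples under a map of points. -/
def apush (φ : P → Q) {n : ℕ} : AChain P n →ₗ[ZMod 2] AChain Q n :=
  Finsupp.lmapDomain _ _ fun p => φ ∘ p

theorem abd_single {n : ℕ} (p : Fin (n + 1) → P) :
    abd (Finsupp.single p 1) = ∑ i, Finsupp.single (p ∘ Fin.succAbove i) (1 : ZMod 2) := by
  simp [abd]

theorem cone_single (b : P) {n : ℕ} (p : Fin n → P) (a : ZMod 2) :
    cone b (Finsupp.single p a) = Finsupp.single (Fin.cons b p : Fin (n + 1) → P) a := by
  simp [cone]

theorem apush_single (φ : P → Q) {n : ℕ} (p : Fin n → P) (a : ZMod 2) :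
    apush φ (Finsupp.single p a) = Finsupp.single (φ ∘ p) a := by
  simp [apush]

theorem abd_cone (b : P) {n : ℕ} (c : AChain P (n + 1)) :
    abd (cone b c) = c + cone b (abd c) := by
  refine SChain.hom_ext (f := abd ∘ₗ cone b) (g := LinearMap.id + cone b ∘ₗ abd) (fun p => ?_) c
  simp only [LinearMap.comp_apply, cone_single, abd_single, LinearMap.add_apply,
    LinearMap.id_apply, map_sum, Fin.sum_univ_succ (n := n + 1)]
  congr 1
  refine sum_congr rfl fun j _ => ?_
  congr 1
  ext k
  cases k using Fin.cases <;> simp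

theorem abd_cone_zero (b : P) (c : AChain P 0) : abd (cone b c) = c := by
  refine SChain.hom_ext (f := abd ∘ₗ cone b) (g := LinearMap.id) (fun p => ?_) c
  simp only [LinearMap.comp_apply, cone_single, abd_single, LinearMap.id_apply]
  rw [show (univ : Finset (Fin (0 + 1))) = {0} from rfl, sum_singleton]
  congr 1

theorem abd_apush (φ : P → Q) {n : ℕ} (c : AChain P (n + 1)) :
    abd (apush φ c) = apush φ (abd c) := by
  refine SChain.hom_ext (f := abd ∘ₗ apush φ) (g := apush φ ∘ₗ abd) (fun p => ?_) c
  simp [abd_single, apush_single, Function.comp_assoc]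

theorem apush_cone (φ : P → Q) (b : P) {n : ℕ} (c : AChain P n) :
    apush φ (cone b c) = cone (φ b) (apush φ c) := by
  refine SChain.hom_ext (f := apush φ ∘ₗ cone b) (g := cone (φ b) ∘ₗ apush φ) (fun p => ?_) c
  simp only [LinearMap.comp_apply, cone_single, apush_single]
  congr 1
  ext k
  cases k using Fin.cases <;> simp

/-- Every tuple is the cone from its first entry over its tail, so the cone formula reduces the
claim to the tail: `c` and the boundary of `cone b (abd c)` contribute the same chain twice. -/
theorem abd_abd {n : ℕ} (c : AChain P (n + 2)) : abd (abd c) = 0 := by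
  refine SChain.hom_ext (f := abd ∘ₗ abd) (g := 0) (fun p => ?_) c
  simp only [LinearMap.comp_apply, LinearMap.zero_apply]
  clear c
  induction n with
  | zero =>
    rw [← Fin.cons_self_tail p, ← cone_single, abd_cone, map_add, abd_cone_zero,
      ZModModule.add_self]
  | succ n ih =>
    rw [← Fin.cons_self_tail p, ← cone_single, abd_cone, map_add, abd_cone, ih, map_zero,
      add_zero, ZModModule.add_self]

/-- The chain homotopy obtained by coning off the chains `Θ p + T (∂ p)`, starting from `T = 0`. -/
def coneHtpy (Θ : ∀ n, AChain P n →ₗ[ZMod 2] AChain Q n) (b : ∀ n, (Fin (n + 1) → P) → Q) :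
    ∀ n, AChain P n →ₗ[ZMod 2] AChain Q (n + 1)
  | 0 => 0
  | n + 1 => Finsupp.linearCombination (ZMod 2) fun p =>
      cone (b n p) (Θ (n + 1) (Finsupp.single p 1) + coneHtpy Θ b n (abd (Finsupp.single p 1)))

theorem coneHtpy_single (Θ : ∀ n, AChain P n →ₗ[ZMod 2] AChain Q n)
    (b : ∀ n, (Fin (n + 1) → P) → Q) {n : ℕ} (p : Fin (n + 1) → P) :
    coneHtpy Θ b (n + 1) (Finsupp.single p 1) =
      cone (b n p)
        (Θ (n + 1) (Finsupp.single p 1) + coneHtpy Θ b n (abd (Finsupp.single p 1))) := by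
  simp [coneHtpy]

/-- By induction the chain that is coned off is itself a cycle mod 2, so the cone formula leaves no
error term. The same recursion serves the subdivision homotopy and the prism operator. -/
theorem abd_coneHtpy (Θ : ∀ n, AChain P n →ₗ[ZMod 2] AChain Q n)
    (b : ∀ n, (Fin (n + 1) → P) → Q) (hΘ : ∀ n c, abd (Θ (n + 1) c) = Θ n (abd c))
    (hΘ0 : Θ 0 = 0) {n : ℕ} (c : AChain P (n + 1)) :
    abd (coneHtpy Θ b (n + 1) c) = Θ (n + 1) c + coneHtpy Θ b n (abd c) := by
  refine SChain.hom_ext (f := abd ∘ₗ coneHtpy Θ b (n + 1))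
    (g := Θ (n + 1) + coneHtpy Θ b n ∘ₗ abd) (fun p => ?_) c
  simp only [LinearMap.comp_apply, LinearMap.add_apply, coneHtpy_single]
  rw [abd_cone]
  conv_rhs => rw [← add_zero (Θ (n + 1) (Finsupp.single p 1) + _)]
  congr 1
  -- What remains is the vanishing of the cone over the boundary; `Θ 0 = 0` starts the induction.
  rw [map_add, hΘ]
  clear c
  induction n with
  | zero => simp [coneHtpy, hΘ0]
  | succ n ih =>
    have : ∀ c : AChain P (n + 1),
        abd (coneHtpy Θ b (n + 1) c) = Θ (n + 1) c + coneHtpy Θ b n (abd c) := by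
      refine SChain.hom_ext (f := abd ∘ₗ coneHtpy Θ b (n + 1))
        (g := Θ (n + 1) + coneHtpy Θ b n ∘ₗ abd) (fun q => ?_)
      simp only [LinearMap.comp_apply, LinearMap.add_apply, coneHtpy_single]
      rw [abd_cone, map_add, hΘ, ih, add_zero]
    rw [this, abd_abd, map_zero, add_zero, ZModModule.add_self, map_zero]

theorem apush_coneHtpy {P' Q' : Type*} (φ : P → P') (ψ : Q → Q')
    (Θ : ∀ n, AChain P n →ₗ[ZMod 2] AChain Q n) (b : ∀ n, (Fin (n + 1) → P) → Q)
    (Θ' : ∀ n, AChain P' n →ₗ[ZMod 2] AChain Q' n) (b' : ∀ n, (Fin (n + 1) → P') → Q')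
    (hΘ : ∀ n c, apush ψ (Θ n c) = Θ' n (apush φ c)) (hb : ∀ n p, ψ (b n p) = b' n (φ ∘ p))
    {n : ℕ} (c : AChain P n) :
    apush ψ (coneHtpy Θ b n c) = coneHtpy Θ' b' n (apush φ c) := by
  induction n with
  | zero => simp [coneHtpy]
  | succ n ih =>
    refine SChain.hom_ext (f := apush ψ ∘ₗ coneHtpy Θ b (n + 1))
      (g := coneHtpy Θ' b' (n + 1) ∘ₗ apush φ) (fun p => ?_) c
    simp only [LinearMap.comp_apply, coneHtpy_single, apush_single]
    rw [apush_cone, hb, map_add, hΘ, ih, ← abd_apush, apush_single]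

/-- The subdivision operator whose cone points are given by `b`. -/
def subdiv (b : ∀ n, (Fin (n + 1) → P) → P) : ∀ n, AChain P n →ₗ[ZMod 2] AChain P n
  | 0 => LinearMap.id
  | n + 1 => Finsupp.linearCombination (ZMod 2) fun p =>
      cone (b n p) (subdiv b n (abd (Finsupp.single p 1)))

theorem subdiv_single (b : ∀ n, (Fin (n + 1) → P) → P) {n : ℕ} (p : Fin (n + 1) → P) :
    subdiv b (n + 1) (Finsupp.single p 1) =
      cone (b n p) (subdiv b n (abd (Finsupp.single p 1))) := by
  simp [subdiv]

theorem abd_subdiv (b : ∀ n, (Fin (n + 1) → P) → P) {n : ℕ} (c : AChain P (n + 1)) :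
    abd (subdiv b (n + 1) c) = subdiv b n (abd c) := by
  induction n with
  | zero =>
    refine SChain.hom_ext (f := abd ∘ₗ subdiv b 1) (g := subdiv b 0 ∘ₗ abd) (fun p => ?_) c
    simp only [LinearMap.comp_apply, subdiv_single, abd_cone_zero]
  | succ n ih =>
    refine SChain.hom_ext (f := abd ∘ₗ subdiv b (n + 2)) (g := subdiv b (n + 1) ∘ₗ abd)
      (fun p => ?_) c
    simp only [LinearMap.comp_apply, subdiv_single, abd_cone]
    rw [ih, abd_abd, map_zero, map_zero, add_zero]

theorem apush_subdiv (φ : P → Q) (b : ∀ n, (Fin (n + 1) → P) → P)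
    (b' : ∀ n, (Fin (n + 1) → Q) → Q) (hb : ∀ n p, φ (b n p) = b' n (φ ∘ p)) {n : ℕ}
    (c : AChain P n) : apush φ (subdiv b n c) = subdiv b' n (apush φ c) := by
  induction n with
  | zero => rfl
  | succ n ih =>
    refine SChain.hom_ext (f := apush φ ∘ₗ subdiv b (n + 1))
      (g := subdiv b' (n + 1) ∘ₗ apush φ) (fun p => ?_) c
    simp only [LinearMap.comp_apply, subdiv_single, apush_single]
    rw [apush_cone, hb, ih, ← abd_apush, apush_single]

end TupleChains

/-! ### Affine simplices in convex sets -/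

section Affine

variable {E E' : Type*} [AddCommGroup E] [Module ℝ E] [TopologicalSpace E]
  [IsTopologicalAddGroup E] [ContinuousSMul ℝ E]
  [AddCommGroup E'] [Module ℝ E'] [TopologicalSpace E']
  [IsTopologicalAddGroup E'] [ContinuousSMul ℝ E']
  {S : Set E} {S' : Set E'} {X Y : Type*} [TopologicalSpace X] [TopologicalSpace Y]

/-- The affine simplex with given vertices in a convex set. -/
def affSimplex (hS : Convex ℝ S) {n : ℕ} (p : Fin n → S) : C(stdSimplex ℝ (Fin n), S) where
  toFun x := ⟨∑ i, x i • (p i : E),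
    hS.sum_mem (fun i _ => x.2.1 i) x.2.2 fun i _ => (p i).2⟩
  continuous_toFun := by
    refine Continuous.subtype_mk (continuous_finsetSum _ fun i _ => ?_) _
    exact ((continuous_apply i).comp continuous_subtype_val).smul continuous_const

theorem affSimplex_coe (hS : Convex ℝ S) {n : ℕ} (p : Fin n → S) (x : stdSimplex ℝ (Fin n)) :
    (affSimplex hS p x : E) = ∑ i, x i • (p i : E) := rfl

theorem affSimplex_comp_faceMap (hS : Convex ℝ S) {n : ℕ} (p : Fin (n + 1) → S)
    (i : Fin (n + 1)) : (affSimplex hS p).comp (faceMap i) = affSimplex hS (p ∘ i.succAbove) := by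
  ext x
  simp only [ContinuousMap.comp_apply, affSimplex_coe, Function.comp_apply]
  rw [Fin.sum_univ_succAbove _ i]
  have h0 : (faceMap i x) i = 0 := by
    simp [faceMap, stdSimplex.map_coe, FunOnFinite.linearMap_apply_apply]
  have h1 : ∀ j, (faceMap i x) (i.succAbove j) = x j := by
    intro j
    simp [faceMap, stdSimplex.map_coe, FunOnFinite.linearMap_apply_apply, Finset.sum_filter]
  simp [h0, h1]

/-- The singular chain in `X` given by an affine chain in `S` and a map `S → X`. -/
def realize (hS : Convex ℝ S) (f : C(S, X)) {n : ℕ} : AChain S n →ₗ[ZMod 2] SChain X n :=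
  Finsupp.lmapDomain _ _ fun p => f.comp (affSimplex hS p)

theorem realize_single (hS : Convex ℝ S) (f : C(S, X)) {n : ℕ} (p : Fin n → S) (a : ZMod 2) :
    realize hS f (Finsupp.single p a) = Finsupp.single (f.comp (affSimplex hS p)) a := by
  simp [realize]

theorem bd_realize (hS : Convex ℝ S) (f : C(S, X)) {n : ℕ} (c : AChain S (n + 1)) :
    bd (realize hS f c) = realize hS f (abd c) := by
  refine SChain.hom_ext (f := bd ∘ₗ realize hS f) (g := realize hS f ∘ₗ abd) (fun p => ?_) c
  simp only [LinearMap.comp_apply, realize_single, bd_single, abd_single, map_sum,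
    ContinuousMap.comp_assoc, affSimplex_comp_faceMap]

theorem push_realize (hS : Convex ℝ S) (f : C(S, X)) (g : C(X, Y)) {n : ℕ} (c : AChain S n) :
    push g (realize hS f c) = realize hS (g.comp f) c := by
  refine SChain.hom_ext (f := push g ∘ₗ realize hS f) (g := realize hS (g.comp f))
    (fun p => ?_) c
  simp [realize_single, push_single, ContinuousMap.comp_assoc]

/-- A map of convex sets is affine if it maps affine simplices to affine simplices. -/
def IsAff (hS : Convex ℝ S) (hS' : Convex ℝ S') (φ : S → S') : Prop :=
  ∀ (n : ℕ) (p : Fin n → S) (x : stdSimplex ℝ (Fin n)),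
    φ (affSimplex hS p x) = affSimplex hS' (φ ∘ p) x

theorem realize_apush (hS : Convex ℝ S) (hS' : Convex ℝ S') {φ : C(S, S')} (hφ : IsAff hS hS' φ)
    (f : C(S', X)) {n : ℕ} (c : AChain S n) :
    realize hS' f (apush φ c) = realize hS (f.comp φ) c := by
  refine SChain.hom_ext (f := realize hS' f ∘ₗ apush φ) (g := realize hS (f.comp φ))
    (fun p => ?_) c
  simp only [LinearMap.comp_apply, apush_single, realize_single]
  congr 1
  ext x
  simp [hφ n p x]

/-- The barycenter of an affine simplex. -/
def bary (hS : Convex ℝ S) (n : ℕ) (p : Fin (n + 1) → S) : S :=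
  affSimplex hS p stdSimplex.barycenter

theorem isAff_affSimplex (hS : Convex ℝ S) {m : ℕ} (q : Fin m → S) :
    IsAff (convex_stdSimplex ℝ (Fin m)) hS (affSimplex hS q) := by
  intro n p x
  ext
  simp only [affSimplex_coe, Function.comp_apply, smul_sum]
  rw [sum_comm]
  refine sum_congr rfl fun i _ => ?_
  have : (affSimplex (convex_stdSimplex ℝ (Fin m)) p x) i = ∑ j, x j * (p j) i := by
    refine (congrFun (affSimplex_coe (convex_stdSimplex ℝ (Fin m)) p x) i).trans ?_
    rw [Finset.sum_apply]
    rfl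
  rw [this, sum_smul]
  simp [mul_smul]

/-- The vertices of the standard simplex. -/
def stdVertices (n : ℕ) : Fin n → stdSimplex ℝ (Fin n) := stdSimplex.vertex

theorem affSimplex_stdVertices (n : ℕ) :
    affSimplex (convex_stdSimplex ℝ (Fin n)) (stdVertices n) = ContinuousMap.id _ := by
  ext x i
  have := congrFun (affSimplex_coe (convex_stdSimplex ℝ (Fin n)) (stdVertices n) x) i
  simp only [Finset.sum_apply, Pi.smul_apply, stdVertices, smul_eq_mul] at this
  refine this.trans ?_
  simp [Pi.single_apply]

/-- The universal example: each singular simplex is the image of the tuple of standard vertices, so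
identities for affine chains transfer to singular chains by naturality. -/
theorem realize_stdVertices {n : ℕ} (σ : C(stdSimplex ℝ (Fin n), X)) (a : ZMod 2) :
    realize (convex_stdSimplex ℝ (Fin n)) σ (Finsupp.single (stdVertices n) a) =
      Finsupp.single σ a := by
  rw [realize_single, affSimplex_stdVertices, ContinuousMap.comp_id]

theorem bd_bd {n : ℕ} (c : SChain X (n + 2)) : bd (bd c) = 0 := by
  refine SChain.hom_ext (f := bd ∘ₗ bd) (g := 0) (fun σ => ?_) c
  simp only [LinearMap.comp_apply, LinearMap.zero_apply]
  rw [← realize_stdVertices σ, bd_realize, bd_realize, abd_abd, map_zero]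

end Affine

/-! ### Chains supported in subsets -/

section Support

variable {X Y : Type*} [TopologicalSpace X] [TopologicalSpace Y]

theorem map_mem_of_mem_supported {α M : Type*} [AddCommGroup M] [Module (ZMod 2) M] {s : Set α}
    {W : Submodule (ZMod 2) M} {L : (α →₀ ZMod 2) →ₗ[ZMod 2] M}
    (h : ∀ a ∈ s, L (Finsupp.single a 1) ∈ W) {c : α →₀ ZMod 2}
    (hc : c ∈ Finsupp.supported (ZMod 2) (ZMod 2) s) : L c ∈ W := by
  rw [Finsupp.supported_eq_span_single] at hc
  have : Submodule.span (ZMod 2) ((fun i => Finsupp.single i (1 : ZMod 2)) '' s) ≤ W.comap L := by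
    rw [Submodule.span_le]
    rintro _ ⟨a, ha, rfl⟩
    exact h a ha
  exact this hc

/-- The chains in `X` whose simplices lie in `A`. -/
def SIn (A : Set X) (n : ℕ) : Submodule (ZMod 2) (SChain X n) :=
  Finsupp.supported (ZMod 2) (ZMod 2) {σ | Set.range σ ⊆ A}

theorem single_mem_SIn {A : Set X} {n : ℕ} {σ : C(stdSimplex ℝ (Fin n), X)}
    (h : ∀ x, σ x ∈ A) (a : ZMod 2) : Finsupp.single σ a ∈ SIn A n :=
  Finsupp.single_mem_supported _ _ (by rintro _ ⟨x, rfl⟩; exact h x)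

theorem SIn_mono {A B : Set X} (h : A ⊆ B) (n : ℕ) : SIn A n ≤ SIn B n :=
  Finsupp.supported_mono fun _ hσ => hσ.trans h

theorem SIn_inter (A B : Set X) (n : ℕ) : SIn (A ∩ B) n = SIn A n ⊓ SIn B n := by
  unfold SIn
  rw [← Finsupp.supported_inter]
  congr 1
  ext σ
  simp [Set.subset_inter_iff]

theorem map_mem_of_mem_SIn {M : Type*} [AddCommGroup M] [Module (ZMod 2) M] {A : Set X} {n : ℕ}
    {W : Submodule (ZMod 2) M} {L : SChain X n →ₗ[ZMod 2] M}
    (h : ∀ σ : C(stdSimplex ℝ (Fin n), X), (∀ x, σ x ∈ A) → L (Finsupp.single σ 1) ∈ W)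
    {c : SChain X n} (hc : c ∈ SIn A n) : L c ∈ W :=
  map_mem_of_mem_supported (L := L) (fun σ (hσ : Set.range σ ⊆ A) => h σ fun x => hσ ⟨x, rfl⟩) hc

theorem map_mem_SIn_sup {X' : Type*} [TopologicalSpace X'] {A₁ A₂ : Set X} {B₁ B₂ : Set X'}
    {n m : ℕ} {L : SChain X n →ₗ[ZMod 2] SChain X' m}
    (h₁ : ∀ c ∈ SIn A₁ n, L c ∈ SIn B₁ m) (h₂ : ∀ c ∈ SIn A₂ n, L c ∈ SIn B₂ m)
    {c : SChain X n} (hc : c ∈ SIn A₁ n ⊔ SIn A₂ n) : L c ∈ SIn B₁ m ⊔ SIn B₂ m := by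
  obtain ⟨a, ha, b, hb, rfl⟩ := Submodule.mem_sup.1 hc
  rw [map_add]
  exact Submodule.add_mem_sup (h₁ a ha) (h₂ b hb)

theorem bd_mem_SIn {A : Set X} {n : ℕ} {c : SChain X (n + 1)} (hc : c ∈ SIn A (n + 1)) :
    bd c ∈ SIn A n := by
  refine map_mem_of_mem_SIn (fun σ hσ => ?_) hc
  rw [bd_single]
  exact Submodule.sum_mem _ fun i _ => single_mem_SIn (fun x => hσ (faceMap i x)) _

theorem push_mem_SIn {A : Set X} {B : Set Y} {f : C(X, Y)} (h : ∀ x ∈ A, f x ∈ B) {n : ℕ}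
    {c : SChain X n} (hc : c ∈ SIn A n) : push f c ∈ SIn B n := by
  refine map_mem_of_mem_SIn (fun σ hσ => ?_) hc
  rw [push_single]
  exact single_mem_SIn (fun x => h _ (hσ x)) _

theorem SIn_univ (n : ℕ) (c : SChain X n) : c ∈ SIn (Set.univ : Set X) n := by
  unfold SIn
  rw [Finsupp.mem_supported]
  intro σ _
  exact Set.subset_univ _

end Support

section Realize

variable {E : Type*} [AddCommGroup E] [Module ℝ E] [TopologicalSpace E]
  [IsTopologicalAddGroup E] [ContinuousSMul ℝ E] {S : Set E} {X Y : Type*}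
  [TopologicalSpace X] [TopologicalSpace Y]

theorem realize_mem_SIn (hS : Convex ℝ S) {f : C(S, X)} {A : Set X} (h : ∀ x, f x ∈ A) {n : ℕ}
    (c : AChain S n) : realize hS f c ∈ SIn A n := by
  refine map_mem_of_mem_supported (s := Set.univ) (fun p _ => ?_) (by simp)
  rw [realize_single]
  exact single_mem_SIn (fun x => h _) _

theorem affSimplex_comp_stdVertices (hS : Convex ℝ S) {n : ℕ} (p : Fin n → S) :
    affSimplex hS p ∘ stdVertices n = p := by
  ext i
  have h : ∀ j, stdVertices n i j = if j = i then 1 else 0 := fun j =>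
    (congrFun (stdSimplex.vertex_coe i) j).trans (Pi.single_apply i 1 j)
  simp [affSimplex_coe, h]

theorem apply_bary {E' : Type*} [AddCommGroup E'] [Module ℝ E'] [TopologicalSpace E']
    [IsTopologicalAddGroup E'] [ContinuousSMul ℝ E'] {S' : Set E'} {hS' : Convex ℝ S'}
    {hS : Convex ℝ S} {φ : S' → S} (hφ : IsAff hS' hS φ) {n : ℕ} (q : Fin (n + 1) → S') :
    φ (bary hS' n q) = bary hS n (φ ∘ q) :=
  hφ _ q _

/-! ### Barycentric subdivision of singular chains -/

/-- The barycentric subdivision of a singular chain. -/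
def sSubdiv (n : ℕ) : SChain X n →ₗ[ZMod 2] SChain X n :=
  Finsupp.linearCombination (ZMod 2) fun σ =>
    realize (convex_stdSimplex ℝ (Fin n)) σ
      (subdiv (bary (convex_stdSimplex ℝ (Fin n))) n (Finsupp.single (stdVertices n) 1))

/-- The homotopy between the identity and the subdivision of tuples. -/
def subdivHtpy (hS : Convex ℝ S) (n : ℕ) : AChain S n →ₗ[ZMod 2] AChain S (n + 1) :=
  coneHtpy (fun n => LinearMap.id + subdiv (bary hS) n) (bary hS) n

/-- The homotopy between the identity and the barycentric subdivision. -/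
def sSubdivHtpy (n : ℕ) : SChain X n →ₗ[ZMod 2] SChain X (n + 1) :=
  Finsupp.linearCombination (ZMod 2) fun σ =>
    realize (convex_stdSimplex ℝ (Fin n)) σ
      (subdivHtpy (convex_stdSimplex ℝ (Fin n)) n (Finsupp.single (stdVertices n) 1))

theorem abd_subdivHtpy (hS : Convex ℝ S) {n : ℕ} (c : AChain S (n + 1)) :
    abd (subdivHtpy hS (n + 1) c) = c + subdiv (bary hS) (n + 1) c + subdivHtpy hS n (abd c) := by
  refine abd_coneHtpy _ _ (fun n c => ?_) ?_ c
  · simp [abd_subdiv]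
  · exact LinearMap.ext fun c => ZModModule.add_self c

theorem sSubdiv_single {n : ℕ} (σ : C(stdSimplex ℝ (Fin n), X)) :
    sSubdiv n (Finsupp.single σ 1) = realize (convex_stdSimplex ℝ (Fin n)) σ
      (subdiv (bary (convex_stdSimplex ℝ (Fin n))) n (Finsupp.single (stdVertices n) 1)) := by
  simp [sSubdiv]

theorem sSubdivHtpy_single {n : ℕ} (σ : C(stdSimplex ℝ (Fin n), X)) :
    sSubdivHtpy n (Finsupp.single σ 1) = realize (convex_stdSimplex ℝ (Fin n)) σ
      (subdivHtpy (convex_stdSimplex ℝ (Fin n)) n (Finsupp.single (stdVertices n) 1)) := by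
  simp [sSubdivHtpy]

/-- Affine maps preserve barycenters, and the affine simplex on `p` sends the standard vertices to
`p`; so subdividing the model and subdividing the tuple agree. -/
theorem sSubdiv_realize (hS : Convex ℝ S) (f : C(S, X)) {n : ℕ} (c : AChain S n) :
    sSubdiv n (realize hS f c) = realize hS f (subdiv (bary hS) n c) := by
  refine SChain.hom_ext (f := sSubdiv n ∘ₗ realize hS f)
    (g := realize hS f ∘ₗ subdiv (bary hS) n) (fun p => ?_) c
  simp only [LinearMap.comp_apply, realize_single, sSubdiv_single]
  rw [← realize_apush _ hS (isAff_affSimplex hS p),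
    apush_subdiv _ _ (bary hS) fun n q => apply_bary (isAff_affSimplex hS p) q, apush_single,
    affSimplex_comp_stdVertices]

theorem sSubdivHtpy_realize (hS : Convex ℝ S) (f : C(S, X)) {n : ℕ} (c : AChain S n) :
    sSubdivHtpy n (realize hS f c) = realize hS f (subdivHtpy hS n c) := by
  refine SChain.hom_ext (f := sSubdivHtpy n ∘ₗ realize hS f)
    (g := realize hS f ∘ₗ subdivHtpy hS n) (fun p => ?_) c
  simp only [LinearMap.comp_apply, realize_single, sSubdivHtpy_single]
  rw [← realize_apush _ hS (isAff_affSimplex hS p)]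
  unfold subdivHtpy
  rw [apush_coneHtpy (affSimplex hS p) (affSimplex hS p) _ _
    (fun n => LinearMap.id + subdiv (bary hS) n) (bary hS), apush_single,
    affSimplex_comp_stdVertices]
  · intro n c
    simp only [LinearMap.add_apply, map_add, LinearMap.id_apply]
    rw [apush_subdiv _ _ (bary hS) fun n q => apply_bary (isAff_affSimplex hS p) q]
  · exact fun n q => apply_bary (isAff_affSimplex hS p) q

theorem bd_sSubdiv {n : ℕ} (c : SChain X (n + 1)) :
    bd (sSubdiv (n + 1) c) = sSubdiv n (bd c) := by
  refine SChain.hom_ext (f := bd ∘ₗ sSubdiv (n + 1)) (g := sSubdiv n ∘ₗ bd) (fun σ => ?_) c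
  simp only [LinearMap.comp_apply, sSubdiv_single]
  conv_rhs => rw [← realize_stdVertices σ]
  rw [bd_realize, bd_realize, sSubdiv_realize, abd_subdiv]

theorem bd_sSubdivHtpy {n : ℕ} (c : SChain X (n + 1)) :
    bd (sSubdivHtpy (n + 1) c) = c + sSubdiv (n + 1) c + sSubdivHtpy n (bd c) := by
  refine SChain.hom_ext (f := bd ∘ₗ sSubdivHtpy (n + 1))
    (g := LinearMap.id + sSubdiv (n + 1) + sSubdivHtpy n ∘ₗ bd) (fun σ => ?_) c
  simp only [LinearMap.comp_apply, LinearMap.add_apply, LinearMap.id_apply]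
  rw [← realize_stdVertices σ]
  rw [bd_realize, sSubdivHtpy_realize, bd_realize, sSubdivHtpy_realize, sSubdiv_realize,
    abd_subdivHtpy, map_add, map_add]

theorem sSubdiv_mem_SIn {A : Set X} {n : ℕ} {c : SChain X n} (hc : c ∈ SIn A n) :
    sSubdiv n c ∈ SIn A n := by
  refine map_mem_of_mem_SIn (fun σ hσ => ?_) hc
  rw [sSubdiv_single]
  exact realize_mem_SIn _ hσ _

theorem sSubdivHtpy_mem_SIn {A : Set X} {n : ℕ} {c : SChain X n} (hc : c ∈ SIn A n) :
    sSubdivHtpy n c ∈ SIn A (n + 1) := by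
  refine map_mem_of_mem_SIn (fun σ hσ => ?_) hc
  rw [sSubdivHtpy_single]
  exact realize_mem_SIn _ hσ _

end Realize

/-! ### Iterated subdivision -/

section Iterate

variable {X : Type*} [TopologicalSpace X]

theorem iterate_sSubdiv_mem_SIn {A : Set X} {n : ℕ} {c : SChain X n} (hc : c ∈ SIn A n) (k : ℕ) :
    (sSubdiv n ^ k) c ∈ SIn A n := by
  induction k with
  | zero => exact hc
  | succ k ih =>
    rw [pow_succ']
    exact sSubdiv_mem_SIn ih

theorem bd_iterate_sSubdiv {n : ℕ} (c : SChain X (n + 1)) (k : ℕ) :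
    bd ((sSubdiv (n + 1) ^ k) c) = (sSubdiv n ^ k) (bd c) := by
  induction k with
  | zero => rfl
  | succ k ih =>
    rw [pow_succ', pow_succ', Module.End.mul_apply, Module.End.mul_apply, bd_sSubdiv, ih]

/-- Telescoping the one-step homotopy: `e` collects the homotopies of the subdivisions of `c`, and
`w` those of the subdivisions of `bd c`. Hence `e` lies wherever `c` does, and `w` splits between
`A` and `B` as soon as `bd c` does. -/
theorem exists_iterate_sSubdiv_homotopy {n : ℕ} (c : SChain X (n + 1)) (k : ℕ) :
    ∃ (e : SChain X (n + 2)) (w : SChain X (n + 1)), c = (sSubdiv (n + 1) ^ k) c + bd e + w ∧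
      (∀ A : Set X, c ∈ SIn A (n + 1) → e ∈ SIn A (n + 2)) ∧
      ∀ A B : Set X, bd c ∈ SIn A n ⊔ SIn B n → w ∈ SIn A (n + 1) ⊔ SIn B (n + 1) := by
  induction k with
  | zero => exact ⟨0, 0, by simp, fun A _ => zero_mem _, fun A B _ => zero_mem _⟩
  | succ k ih =>
    obtain ⟨e, w, h, he, hw⟩ := ih
    refine ⟨e + sSubdivHtpy (n + 1) ((sSubdiv (n + 1) ^ k) c),
      w + sSubdivHtpy n ((sSubdiv n ^ k) (bd c)), ?_, fun A hA => ?_, fun A B hAB => ?_⟩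
    · have h2 := bd_sSubdivHtpy ((sSubdiv (n + 1) ^ k) c)
      rw [bd_iterate_sSubdiv] at h2
      rw [pow_succ', Module.End.mul_apply, map_add, h2]
      set a := (sSubdiv (n + 1) ^ k) c
      set b := sSubdiv (n + 1) a
      set d := sSubdivHtpy n ((sSubdiv n ^ k) (bd c))
      rw [show b + (bd e + (a + b + d)) + (w + d) = a + bd e + w + (b + b) + (d + d) by abel,
        ZModModule.add_self, ZModModule.add_self, add_zero, add_zero]
      exact h
    · exact add_mem (he A hA) (sSubdivHtpy_mem_SIn (iterate_sSubdiv_mem_SIn hA k))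
    · refine add_mem (hw A B hAB) (map_mem_SIn_sup (fun c hc => sSubdivHtpy_mem_SIn hc)
        (fun c hc => sSubdivHtpy_mem_SIn hc) ?_)
      exact map_mem_SIn_sup (fun c hc => iterate_sSubdiv_mem_SIn hc k)
        (fun c hc => iterate_sSubdiv_mem_SIn hc k) hAB

end Iterate

/-! ### The mesh of the barycentric subdivision -/

section Mesh

variable {E : Type*} [NormedAddCommGroup E] [NormedSpace ℝ E] {S : Set E}

/-- The chains all of whose simplices have diameter at most `d`. -/
def Mesh (S : Set E) (d : ℝ) (n : ℕ) : Submodule (ZMod 2) (AChain S n) :=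
  Finsupp.supported (ZMod 2) (ZMod 2) {q | ∀ i j, dist (q i) (q j) ≤ d}

/-- The difference is an average of `n + 2` vectors `p i - p j`, of which the one with `i = j` is
zero; this yields the contraction factor. -/
theorem dist_bary_le (hS : Convex ℝ S) {n : ℕ} {p : Fin (n + 2) → S} {d : ℝ}
    (hp : ∀ i j, dist (p i) (p j) ≤ d) (j : Fin (n + 2)) :
    dist (bary hS (n + 1) p : E) (p j) ≤ ((n + 1 : ℕ) : ℝ) / ((n + 1 : ℕ) + 1) * d := by
  have hc : (bary hS (n + 1) p : E) = ∑ i, ((n : ℝ) + 2)⁻¹ • (p i : E) := by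
    rw [bary, affSimplex_coe]
    refine sum_congr rfl fun i _ => ?_
    congr 1
    change ((stdSimplex.barycenter : stdSimplex ℝ (Fin (n + 2))) i) = _
    simp [stdSimplex.barycenter]
    rfl
  have hd : (bary hS (n + 1) p : E) - p j =
      ∑ i ∈ univ.erase j, ((n : ℝ) + 2)⁻¹ • ((p i : E) - p j) := by
    have h1 : ∑ i ∈ univ.erase j, ((n : ℝ) + 2)⁻¹ • ((p i : E) - p j) =
        ∑ i, ((n : ℝ) + 2)⁻¹ • ((p i : E) - p j) :=
      sum_erase _ (by simp)
    rw [h1, hc]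
    simp only [smul_sub, sum_sub_distrib, sum_const, card_univ, Fintype.card_fin]
    rw [← Nat.cast_smul_eq_nsmul ℝ, smul_smul]
    have : ((n : ℝ) + 2) ≠ 0 := by positivity
    push_cast
    rw [mul_inv_cancel₀ this, one_smul]
  rw [dist_eq_norm, hd]
  refine (norm_sum_le _ _).trans ?_
  refine (sum_le_card_nsmul _ _ (((n : ℝ) + 2)⁻¹ * d) fun i _ => ?_).trans ?_
  · rw [norm_smul, Real.norm_of_nonneg (by positivity)]
    refine mul_le_mul_of_nonneg_left ?_ (by positivity)
    rw [← dist_eq_norm]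
    exact hp i j
  · rw [card_erase_of_mem (mem_univ j), card_univ, Fintype.card_fin, nsmul_eq_mul]
    apply le_of_eq
    change ((n + 1 : ℕ) : ℝ) * _ = _
    push_cast
    rw [show (n : ℝ) + 1 + 1 = n + 2 by ring]
    ring

/-- The hull condition is carried along to make the induction work: the new cone point is close to
every vertex of `p`, hence to every point of their convex hull. -/
theorem subdiv_single_mem (hS : Convex ℝ S) {n : ℕ} (p : Fin (n + 1) → S) {d : ℝ}
    (hp : ∀ i j, dist (p i) (p j) ≤ d) :
    subdiv (bary hS) (n + 1) (Finsupp.single p 1) ∈ Finsupp.supported (ZMod 2) (ZMod 2)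
      {q | (∀ i j, dist (q i) (q j) ≤ (n : ℝ) / (n + 1) * d) ∧
        ∀ i, (q i : E) ∈ convexHull ℝ (Set.range fun j => (p j : E))} := by
  have hd : 0 ≤ d := dist_nonneg.trans (hp 0 0)
  have hb : ∀ {m : ℕ} (p : Fin (m + 1) → S),
      (bary hS m p : E) ∈ convexHull ℝ (Set.range fun j => (p j : E)) := fun p =>
    (convex_convexHull ℝ _).sum_mem (fun i _ => (stdSimplex.barycenter (𝕜 := ℝ)).2.1 i)
      (stdSimplex.barycenter (𝕜 := ℝ)).2.2 fun i _ => subset_convexHull ℝ _ (Set.mem_range_self i)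
  induction n with
  | zero =>
    rw [subdiv_single]
    refine map_mem_of_mem_supported (s := Set.univ) (L := cone _) (fun q _ => ?_) (by simp)
    rw [cone_single]
    refine Finsupp.single_mem_supported _ _ ⟨fun i j => ?_, fun i => ?_⟩
    · rw [Subsingleton.elim (α := Fin 1) i j, dist_self]
      positivity
    · rw [Subsingleton.elim (α := Fin 1) i 0]
      exact hb p
  | succ n ih =>
    rw [subdiv_single, abd_single, map_sum, map_sum]
    refine Submodule.sum_mem _ fun k _ => ?_
    refine map_mem_of_mem_supported (L := cone _) (fun q hq => ?_)
      (ih (p ∘ k.succAbove) fun i j => hp _ _)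
    rw [cone_single]
    have hsub : convexHull ℝ (Set.range fun j => ((p ∘ k.succAbove) j : E)) ⊆
        convexHull ℝ (Set.range fun j => (p j : E)) := by
      refine convexHull_mono ?_
      rintro _ ⟨j, rfl⟩
      exact ⟨k.succAbove j, rfl⟩
    have hball : ∀ x ∈ convexHull ℝ (Set.range fun j => (p j : E)),
        dist x (bary hS (n + 1) p : E) ≤ ((n + 1 : ℕ) : ℝ) / ((n + 1 : ℕ) + 1) * d := by
      intro x hx
      refine convexHull_min (t := Metric.closedBall _ _) ?_ (convex_closedBall _ _) hx
      rintro _ ⟨j, rfl⟩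
      rw [Metric.mem_closedBall, dist_comm]
      exact dist_bary_le hS hp j
    have hle : (n : ℝ) / (n + 1) * d ≤ ((n + 1 : ℕ) : ℝ) / ((n + 1 : ℕ) + 1) * d := by
      refine mul_le_mul_of_nonneg_right ?_ hd
      rw [div_le_div_iff₀ (by positivity) (by positivity)]
      push_cast
      nlinarith
    have hnn : 0 ≤ ((n + 1 : ℕ) : ℝ) / ((n + 1 : ℕ) + 1) * d := by positivity
    refine Finsupp.single_mem_supported _ _ ⟨fun i j => ?_, fun i => ?_⟩
    · cases i using Fin.cases with
      | zero =>
        cases j using Fin.cases with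
        | zero => simpa using hnn
        | succ j =>
          rw [dist_comm]
          exact hball _ (hsub (hq.2 j))
      | succ i =>
        cases j using Fin.cases with
        | zero => exact hball _ (hsub (hq.2 i))
        | succ j => exact (hq.1 i j).trans hle
    · cases i using Fin.cases with
      | zero => exact hb p
      | succ i => exact hsub (hq.2 i)

theorem subdiv_mem_mesh (hS : Convex ℝ S) {n : ℕ} {d : ℝ} {c : AChain S (n + 1)}
    (hc : c ∈ Mesh S d (n + 1)) :
    subdiv (bary hS) (n + 1) c ∈ Mesh S ((n : ℝ) / (n + 1) * d) (n + 1) :=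
  map_mem_of_mem_supported (L := subdiv (bary hS) (n + 1)) (fun p hp =>
    Finsupp.supported_mono (fun _ hq => hq.1) (subdiv_single_mem hS p hp)) hc

theorem iterate_subdiv_mem_mesh (hS : Convex ℝ S) {n : ℕ} {d : ℝ} {c : AChain S (n + 1)}
    (hc : c ∈ Mesh S d (n + 1)) (k : ℕ) :
    (subdiv (bary hS) (n + 1) ^ k) c ∈ Mesh S (((n : ℝ) / (n + 1)) ^ k * d) (n + 1) := by
  induction k with
  | zero => simpa using hc
  | succ k ih =>
    rw [pow_succ', pow_succ', Module.End.mul_apply, mul_assoc]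
    exact subdiv_mem_mesh hS ih

end Mesh

/-! ### Small chains -/

section Small

variable {X : Type*} [TopologicalSpace X]

theorem iterate_sSubdiv_single {n : ℕ} (σ : C(stdSimplex ℝ (Fin n), X)) (k : ℕ) :
    (sSubdiv n ^ k) (Finsupp.single σ 1) = realize (convex_stdSimplex ℝ (Fin n)) σ
      ((subdiv (bary (convex_stdSimplex ℝ (Fin n))) n ^ k)
        (Finsupp.single (stdVertices n) 1)) := by
  induction k with
  | zero => exact (realize_stdVertices σ 1).symm
  | succ k ih =>
    rw [pow_succ', pow_succ', Module.End.mul_apply, Module.End.mul_apply, ih, sSubdiv_realize]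

/-- The preimages of `U` and `V` cover the compact standard simplex; once the mesh is below a
Lebesgue number, each affine piece lies in one of them. -/
theorem exists_iterate_sSubdiv_single_small {A U V : Set X} (hU : IsOpen U) (hV : IsOpen V)
    (hA : A ⊆ U ∪ V) {n : ℕ} (σ : C(stdSimplex ℝ (Fin (n + 1)), X)) (hσ : ∀ x, σ x ∈ A) :
    ∃ k₀, ∀ k ≥ k₀, (sSubdiv (n + 1) ^ k) (Finsupp.single σ 1) ∈
      SIn (A ∩ U) (n + 1) ⊔ SIn (A ∩ V) (n + 1) := by
  let c : Bool → Set (stdSimplex ℝ (Fin (n + 1))) := fun b => if b then σ ⁻¹' U else σ ⁻¹' V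
  obtain ⟨δ, hδ, hL⟩ := lebesgue_number_lemma_of_metric (s := Set.univ) (c := c) isCompact_univ
    (by rintro (_ | _) <;> simp only [c] <;> [exact hV.preimage σ.continuous;
      exact hU.preimage σ.continuous])
    (by
      intro x _
      rcases hA (hσ x) with h | h
      · exact Set.mem_iUnion.2 ⟨true, h⟩
      · exact Set.mem_iUnion.2 ⟨false, h⟩)
  have hdiam : Finsupp.single (stdVertices (n + 1)) (1 : ZMod 2) ∈
      Mesh (stdSimplex ℝ (Fin (n + 1))) 1 (n + 1) := by
    refine Finsupp.single_mem_supported _ _ fun i j => ?_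
    exact (Metric.dist_le_diam_of_mem (bounded_stdSimplex _) (stdVertices _ i).2
      (stdVertices _ j).2).trans diam_stdSimplex_le
  have hlim : Filter.Tendsto (fun k : ℕ => ((n : ℝ) / (n + 1)) ^ k * 1) Filter.atTop
      (nhds 0) := by
    simpa using tendsto_pow_atTop_nhds_zero_of_lt_one (r := (n : ℝ) / (n + 1)) (by positivity)
      (by rw [div_lt_one (by positivity)]; linarith)
  obtain ⟨k₀, hk₀⟩ := Filter.eventually_atTop.1 (hlim.eventually (gt_mem_nhds hδ))
  refine ⟨k₀, fun k hk => ?_⟩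
  rw [iterate_sSubdiv_single]
  refine map_mem_of_mem_supported (L := realize _ σ) (fun q hq => ?_)
    (iterate_subdiv_mem_mesh (convex_stdSimplex ℝ (Fin (n + 1))) hdiam k)
  rw [realize_single]
  obtain ⟨b, hb⟩ := hL (q 0) (Set.mem_univ _)
  -- Balls are convex, so vertices near `q 0` keep the whole affine simplex in the ball around `q
  -- 0`.
  have hin : ∀ x, affSimplex (convex_stdSimplex ℝ (Fin (n + 1))) q x ∈ c b := by
    intro x
    apply hb
    rw [Metric.mem_ball, Subtype.dist_eq, ← Metric.mem_ball]
    refine (convex_ball _ _).sum_mem (fun i _ => x.2.1 i) x.2.2 fun i _ => ?_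
    exact lt_of_le_of_lt (hq i 0) (hk₀ k hk)
  cases b with
  | false => exact Submodule.mem_sup_right (single_mem_SIn (A := A ∩ V)
      (σ := σ.comp (affSimplex _ q)) (fun x => ⟨hσ _, hin x⟩) _)
  | true => exact Submodule.mem_sup_left (single_mem_SIn (A := A ∩ U)
      (σ := σ.comp (affSimplex _ q)) (fun x => ⟨hσ _, hin x⟩) _)

/-- Every chain in a union of two open sets becomes small after sufficiently many subdivisions. -/
theorem exists_iterate_sSubdiv_small {A U V : Set X} (hU : IsOpen U) (hV : IsOpen V)
    (hA : A ⊆ U ∪ V) {n : ℕ} {c : SChain X (n + 1)} (hc : c ∈ SIn A (n + 1)) :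
    ∃ k, (sSubdiv (n + 1) ^ k) c ∈ SIn (A ∩ U) (n + 1) ⊔ SIn (A ∩ V) (n + 1) := by
  suffices h : ∃ k₀, ∀ k ≥ k₀, (sSubdiv (n + 1) ^ k) c ∈
      SIn (A ∩ U) (n + 1) ⊔ SIn (A ∩ V) (n + 1) from h.imp fun k hk => hk k le_rfl
  unfold SIn at hc
  rw [Finsupp.supported_eq_span_single] at hc
  induction hc using Submodule.span_induction with
  | mem x hx =>
    obtain ⟨σ, hσ, rfl⟩ := hx
    exact exists_iterate_sSubdiv_single_small hU hV hA σ fun x => hσ ⟨x, rfl⟩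
  | zero => exact ⟨0, fun k _ => by rw [map_zero]; exact zero_mem _⟩
  | add x y _ _ hx hy =>
    obtain ⟨a, ha⟩ := hx
    obtain ⟨b, hb⟩ := hy
    refine ⟨max a b, fun k hk => ?_⟩
    rw [map_add]
    exact add_mem (ha k (le_of_max_le_left hk)) (hb k (le_of_max_le_right hk))
  | smul a x _ hx =>
    obtain ⟨k₀, h⟩ := hx
    refine ⟨k₀, fun k hk => ?_⟩
    rw [map_smul]
    exact Submodule.smul_mem _ _ (h k hk)

end Small

/-! ### The prism operator -/

section Prism

/-- The prism over the standard simplex with `n` vertices. -/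
def prism (n : ℕ) : Set ((Fin n → ℝ) × ℝ) := stdSimplex ℝ (Fin n) ×ˢ Set.Icc 0 1

theorem convex_prism (n : ℕ) : Convex ℝ (prism n) :=
  (convex_stdSimplex ℝ (Fin n)).prod (convex_Icc 0 1)

/-- The inclusion of the standard simplex in the prism at height `t`. -/
def prismIncl (n : ℕ) (t : unitInterval) : C(stdSimplex ℝ (Fin n), prism n) where
  toFun x := ⟨((x : Fin n → ℝ), (t : ℝ)), x.2, t.2⟩
  continuous_toFun := by fun_prop

theorem isAff_prismIncl (n : ℕ) (t : unitInterval) :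
    IsAff (convex_stdSimplex ℝ (Fin n)) (convex_prism n) (prismIncl n t) := by
  intro m p x
  ext1
  simp only [affSimplex_coe, prismIncl, ContinuousMap.coe_mk, Function.comp_apply]
  ext1
  · simp only [Prod.fst_sum, Prod.smul_fst]
    rfl
  · have : ∑ i, x i = 1 := x.2.2
    simp [Prod.snd_sum, ← Finset.sum_mul, this]

/-- The map of prisms induced by an affine simplex. -/
def prismLift {m n : ℕ} (p : Fin n → stdSimplex ℝ (Fin m)) : C(prism n, prism m) where
  toFun z := ⟨((affSimplex (convex_stdSimplex ℝ (Fin m)) p ⟨z.1.1, z.2.1⟩ : Fin m → ℝ), z.1.2),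
    Subtype.property _, z.2.2⟩
  continuous_toFun := by fun_prop

theorem isAff_prismLift {m n : ℕ} (p : Fin n → stdSimplex ℝ (Fin m)) :
    IsAff (convex_prism n) (convex_prism m) (prismLift p) := by
  intro k q x
  ext1
  simp only [affSimplex_coe, prismLift, ContinuousMap.coe_mk, Function.comp_apply]
  ext1
  · have h := congrArg Subtype.val (isAff_affSimplex (convex_stdSimplex ℝ (Fin m)) p k
      (fun i => ⟨(q i).1.1, (q i).2.1⟩) x)
    rw [affSimplex_coe] at h
    simp only [Prod.fst_sum, Prod.smul_fst]
    refine Eq.trans ?_ h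
    congr 2
  · simp [Prod.snd_sum]

/-- The prism chain of a tuple of points. -/
def prismChain (m n : ℕ) : AChain (stdSimplex ℝ (Fin m)) n →ₗ[ZMod 2] AChain (prism m) (n + 1) :=
  coneHtpy (fun _ => apush (prismIncl m 0) + apush (prismIncl m 1))
    (fun _ p => prismIncl m 0 (p 0)) n

theorem abd_prismChain (m n : ℕ) (c : AChain (stdSimplex ℝ (Fin m)) (n + 1)) :
    abd (prismChain m (n + 1) c) = apush (prismIncl m 0) c + apush (prismIncl m 1) c +
      prismChain m n (abd c) := by
  refine abd_coneHtpy _ _ (fun n c => ?_) (LinearMap.ext fun c => ?_) c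
  · simp [abd_apush]
  -- There is only one empty tuple, so bottom and top coincide in the augmentation degree and cancel
  -- mod 2.
  · have : apush (n := 0) (prismIncl m 0) = apush (prismIncl m 1) := by
      unfold apush
      congr 1
      ext1 p
      exact Subsingleton.elim _ _
    simp only [LinearMap.add_apply, this]
    exact ZModModule.add_self _

variable {X Y : Type*} [TopologicalSpace X] [TopologicalSpace Y]

/-- The map of the prism over a singular simplex which is given by a homotopy. -/
def prismMap (H : C(Y × unitInterval, X)) {n : ℕ} (σ : C(stdSimplex ℝ (Fin n), Y)) :
    C(prism n, X) where
  toFun z := H (σ ⟨z.1.1, z.2.1⟩, ⟨z.1.2, z.2.2⟩)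
  continuous_toFun := by fun_prop

/-- The prism operator of a homotopy. -/
def prismOp (H : C(Y × unitInterval, X)) (n : ℕ) : SChain Y n →ₗ[ZMod 2] SChain X (n + 1) :=
  Finsupp.linearCombination (ZMod 2) fun σ =>
    realize (convex_prism n) (prismMap H σ) (prismChain n n (Finsupp.single (stdVertices n) 1))

/-- The map at time `t` of a homotopy. -/
def homotopyAt (H : C(Y × unitInterval, X)) (t : unitInterval) : C(Y, X) :=
  H.comp ((ContinuousMap.id Y).prodMk (ContinuousMap.const Y t))

theorem prismOp_single (H : C(Y × unitInterval, X)) {n : ℕ} (σ : C(stdSimplex ℝ (Fin n), Y)) :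
    prismOp H n (Finsupp.single σ 1) = realize (convex_prism n) (prismMap H σ)
      (prismChain n n (Finsupp.single (stdVertices n) 1)) := by
  simp [prismOp]

theorem prismOp_realize (H : C(Y × unitInterval, X)) {m n : ℕ} (σ : C(stdSimplex ℝ (Fin m), Y))
    (c : AChain (stdSimplex ℝ (Fin m)) n) :
    prismOp H n (realize (convex_stdSimplex ℝ (Fin m)) σ c) =
      realize (convex_prism m) (prismMap H σ) (prismChain m n c) := by
  refine SChain.hom_ext (f := prismOp H n ∘ₗ realize (convex_stdSimplex ℝ (Fin m)) σ)
    (g := realize (convex_prism m) (prismMap H σ) ∘ₗ prismChain m n) (fun p => ?_) c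
  simp only [LinearMap.comp_apply, realize_single, prismOp_single]
  have : prismMap H (σ.comp (affSimplex (convex_stdSimplex ℝ (Fin m)) p)) =
      (prismMap H σ).comp (prismLift p) := by
    ext z
    rfl
  rw [this, ← realize_apush _ _ (isAff_prismLift p)]
  unfold prismChain
  rw [apush_coneHtpy (affSimplex (convex_stdSimplex ℝ (Fin m)) p) (prismLift p) _ _
    (fun _ => apush (prismIncl m 0) + apush (prismIncl m 1)) (fun _ p => prismIncl m 0 (p 0)),
    apush_single, affSimplex_comp_stdVertices]
  · intro k c
    refine SChain.hom_ext
      (f := apush (prismLift p) ∘ₗ (apush (prismIncl n 0) + apush (prismIncl n 1)))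
      (g := (apush (prismIncl m 0) + apush (prismIncl m 1)) ∘ₗ
        apush (affSimplex (convex_stdSimplex ℝ (Fin m)) p)) (fun q => ?_) c
    simp only [LinearMap.comp_apply, LinearMap.add_apply, map_add, apush_single]
    rfl
  · intro k q
    rfl

theorem bd_prismOp (H : C(Y × unitInterval, X)) {n : ℕ} (c : SChain Y (n + 1)) :
    bd (prismOp H (n + 1) c) =
      push (homotopyAt H 0) c + push (homotopyAt H 1) c + prismOp H n (bd c) := by
  refine SChain.hom_ext (f := bd ∘ₗ prismOp H (n + 1))
    (g := push (homotopyAt H 0) + push (homotopyAt H 1) + prismOp H n ∘ₗ bd) (fun σ => ?_) c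
  simp only [LinearMap.comp_apply, LinearMap.add_apply]
  rw [← realize_stdVertices σ, prismOp_realize, bd_realize, bd_realize, prismOp_realize,
    abd_prismChain, map_add, map_add, realize_apush _ _ (isAff_prismIncl _ _),
    realize_apush _ _ (isAff_prismIncl _ _), push_realize, push_realize]
  rfl

theorem prismOp_mem_SIn {H : C(Y × unitInterval, X)} {A : Set Y} {B : Set X}
    (h : ∀ y ∈ A, ∀ t, H (y, t) ∈ B) {n : ℕ} {c : SChain Y n} (hc : c ∈ SIn A n) :
    prismOp H n c ∈ SIn B (n + 1) := by
  refine map_mem_of_mem_SIn (L := prismOp H n) (fun σ hσ => ?_) hc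
  rw [prismOp_single]
  exact realize_mem_SIn _ (fun z => h _ (hσ _) _) _

end Prism

end

end TightTriangulation

namespace TightTriangulation

noncomputable section

open Finset CategoryTheory Simplicial

/-! ### Comparison with the singular homology functor -/

section Bridge

/-- The coefficient module. -/
abbrev coeffMod : ModuleCat.{0} (ZMod 2) := ModuleCat.of (ZMod 2) (ZMod 2)

/-- The singular chain complex. -/
abbrev singComplex (X : TopCat.{0}) : ChainComplex (ModuleCat.{0} (ZMod 2)) ℕ :=
  (TopCat.toSSet.obj X).chainComplex coeffMod

/-- The comparison map from the singular chains to the concrete singular chains. -/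
def toSChain (X : TopCat.{0}) (i : ℕ) :
    (singComplex X).X i ⟶ ModuleCat.of (ZMod 2) (SChain X (i + 1)) :=
  ((TopCat.toSSet.obj X).isColimitChainComplexXCofan coeffMod i).desc
    (Limits.Cofan.mk _ fun x => ModuleCat.ofHom (Finsupp.lsingle (X.toSSetObjEquiv _ x)))

theorem ι_toSChain (X : TopCat.{0}) {i : ℕ} (x : (TopCat.toSSet.obj X) _⦋i⦌) :
    (TopCat.toSSet.obj X).ιChainComplex x ≫ toSChain X i =
      ModuleCat.ofHom (Finsupp.lsingle (X.toSSetObjEquiv _ x)) :=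
  ((TopCat.toSSet.obj X).isColimitChainComplexXCofan coeffMod i).fac _ ⟨x⟩

theorem toSSetObjEquiv_δ (X : TopCat.{0}) {i : ℕ} (x : (TopCat.toSSet.obj X) _⦋i + 1⦌)
    (k : Fin (i + 2)) : X.toSSetObjEquiv _ ((TopCat.toSSet.obj X).δ k x) =
      (X.toSSetObjEquiv _ x).comp (faceMap k) := rfl

theorem toSSetObjEquiv_map {X Y : TopCat.{0}} (f : X ⟶ Y) {i : ℕ}
    (x : (TopCat.toSSet.obj X) _⦋i⦌) :
    Y.toSSetObjEquiv _ ((TopCat.toSSet.map f).app _ x) = f.hom.comp (X.toSSetObjEquiv _ x) := rfl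

/-- Mod 2 the alternating signs disappear. Homological degree `i` corresponds to simplices with `i +
1` vertices. -/
theorem toSChain_bd (X : TopCat.{0}) (i : ℕ) :
    toSChain X (i + 1) ≫ ModuleCat.ofHom bd = (singComplex X).d (i + 1) i ≫ toSChain X i := by
  refine SSet.chainComplex_hom_ext fun x => ?_
  rw [← Category.assoc, ι_toSChain, ← Category.assoc, SSet.ιChainComplex_d,
    Preadditive.sum_comp]
  simp only [Preadditive.zsmul_comp, ι_toSChain, toSSetObjEquiv_δ]
  have h : ∀ k : Fin (i + 2), ((-1 : ℤ) ^ (k : ℕ)) • ModuleCat.ofHom (Finsupp.lsingle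
      (R := ZMod 2) (M := ZMod 2) ((X.toSSetObjEquiv _ x).comp (faceMap k))) =
      ModuleCat.ofHom (Finsupp.lsingle ((X.toSSetObjEquiv _ x).comp (faceMap k))) := by
    intro k
    rcases neg_one_pow_eq_or ℤ (k : ℕ) with h | h
    · rw [h, one_smul]
    · rw [h, neg_one_smul]
      ext1
      rw [ModuleCat.hom_neg]
      exact LinearMap.ext fun a => ZModModule.neg_eq_self _
  refine Eq.trans ?_ (sum_congr rfl fun k _ => (h k).symm)
  ext1
  rw [ModuleCat.hom_comp, ModuleCat.hom_sum]
  refine LinearMap.ext_ring ?_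
  rw [LinearMap.sum_apply]
  exact bd_single _

theorem toSChain_push {X Y : TopCat.{0}} (f : X ⟶ Y) (i : ℕ) :
    toSChain X i ≫ ModuleCat.ofHom (push f.hom) =
      (SSet.chainComplexMap (TopCat.toSSet.map f) coeffMod).f i ≫ toSChain Y i := by
  refine SSet.chainComplex_hom_ext fun x => ?_
  rw [← Category.assoc, ι_toSChain, ← Category.assoc, SSet.ι_chainComplexMap_f, ι_toSChain,
    toSSetObjEquiv_map]
  ext1
  rw [ModuleCat.hom_comp]
  exact LinearMap.ext_ring (push_single _ _ _)

theorem bijective_toSChain (X : TopCat.{0}) (i : ℕ) : Function.Bijective (toSChain X i) := by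
  let g : SChain X (i + 1) →ₗ[ZMod 2] (singComplex X).X i := Finsupp.lsum (ZMod 2) fun σ =>
      ((TopCat.toSSet.obj X).ιChainComplex (R := coeffMod) (n := i)
        ((X.toSSetObjEquiv _).symm σ)).hom
  have hg : ∀ σ (a : ZMod 2), g (Finsupp.single σ a) =
      ((TopCat.toSSet.obj X).ιChainComplex (R := coeffMod) (n := i)
        ((X.toSSetObjEquiv _).symm σ)).hom a := fun σ a => by simp [g]
  let ψ : ModuleCat.of (ZMod 2) (SChain X (i + 1)) ⟶ (singComplex X).X i := ModuleCat.ofHom g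
  have h1 : toSChain X i ≫ ψ = 𝟙 _ := by
    refine SSet.chainComplex_hom_ext fun x => ?_
    rw [← Category.assoc, ι_toSChain, Category.comp_id]
    ext1
    rw [ModuleCat.hom_comp]
    refine LinearMap.ext fun a => ?_
    refine (hg _ _).trans ?_
    rw [Equiv.symm_apply_apply]
  have h2 : ψ ≫ toSChain X i = 𝟙 _ := by
    ext1
    rw [ModuleCat.hom_comp]
    refine Finsupp.lhom_ext' fun σ => LinearMap.ext fun a => ?_
    have h := congrArg (fun f => f.hom a) (ι_toSChain X ((X.toSSetObjEquiv (.op ⦋i⦌)).symm σ))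
    rw [Equiv.apply_symm_apply] at h
    refine Eq.trans ?_ h
    exact congrArg (toSChain X i).hom (hg _ _)
  exact ⟨Function.LeftInverse.injective (g := ψ) fun x => congrArg (fun f => f.hom x) h1,
    Function.RightInverse.surjective (g := ψ) fun x => congrArg (fun f => f.hom x) h2⟩

/-- A criterion for the injectivity of a map in singular homology. -/
theorem injective_homologyInclusion {E : Type} [TopologicalSpace E] {A B : Set E} (hAB : A ⊆ B)
    (i : ℕ)
    (h : ∀ (z : SChain A (i + 1)) (e : SChain B (i + 2)),
      bd e = push ⟨Set.inclusion hAB, continuous_inclusion hAB⟩ z →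
        ∃ e' : SChain A (i + 2), bd e' = z) :
    Function.Injective (homologyInclusion (ZMod 2) hAB i) := by
  let f : TopCat.of A ⟶ TopCat.of B :=
    TopCat.ofHom ⟨Set.inclusion hAB, continuous_inclusion hAB⟩
  have hmono : Mono (HomologicalComplex.homologyMap
      (SSet.chainComplexMap (TopCat.toSSet.map f) coeffMod) i) := by
    -- Injectivity is tested on generalized elements. The hypothesis `h` puts all their values into
    -- the range of the differential, and the chains map epimorphically onto that range, so a lift
    -- exists after a refinement.
    rw [HomologicalComplex.mono_homologyMap_iff_up_to_refinements _ (i + 1) i _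
      (by simp) rfl]
    intro M x₂ _ y₁ hxy
    let d : (singComplex (TopCat.of A)).X (i + 1) ⟶
        ModuleCat.of (ZMod 2) (((singComplex (TopCat.of A)).d (i + 1) i).hom.range) :=
      ModuleCat.ofHom ((singComplex (TopCat.of A)).d (i + 1) i).hom.rangeRestrict
    have hd : Epi d := (ModuleCat.epi_iff_surjective d).2 (LinearMap.surjective_rangeRestrict _)
    have hmem : ∀ a, x₂.hom a ∈ ((singComplex (TopCat.of A)).d (i + 1) i).hom.range := by
      intro a
      have e1 := congrArg (fun g => g.hom (x₂.hom a)) (toSChain_push f i)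
      have e2 := congrArg (fun g => g.hom (y₁.hom a)) (toSChain_bd (TopCat.of B) i)
      have e3 := congrArg (fun g => (toSChain (TopCat.of B) i).hom (g.hom a)) hxy
      obtain ⟨e', he'⟩ := h ((toSChain (TopCat.of A) i).hom (x₂.hom a))
        ((toSChain (TopCat.of B) (i + 1)).hom (y₁.hom a)) (e2.trans (e3.symm.trans e1.symm))
      obtain ⟨c, hc⟩ := (bijective_toSChain (TopCat.of A) (i + 1)).2 e'
      refine ⟨c, (bijective_toSChain (TopCat.of A) i).1 ?_⟩
      have e4 := congrArg (fun g => g.hom c) (toSChain_bd (TopCat.of A) i)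
      refine e4.symm.trans ?_
      refine Eq.trans ?_ he'
      exact congrArg bd hc
    let y : M ⟶ ModuleCat.of (ZMod 2) (((singComplex (TopCat.of A)).d (i + 1) i).hom.range) :=
      ModuleCat.ofHom (x₂.hom.codRestrict _ hmem)
    obtain ⟨A', π, hπ, x₁, hx₁⟩ := surjective_up_to_refinements_of_epi d y
    refine ⟨A', π, hπ, x₁, ?_⟩
    ext a
    exact congrArg Subtype.val (congrArg (fun g => g.hom a) hx₁)
  exact (ModuleCat.mono_iff_injective _).1 hmono

end Bridge

end

end TightTriangulation

namespace TightTriangulation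

noncomputable section

open Finset

/-! ### Simplicial chains modulo 2 -/

section FChain

variable {V : Type*}

/-- Simplicial chains mod 2 on the finite subsets of `V`. -/
abbrev FChain (V : Type*) := Finset V →₀ ZMod 2

/-- The simplicial boundary operator. -/
def fbd [DecidableEq V] : FChain V →ₗ[ZMod 2] FChain V :=
  Finsupp.linearCombination (ZMod 2) fun s => ∑ a ∈ s, Finsupp.single (s.erase a) 1

theorem fbd_single [DecidableEq V] (s : Finset V) :
    fbd (Finsupp.single s 1) = ∑ a ∈ s, Finsupp.single (s.erase a) (1 : ZMod 2) := by
  simp [fbd]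

/-- The simplicial cone operator. -/
def fcone [DecidableEq V] (v : V) : FChain V →ₗ[ZMod 2] FChain V :=
  Finsupp.linearCombination (ZMod 2) fun s => if v ∈ s then 0 else Finsupp.single (insert v s) 1

theorem fcone_single [DecidableEq V] (v : V) (s : Finset V) : fcone v (Finsupp.single s 1) =
    if v ∈ s then 0 else Finsupp.single (insert v s) (1 : ZMod 2) := by
  simp [fcone]

/-- The formula survives when `v` already lies in `s`: the cone is then zero, and coning the
boundary returns `s` from the only face without `v`. -/
theorem fbd_fcone [DecidableEq V] (v : V) (c : FChain V) :
    fbd (fcone v c) = c + fcone v (fbd c) := by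
  refine SChain.hom_ext (f := fbd ∘ₗ fcone v) (g := LinearMap.id + fcone v ∘ₗ fbd)
    (fun s => ?_) c
  simp only [LinearMap.comp_apply, LinearMap.add_apply, LinearMap.id_apply, fcone_single,
    fbd_single, map_sum, mem_erase]
  by_cases hv : v ∈ s
  · rw [if_pos hv, map_zero, sum_eq_single_of_mem v hv, if_neg (by simp), insert_erase hv,
      ZModModule.add_self]
    intro a _ hav
    rw [if_pos ⟨hav.symm, hv⟩]
  · rw [if_neg hv, fbd_single, sum_insert hv, erase_insert hv]
    congr 1
    refine sum_congr rfl fun a ha => ?_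
    have hav : v ≠ a := fun h => hv (h ▸ ha)
    rw [if_neg (fun h => hv h.2), erase_insert_of_ne hav]

/-- The simplicial chains on the faces with `n` vertices of a complex. -/
def FIn (F : Set (Finset V)) (n : ℕ) : Submodule (ZMod 2) (FChain V) :=
  Finsupp.supported (ZMod 2) (ZMod 2) {s | s ∈ F ∧ s.card = n}

theorem FIn_mono {F G : Set (Finset V)} (h : F ⊆ G) (n : ℕ) : FIn F n ≤ FIn G n :=
  Finsupp.supported_mono fun _ hs => ⟨h hs.1, hs.2⟩

theorem single_mem_FIn {F : Set (Finset V)} {n : ℕ} {s : Finset V} (hs : s ∈ F)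
    (hn : s.card = n) : Finsupp.single s (1 : ZMod 2) ∈ FIn F n :=
  Finsupp.single_mem_supported _ _ ⟨hs, hn⟩

theorem fbd_mem_FIn [DecidableEq V] {F : Set (Finset V)} (hF : IsLowerSet F) {n : ℕ} {c : FChain V}
    (hc : c ∈ FIn F (n + 1)) : fbd c ∈ FIn F n := by
  refine map_mem_of_mem_supported (L := fbd) (fun s hs => ?_) hc
  rw [fbd_single]
  refine Submodule.sum_mem _ fun a ha => single_mem_FIn (hF (erase_subset a s) hs.1) ?_
  rw [card_erase_of_mem ha, hs.2, Nat.add_sub_cancel]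

theorem fbd_eq_zero_of_mem_FIn [DecidableEq V] {F : Set (Finset V)} {c : FChain V}
    (hc : c ∈ FIn F 0) : fbd c = 0 := by
  rw [← Submodule.mem_bot (ZMod 2)]
  refine map_mem_of_mem_supported (L := fbd) (fun s hs => ?_) hc
  rw [fbd_single, card_eq_zero.1 hs.2, sum_empty]
  exact zero_mem _

theorem fcone_mem_FIn [DecidableEq V] {F : Set (Finset V)} {v : V}
    (hF : ∀ s ∈ F, insert v s ∈ F) {n : ℕ} {c : FChain V} (hc : c ∈ FIn F n) :
    fcone v c ∈ FIn F (n + 1) := by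
  refine map_mem_of_mem_supported (L := fcone v) (fun s hs => ?_) hc
  rw [fcone_single]
  split_ifs with h
  · exact zero_mem _
  · exact single_mem_FIn (hF s hs.1) (by rw [card_insert_of_notMem h, hs.2])

end FChain

/-! ### Geometric realizations -/

section Geom

variable {N : ℕ}

/-- The underlying set of a set of faces. -/
def geom {V : Type} [Fintype V] (F : Set (Finset V)) : Set (EuclideanSpace ℝ V) :=
  {x | (∀ v, 0 ≤ x v) ∧ ∑ v, x v = 1 ∧ ∃ s ∈ F, ∀ v, v ∉ s → x v = 0}

theorem geom_mono {V : Type} [Fintype V] {F G : Set (Finset V)} (h : F ⊆ G) : geom F ⊆ geom G :=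
  fun _ hx => ⟨hx.1, hx.2.1, let ⟨s, hs, hx'⟩ := hx.2.2; ⟨s, h hs, hx'⟩⟩

theorem geom_inter {V : Type} [Fintype V] [DecidableEq V] {F G : Set (Finset V)}
    (hF : IsLowerSet F) (hG : IsLowerSet G) : geom (F ∩ G) = geom F ∩ geom G := by
  refine Set.Subset.antisymm (Set.subset_inter (geom_mono Set.inter_subset_left)
    (geom_mono Set.inter_subset_right)) ?_
  rintro x ⟨⟨h1, h2, s, hs, h3⟩, -, -, t, ht, h4⟩
  refine ⟨h1, h2, s ∩ t, ⟨hF inter_subset_left hs, hG inter_subset_right ht⟩, fun v hv => ?_⟩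
  by_cases hvs : v ∈ s
  · exact h4 v fun hvt => hv (mem_inter.2 ⟨hvs, hvt⟩)
  · exact h3 v hvs

/-- The vertices of the face `s`, provided that it has `n` vertices. -/
def faceVertex (s : Finset (Fin N)) (n : ℕ) (i : Fin n) : EuclideanSpace ℝ (Fin N) :=
  if h : s.card = n then EuclideanSpace.single (s.orderEmbOfFin h i) 1 else 0

/-- The face `s` as a singular simplex, provided that it has `n` vertices. -/
def faceSimplex (n : ℕ) (s : Finset (Fin N)) :
    C(stdSimplex ℝ (Fin n), EuclideanSpace ℝ (Fin N)) :=
  ContinuousMap.comp ⟨Subtype.val, continuous_subtype_val⟩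
    (affSimplex (convex_univ (𝕜 := ℝ)) fun i => ⟨faceVertex s n i, Set.mem_univ _⟩)

theorem faceSimplex_apply (n : ℕ) (s : Finset (Fin N)) (x : stdSimplex ℝ (Fin n)) :
    faceSimplex n s x = ∑ i, x i • faceVertex s n i := rfl

theorem faceSimplex_apply_emb {n : ℕ} {s : Finset (Fin N)} (h : s.card = n)
    (x : stdSimplex ℝ (Fin n)) (i : Fin n) :
    faceSimplex n s x (s.orderEmbOfFin h i) = x i := by
  simp [faceSimplex_apply, faceVertex, h, Pi.single_apply]

theorem faceSimplex_apply_of_notMem {n : ℕ} {s : Finset (Fin N)} (h : s.card = n)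
    (x : stdSimplex ℝ (Fin n)) {v : Fin N} (hv : v ∉ s) : faceSimplex n s x v = 0 := by
  have : ∀ i, v ≠ s.orderEmbOfFin h i := fun i hi => hv (hi ▸ orderEmbOfFin_mem s h i)
  simp [faceSimplex_apply, faceVertex, h, this]

theorem faceSimplex_mem_geom {F : Set (Finset (Fin N))} {n : ℕ} {s : Finset (Fin N)} (hs : s ∈ F)
    (h : s.card = n) (x : stdSimplex ℝ (Fin n)) : faceSimplex n s x ∈ geom F := by
  have hsum : ∑ v ∈ s, faceSimplex n s x v = 1 := by
    have h1 := sum_map univ (s.orderEmbOfFin h).toEmbedding (fun v => faceSimplex n s x v)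
    rw [Finset.map_orderEmbOfFin_univ] at h1
    rw [h1]
    exact (sum_congr rfl fun i _ => faceSimplex_apply_emb h x i).trans x.2.2
  refine ⟨fun v => ?_, ?_, s, hs, fun v hv => faceSimplex_apply_of_notMem h x hv⟩
  · by_cases hv : v ∈ s
    · rw [← Finset.map_orderEmbOfFin_univ s h, mem_map] at hv
      obtain ⟨i, _, rfl⟩ := hv
      exact (faceSimplex_apply_emb h x i).symm ▸ x.2.1 i
    · rw [faceSimplex_apply_of_notMem h x hv]
  · rw [← hsum]
    refine (sum_subset (subset_univ s) fun v _ hv => ?_).symm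
    exact faceSimplex_apply_of_notMem h x hv

theorem faceSimplex_injOn (n : ℕ) :
    Set.InjOn (faceSimplex n) {s : Finset (Fin N) | s.card = n} := by
  have key : ∀ s t : Finset (Fin N), s.card = n → t.card = n →
      faceSimplex n s = faceSimplex n t → s ⊆ t := by
    intro s t hs ht h v hv
    rw [← Finset.map_orderEmbOfFin_univ s hs, mem_map] at hv
    obtain ⟨i, _, rfl⟩ := hv
    by_contra hvt
    have h1 := faceSimplex_apply_emb hs (stdVertices n i) i
    rw [h] at h1
    have h2 := (faceSimplex_apply_of_notMem ht (stdVertices n i) hvt).symm.trans h1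
    have h3 : stdVertices n i i = 1 :=
      (congrFun (stdSimplex.vertex_coe i) i).trans (Pi.single_eq_same i 1)
    exact zero_ne_one (h2.trans h3)
  intro s hs t ht h
  exact (key s t hs ht h).antisymm (key t s ht hs h.symm)

theorem faceSimplex_comp_faceMap {n : ℕ} {s : Finset (Fin N)} (h : s.card = n + 1)
    (i : Fin (n + 1)) :
    (faceSimplex (n + 1) s).comp (faceMap i) = faceSimplex n (s.erase (s.orderEmbOfFin h i)) := by
  unfold faceSimplex
  rw [ContinuousMap.comp_assoc, affSimplex_comp_faceMap]
  congr 2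
  have hc : (s.erase (s.orderEmbOfFin h i)).card = n := by
    rw [card_erase_of_mem (orderEmbOfFin_mem s h i), h, Nat.add_sub_cancel]
  have he : (s.orderEmbOfFin h ∘ i.succAbove) =
      (s.erase (s.orderEmbOfFin h i)).orderEmbOfFin hc := by
    refine orderEmbOfFin_unique hc (fun j => ?_)
      ((s.orderEmbOfFin h).strictMono.comp (Fin.strictMono_succAbove i))
    rw [mem_erase]
    refine ⟨fun hj => ?_, orderEmbOfFin_mem s h _⟩
    exact Fin.succAbove_ne i j ((s.orderEmbOfFin h).injective hj)
  ext1 j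
  ext1
  simp only [Function.comp_apply, faceVertex, h, hc, dif_pos]
  rw [← he]
  rfl

/-- The singular chain of a simplicial chain. -/
def toSing (n : ℕ) : FChain (Fin N) →ₗ[ZMod 2] SChain (EuclideanSpace ℝ (Fin N)) n :=
  Finsupp.lmapDomain _ _ (faceSimplex n)

theorem toSing_single (n : ℕ) (s : Finset (Fin N)) (a : ZMod 2) :
    toSing n (Finsupp.single s a) = Finsupp.single (faceSimplex n s) a := by
  simp [toSing]

theorem bd_toSing {F : Set (Finset (Fin N))} {n : ℕ} {c : FChain (Fin N)}
    (hc : c ∈ FIn F (n + 1)) : bd (toSing (n + 1) c) = toSing n (fbd c) := by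
  rw [← sub_eq_zero, ← Submodule.mem_bot (ZMod 2)]
  refine map_mem_of_mem_supported (L := bd ∘ₗ toSing (n + 1) - toSing n ∘ₗ fbd)
    (fun s hs => ?_) hc
  rw [Submodule.mem_bot, LinearMap.sub_apply, sub_eq_zero, LinearMap.comp_apply,
    LinearMap.comp_apply, toSing_single, bd_single, fbd_single, map_sum]
  simp only [toSing_single]
  rw [sum_congr rfl fun i _ => by rw [faceSimplex_comp_faceMap hs.2 i]]
  conv_rhs => rw [← Finset.map_orderEmbOfFin_univ s hs.2, sum_map]
  refine sum_congr rfl fun i _ => ?_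
  rw [Finset.map_orderEmbOfFin_univ]
  rfl

theorem toSing_injOn {F : Set (Finset (Fin N))} {n : ℕ} {c d : FChain (Fin N)}
    (hc : c ∈ FIn F n) (hd : d ∈ FIn F n) (h : toSing n c = toSing n d) : c = d := by
  refine Finsupp.mapDomain_injOn {s : Finset (Fin N) | s.card = n} (faceSimplex_injOn n)
    ?_ ?_ h
  · exact fun s hs => (((Finsupp.mem_supported _ _).1 hc) hs).2
  · exact fun s hs => (((Finsupp.mem_supported _ _).1 hd) hs).2

theorem toSing_mem_SIn {F : Set (Finset (Fin N))} {n : ℕ} {c : FChain (Fin N)}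
    (hc : c ∈ FIn F n) : toSing n c ∈ SIn (geom F) n := by
  refine map_mem_of_mem_supported (L := toSing n) (fun s hs => ?_) hc
  rw [toSing_single]
  exact single_mem_SIn (fun x => faceSimplex_mem_geom hs.1 hs.2 x) _

/-- The singular chains which come from simplicial chains. -/
def SimpIn (F : Set (Finset (Fin N))) (n : ℕ) :
    Submodule (ZMod 2) (SChain (EuclideanSpace ℝ (Fin N)) n) :=
  (FIn F n).map (toSing n)

theorem SimpIn_le (F : Set (Finset (Fin N))) (n : ℕ) : SimpIn F n ≤ SIn (geom F) n := by
  rintro _ ⟨c, hc, rfl⟩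
  exact toSing_mem_SIn hc

theorem SimpIn_mono {F G : Set (Finset (Fin N))} (h : F ⊆ G) (n : ℕ) : SimpIn F n ≤ SimpIn G n :=
  Submodule.map_mono (FIn_mono h n)

theorem SimpIn_union (F G : Set (Finset (Fin N))) (n : ℕ) :
    SimpIn (F ∪ G) n = SimpIn F n ⊔ SimpIn G n := by
  unfold SimpIn FIn
  rw [← Submodule.map_sup, ← Finsupp.supported_union]
  congr 2
  ext s
  simp only [Set.mem_union, Set.mem_ofPred_eq]
  tauto

theorem mem_SimpIn_inter {F G : Set (Finset (Fin N))} {n : ℕ}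
    {c : SChain (EuclideanSpace ℝ (Fin N)) n} (h1 : c ∈ SimpIn F n) (h2 : c ∈ SimpIn G n) :
    c ∈ SimpIn (F ∩ G) n := by
  obtain ⟨a, ha, rfl⟩ := h1
  obtain ⟨b, hb, hab⟩ := h2
  have : b = a := toSing_injOn (FIn_mono (Set.subset_univ _) n hb)
    (FIn_mono (Set.subset_univ _) n ha) hab
  subst this
  refine ⟨b, ?_, rfl⟩
  rw [SetLike.mem_coe, FIn, Finsupp.mem_supported] at ha hb ⊢
  exact fun s hs => ⟨⟨(ha hs).1, (hb hs).1⟩, (ha hs).2⟩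

theorem bd_mem_SimpIn {F : Set (Finset (Fin N))} (hF : IsLowerSet F) {n : ℕ}
    {c : SChain (EuclideanSpace ℝ (Fin N)) (n + 1)} (hc : c ∈ SimpIn F (n + 1)) :
    bd c ∈ SimpIn F n := by
  obtain ⟨a, ha, rfl⟩ := hc
  rw [bd_toSing ha]
  exact ⟨_, fbd_mem_FIn hF ha, rfl⟩

/-- The only singular simplex without vertices is the empty one, which is simplicial. -/
theorem SIn_zero_le {F : Set (Finset (Fin N))} (h : ∅ ∈ F) (A : Set (EuclideanSpace ℝ (Fin N))) :
    SIn A 0 ≤ SimpIn F 0 := by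
  intro c hc
  refine map_mem_of_mem_SIn (L := LinearMap.id) (fun σ _ => ?_) hc
  refine ⟨Finsupp.single ∅ 1, single_mem_FIn h rfl, ?_⟩
  rw [toSing_single, LinearMap.id_apply]
  congr 1
  ext1 x
  exact absurd x.2.2 (by simp)

end Geom

/-! ### Straight-line homotopies -/

section Line

variable {Y E : Type*} [TopologicalSpace Y] [NormedAddCommGroup E] [NormedSpace ℝ E]

/-- The straight-line homotopy between two maps. -/
def lineHomotopy (f g : C(Y, E)) : C(Y × unitInterval, E) where
  toFun z := (1 - (z.2 : ℝ)) • f z.1 + (z.2 : ℝ) • g z.1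
  continuous_toFun := by fun_prop

theorem lineHomotopy_zero (f g : C(Y, E)) : homotopyAt (lineHomotopy f g) 0 = f := by
  ext y
  simp [homotopyAt, lineHomotopy]

theorem lineHomotopy_one (f g : C(Y, E)) : homotopyAt (lineHomotopy f g) 1 = g := by
  ext y
  simp [homotopyAt, lineHomotopy]

theorem bd_prismOp_line (f g : C(Y, E)) {n : ℕ} (c : SChain Y (n + 1)) :
    bd (prismOp (lineHomotopy f g) (n + 1) c) =
      push f c + push g c + prismOp (lineHomotopy f g) n (bd c) := by
  rw [bd_prismOp, lineHomotopy_zero, lineHomotopy_one]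

end Line

theorem push_id {X : Type*} [TopologicalSpace X] {n : ℕ} (c : SChain X n) :
    push (ContinuousMap.id X) c = c :=
  Finsupp.mapDomain_id

/-! ### Constant chains -/

section Const

variable {X : Type*} [TopologicalSpace X]

/-- A cycle of constant simplices is a boundary. -/
theorem exists_bd_eq_push_const {A : Set X} {p : X} (hp : p ∈ A) {n : ℕ} {c : SChain X (n + 1)}
    (hc : bd c = 0) : ∃ e ∈ SIn A (n + 2), bd e = push (ContinuousMap.const X p) c := by
  let k : ∀ m, SChain X m := fun m => Finsupp.single (ContinuousMap.const _ p) 1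
  have hk : ∀ m, bd (k (m + 1)) = ((m + 1 : ℕ) : ZMod 2) • k m := by
    intro m
    rw [bd_single, sum_congr rfl fun i _ => by rw [ContinuousMap.const_comp], sum_const,
      card_univ, Fintype.card_fin, Nat.cast_smul_eq_nsmul]
  obtain ⟨a, ha⟩ : ∃ a : ZMod 2, a • k (n + 1) = push (ContinuousMap.const X p) c := by
    rw [← Submodule.mem_span_singleton]
    refine map_mem_of_mem_SIn (L := push _) (fun σ _ => ?_) (SIn_univ _ c)
    rw [push_single, ContinuousMap.const_comp]
    exact Submodule.mem_span_singleton_self _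
  have h0 : a * ((n + 1 : ℕ) : ZMod 2) = 0 := by
    have h1 := bd_push (ContinuousMap.const X p) c
    rw [hc, map_zero, ← ha, map_smul, hk, smul_smul] at h1
    have h2 := DFunLike.congr_fun h1 (ContinuousMap.const _ p)
    simpa [k] using h2
  -- A constant simplex with `n + 2` vertices has `n + 2` equal faces; since `a * (n + 1) = 0`, the
  -- factor `a * (n + 2)` equals `a`.
  refine ⟨a • k (n + 2), Submodule.smul_mem _ _ (single_mem_SIn (fun _ => hp) _), ?_⟩
  rw [map_smul, hk, ← ha, smul_smul]
  congr 1
  push_cast at h0 ⊢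
  linear_combination h0

end Const

/-! ### Simplicial and singular chains of a complex -/

section Comparison

variable {N : ℕ}

/-- The relative chains of `geom F` modulo the simplicial chains are acyclic. -/
def RelAcyclic (F : Set (Finset (Fin N))) : Prop :=
  ∀ (n : ℕ), ∀ c ∈ SIn (geom F) (n + 1), bd c ∈ SimpIn F n →
    ∃ s ∈ SimpIn F (n + 1), ∃ e ∈ SIn (geom F) (n + 2), c = s + bd e

/-- The chains of `geom F ∪ geom G` modulo those of `geom F` and of `geom G` are acyclic. -/
def Excisive (F G : Set (Finset (Fin N))) : Prop :=
  ∀ (n : ℕ), ∀ c ∈ SIn (geom (F ∪ G)) (n + 1), bd c ∈ SIn (geom F) n ⊔ SIn (geom G) n →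
    ∃ a ∈ SIn (geom F) (n + 1), ∃ b ∈ SIn (geom G) (n + 1), ∃ e ∈ SIn (geom (F ∪ G)) (n + 2),
      c = a + b + bd e

/-- Mayer–Vietoris by hand. With `c = a + b + bd e` and `bd a + bd b = s + t`, the chain `bd a + s =
bd b + t` lies over the intersection, where it is simplicial up to some `bd f`. Then `a + f` and `b
+ f` have simplicial boundaries and are handled separately; the two copies of `f` cancel. -/
theorem RelAcyclic.union {F G : Set (Finset (Fin N))} (hF : IsLowerSet F) (hG : IsLowerSet G)
    (hF0 : ∅ ∈ F) (hG0 : ∅ ∈ G) (hexc : Excisive F G) (h1 : RelAcyclic F) (h2 : RelAcyclic G)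
    (h3 : RelAcyclic (F ∩ G)) : RelAcyclic (F ∪ G) := by
  intro n c hc hbc
  have hbc' : bd c ∈ SIn (geom F) n ⊔ SIn (geom G) n := by
    rw [SimpIn_union] at hbc
    exact sup_le_sup (SimpIn_le F n) (SimpIn_le G n) hbc
  obtain ⟨a, ha, b, hb, e, he, rfl⟩ := hexc n c hc hbc'
  rw [map_add, bd_bd, add_zero, map_add, SimpIn_union] at hbc
  obtain ⟨s, hs, t, ht, hst⟩ := Submodule.mem_sup.1 hbc
  have hw : bd a + s = bd b + t := by
    have h : (bd a + s) + (bd b + t) = 0 := by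
      rw [show bd a + s + (bd b + t) = (bd a + bd b) + (s + t) by abel, hst, ZModModule.add_self]
    rw [← ZModModule.sub_eq_add] at h
    exact sub_eq_zero.1 h
  have hwL : bd a + s ∈ SIn (geom (F ∩ G)) n := by
    rw [geom_inter hF hG, SIn_inter]
    exact ⟨add_mem (bd_mem_SIn ha) (SimpIn_le F n hs),
      hw ▸ add_mem (bd_mem_SIn hb) (SimpIn_le G n ht)⟩
  obtain ⟨u, hu, f, hf, hwu⟩ : ∃ u ∈ SimpIn (F ∩ G) n, ∃ f ∈ SIn (geom (F ∩ G)) (n + 1),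
      bd a + s = u + bd f := by
    -- The acyclicity hypothesis says nothing in augmentation degree, where every chain is
    -- simplicial anyway.
    cases n with
    | zero => exact ⟨_, SIn_zero_le (F := F ∩ G) ⟨hF0, hG0⟩ _ hwL, 0, zero_mem _, by simp⟩
    | succ m =>
      refine h3 m _ hwL (mem_SimpIn_inter ?_ ?_)
      · rw [map_add, bd_bd, zero_add]
        exact bd_mem_SimpIn hF hs
      · rw [hw, map_add, bd_bd, zero_add]
        exact bd_mem_SimpIn hG ht
  have hfF := SIn_mono (geom_mono (Set.inter_subset_left (s := F) (t := G))) _ hf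
  have hfG := SIn_mono (geom_mono (Set.inter_subset_right (s := F) (t := G))) _ hf
  have aux : ∀ x y z w : SChain (EuclideanSpace ℝ (Fin N)) n, x + y = z + w → x + w = y + z := by
    intro x y z w h
    have : x = z + w - y := eq_sub_of_add_eq h
    rw [this, ZModModule.sub_eq_add, show z + w + y + w = y + z + (w + w) by abel,
      ZModModule.add_self, add_zero]
  obtain ⟨s', hs', p, hp, hap⟩ := h1 n (a + f) (add_mem ha hfF) (by
    rw [map_add, aux _ _ _ _ hwu]
    exact add_mem hs (SimpIn_mono Set.inter_subset_left n hu))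
  obtain ⟨t', ht', q, hq, hbq⟩ := h2 n (b + f) (add_mem hb hfG) (by
    rw [map_add, aux _ _ _ _ (hw.symm.trans hwu)]
    exact add_mem ht (SimpIn_mono Set.inter_subset_right n hu))
  refine ⟨s' + t', ?_, p + q + e, ?_, ?_⟩
  · rw [SimpIn_union]
    exact Submodule.add_mem_sup hs' ht'
  · exact add_mem (add_mem (SIn_mono (geom_mono Set.subset_union_left) _ hp)
      (SIn_mono (geom_mono Set.subset_union_right) _ hq)) he
  · rw [map_add, map_add, show s' + t' + (bd p + bd q + bd e) =
      (s' + bd p) + (t' + bd q) + bd e by abel, ← hap, ← hbq,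
      show a + f + (b + f) = a + b + (f + f) by abel, ZModModule.add_self, add_zero]

theorem lineHomotopy_mem_geom {Y : Type*} [TopologicalSpace Y] {F : Set (Finset (Fin N))}
    {f g : C(Y, EuclideanSpace ℝ (Fin N))} {y : Y} {s : Finset (Fin N)} (hs : s ∈ F)
    (hf : f y ∈ geom F) (hg : g y ∈ geom F) (hfs : ∀ v, v ∉ s → f y v = 0)
    (hgs : ∀ v, v ∉ s → g y v = 0) (t : unitInterval) : lineHomotopy f g (y, t) ∈ geom F := by
  have h0 := t.2.1
  have h1 := t.2.2
  refine ⟨fun v => ?_, ?_, s, hs, fun v hv => ?_⟩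
  · have := hf.1 v
    have := hg.1 v
    simp only [lineHomotopy, ContinuousMap.coe_mk, PiLp.add_apply, PiLp.smul_apply, smul_eq_mul]
    have : 0 ≤ 1 - (t : ℝ) := by linarith
    positivity
  · simp only [lineHomotopy, ContinuousMap.coe_mk, PiLp.add_apply, PiLp.smul_apply, smul_eq_mul,
      sum_add_distrib, ← mul_sum, hf.2.1, hg.2.1]
    ring
  · simp [lineHomotopy, hfs v hv, hgs v hv]

theorem single_mem_geom {F : Set (Finset (Fin N))} {v : Fin N} (hv : {v} ∈ F) :
    EuclideanSpace.single v (1 : ℝ) ∈ geom F := by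
  refine ⟨fun w => ?_, by simp, {v}, hv, fun w hw => ?_⟩
  · rw [PiLp.single_apply]
    split_ifs <;> norm_num
  · rw [PiLp.single_apply, if_neg (by simpa using hw)]

/-- The chains of a cone are acyclic. -/
theorem exists_bd_eq_of_cone {F : Set (Finset (Fin N))} (hF0 : ∅ ∈ F)
    {v : Fin N} (hv : ∀ s ∈ F, insert v s ∈ F) {n : ℕ}
    {c : SChain (EuclideanSpace ℝ (Fin N)) (n + 1)} (hc : c ∈ SIn (geom F) (n + 1))
    (hbc : bd c = 0) : ∃ e ∈ SIn (geom F) (n + 2), bd e = c := by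
  have hp : EuclideanSpace.single v (1 : ℝ) ∈ geom F :=
    single_mem_geom (by simpa using hv ∅ hF0)
  obtain ⟨e, he, hbe⟩ := exists_bd_eq_push_const hp hbc
  let H := lineHomotopy (ContinuousMap.id (EuclideanSpace ℝ (Fin N)))
    (ContinuousMap.const _ (EuclideanSpace.single v (1 : ℝ)))
  refine ⟨prismOp H (n + 1) c + e, add_mem (prismOp_mem_SIn (A := geom F) ?_ hc) he, ?_⟩
  · intro y hy t
    obtain ⟨s, hs, hys⟩ := hy.2.2
    refine lineHomotopy_mem_geom (hv s hs) hy hp (fun w hw => ?_) (fun w hw => ?_) t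
    · exact hys w fun h => hw (mem_insert_of_mem h)
    · have : w ≠ v := fun h => hw (h ▸ mem_insert_self v s)
      simp [this]
  · rw [map_add, bd_prismOp_line, hbe, hbc, map_zero, add_zero, push_id, add_assoc,
      ZModModule.add_self, add_zero]

/-- Both theories are acyclic on a cone: the simplicial boundary of `c` is coned off from `v`, and
what then remains is a singular cycle, which bounds by contraction to `v`. -/
theorem relAcyclic_of_cone {F : Set (Finset (Fin N))} (hF : IsLowerSet F) (hF0 : ∅ ∈ F)
    {v : Fin N} (hv : ∀ s ∈ F, insert v s ∈ F) : RelAcyclic F := by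
  rintro n c hc ⟨t, ht, htc⟩
  have ht0 : fbd t = 0 := by
    cases n with
    | zero => exact fbd_eq_zero_of_mem_FIn ht
    | succ n =>
      refine toSing_injOn (fbd_mem_FIn hF ht) (zero_mem (FIn F n)) ?_
      rw [← bd_toSing ht, htc, bd_bd, map_zero]
  have ht1 : fbd (fcone v t) = t := by rw [fbd_fcone, ht0, map_zero, add_zero]
  have hmem : toSing (n + 1) (fcone v t) ∈ SimpIn F (n + 1) := ⟨_, fcone_mem_FIn hv ht, rfl⟩
  obtain ⟨e, he, hbe⟩ := exists_bd_eq_of_cone (c := c + toSing (n + 1) (fcone v t)) hF0 hv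
    (add_mem hc (SimpIn_le F _ hmem))
    (by rw [map_add, bd_toSing (fcone_mem_FIn hv ht), ht1, htc, ZModModule.add_self])
  refine ⟨_, hmem, e, he, ?_⟩
  rw [hbe, add_comm c, ← add_assoc, ZModModule.add_self, zero_add]

/-- The map which stretches the open star of the vertex `v`. -/
def stretch (v : Fin N) : C(EuclideanSpace ℝ (Fin N), EuclideanSpace ℝ (Fin N)) where
  toFun x := WithLp.toLp 2 fun w =>
    if w = v then 1 - (1 - x v) / max (1 - x v) (1 / 3) else x w / max (1 - x v) (1 / 3)
  continuous_toFun := by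
    refine (PiLp.continuous_toLp 2 _).comp (continuous_pi fun w => ?_)
    have h : ∀ x : EuclideanSpace ℝ (Fin N), max (1 - x v) (1 / 3 : ℝ) ≠ 0 := fun x =>
      (lt_of_lt_of_le (by norm_num) (le_max_right _ _)).ne'
    have hc : ∀ w : Fin N, Continuous fun x : EuclideanSpace ℝ (Fin N) => x w := fun w => by
      fun_prop
    split_ifs
    · exact continuous_const.sub ((continuous_const.sub (hc v)).div
        ((continuous_const.sub (hc v)).max continuous_const) h)
    · exact (hc w).div ((continuous_const.sub (hc v)).max continuous_const) h

theorem stretch_apply (v w : Fin N) (x : EuclideanSpace ℝ (Fin N)) : stretch v x w =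
    if w = v then 1 - (1 - x v) / max (1 - x v) (1 / 3) else x w / max (1 - x v) (1 / 3) := rfl

theorem stretch_eq_zero (v : Fin N) {x : EuclideanSpace ℝ (Fin N)} {w : Fin N} (hw : x w = 0) :
    stretch v x w = 0 := by
  rw [stretch_apply]
  split_ifs with h
  · subst h
    rw [hw]
    norm_num
  · rw [hw, zero_div]

theorem stretch_mem_geom {F : Set (Finset (Fin N))} (v : Fin N) {x : EuclideanSpace ℝ (Fin N)}
    (hx : x ∈ geom F) : stretch v x ∈ geom F := by
  obtain ⟨s, hs, hxs⟩ := hx.2.2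
  have hpos : (0 : ℝ) < max (1 - x v) (1 / 3) := lt_of_lt_of_le (by norm_num) (le_max_right _ _)
  refine ⟨fun w => ?_, ?_, s, hs, fun w hw => stretch_eq_zero v (hxs w hw)⟩
  · rw [stretch_apply]
    split_ifs
    · rw [sub_nonneg, div_le_one hpos]
      exact le_max_left _ _
    · exact div_nonneg (hx.1 w) hpos.le
  · have hsum := hx.2.1
    rw [← add_sum_erase _ _ (mem_univ v)] at hsum ⊢
    rw [sum_congr rfl fun w hw => by rw [stretch_apply, if_neg (ne_of_mem_erase hw)],
      stretch_apply, if_pos rfl, ← sum_div]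
    rw [show ∑ w ∈ univ.erase v, x w = 1 - x v by linarith]
    ring

/-- The closed star of a vertex. -/
def starOf (F : Set (Finset (Fin N))) (v : Fin N) : Set (Finset (Fin N)) :=
  {s | insert v s ∈ F}

/-- The faces which avoid a vertex. -/
def deletion (F : Set (Finset (Fin N))) (v : Fin N) : Set (Finset (Fin N)) :=
  {s | s ∈ F ∧ v ∉ s}

theorem deletion_union_starOf {F : Set (Finset (Fin N))} (hF : IsLowerSet F) (v : Fin N) :
    deletion F v ∪ starOf F v = F := by
  ext s
  constructor
  · rintro (h | h)
    · exact h.1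
    · exact hF (subset_insert v s) h
  · intro h
    by_cases hv : v ∈ s
    · exact Or.inr (by simpa [starOf, insert_eq_of_mem hv] using h)
    · exact Or.inl ⟨h, hv⟩

theorem isLowerSet_deletion {F : Set (Finset (Fin N))} (hF : IsLowerSet F) (v : Fin N) :
    IsLowerSet (deletion F v) := fun _ _ hst hs => ⟨hF hst hs.1, fun h => hs.2 (hst h)⟩

theorem isLowerSet_starOf {F : Set (Finset (Fin N))} (hF : IsLowerSet F) (v : Fin N) :
    IsLowerSet (starOf F v) := fun _ _ hst hs => hF (insert_subset_insert v hst) hs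

/-- The deletion and the star are not open, so the chain is first made small with respect to `x v <
2/3` and `0 < x v`. Where `x v ≤ 2/3`, the map `stretch v` is the projection away from `v`, so it
sends the first set into the deletion. A point with `0 < x v` lies only in faces containing `v`, so
the second set stays in the star. The straight-line homotopy from the identity to `stretch v` moves
each point inside its face. -/
theorem excisive_deletion_starOf {F : Set (Finset (Fin N))} (hF : IsLowerSet F) (v : Fin N) :
    Excisive (deletion F v) (starOf F v) := by
  intro n c hc hbc
  have hcont : Continuous fun x : EuclideanSpace ℝ (Fin N) => x v := by fun_prop
  obtain ⟨k, hk⟩ := exists_iterate_sSubdiv_small (A := geom (deletion F v ∪ starOf F v))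
    (U := {x | x v < 2 / 3}) (V := {x | 0 < x v})
    (isOpen_lt hcont continuous_const) (isOpen_lt continuous_const hcont)
    (fun x _ => by
      rcases lt_or_ge 0 (x v) with h | h
      · exact Or.inr h
      · exact Or.inl (show x v < 2 / 3 by linarith)) hc
  obtain ⟨e, w, hce, he, hw⟩ := exists_iterate_sSubdiv_homotopy c k
  set u := (sSubdiv (n + 1) ^ k) c with hu
  let H := lineHomotopy (ContinuousMap.id _) (stretch v)
  have hH : ∀ G : Set (Finset (Fin N)), ∀ y ∈ geom G, ∀ t, H (y, t) ∈ geom G := by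
    intro G y hy t
    obtain ⟨s, hs, hys⟩ := hy.2.2
    exact lineHomotopy_mem_geom hs hy (stretch_mem_geom v hy) hys
      (fun w hw => stretch_eq_zero v (hys w hw)) t
  have hp := bd_prismOp_line (ContinuousMap.id _) (stretch v) u
  rw [push_id] at hp
  have h1 : push (stretch v) u ∈ SIn (geom (deletion F v)) (n + 1) ⊔
      SIn (geom (starOf F v)) (n + 1) := by
    refine map_mem_SIn_sup (L := push (stretch v)) (fun c hc => push_mem_SIn ?_ hc)
      (fun c hc => push_mem_SIn ?_ hc) hk
    · rintro x ⟨hx, hxv⟩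
      have hxv' : x v < 2 / 3 := hxv
      have hz : stretch v x v = 0 := by
        rw [stretch_apply, if_pos rfl, max_eq_left (by linarith), div_self (by linarith), sub_self]
      have hm := stretch_mem_geom v hx
      rw [deletion_union_starOf hF] at hm
      obtain ⟨s, hs, hxs⟩ := hm.2.2
      refine ⟨hm.1, hm.2.1, s.erase v, ⟨hF (erase_subset v s) hs, by simp⟩, fun w hw => ?_⟩
      by_cases hwv : w = v
      · rw [hwv, hz]
      · exact hxs w fun h => hw (mem_erase.2 ⟨hwv, h⟩)
    · rintro x ⟨hx, hxv⟩
      refine stretch_mem_geom v ?_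
      rw [deletion_union_starOf hF] at hx
      obtain ⟨s, hs, hxs⟩ := hx.2.2
      have hvs : v ∈ s := by
        by_contra h
        exact (lt_irrefl (0 : ℝ)) (hxs v h ▸ hxv)
      exact ⟨hx.1, hx.2.1, s, by simpa [starOf, insert_eq_of_mem hvs] using hs, hxs⟩
  have h2 : prismOp H n (bd u) ∈ SIn (geom (deletion F v)) (n + 1) ⊔
      SIn (geom (starOf F v)) (n + 1) := by
    refine map_mem_SIn_sup (L := prismOp H n) (fun c hc => prismOp_mem_SIn (hH _) hc)
      (fun c hc => prismOp_mem_SIn (hH _) hc) ?_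
    rw [hu, bd_iterate_sSubdiv]
    exact map_mem_SIn_sup (fun c hc => iterate_sSubdiv_mem_SIn hc k)
      (fun c hc => iterate_sSubdiv_mem_SIn hc k) hbc
  obtain ⟨a, ha, b, hb, hab⟩ := Submodule.mem_sup.1 (add_mem (add_mem h1 h2) (hw _ _ hbc))
  refine ⟨a, ha, b, hb, e + prismOp H (n + 1) u, add_mem (he _ hc)
    (prismOp_mem_SIn (hH _) (iterate_sSubdiv_mem_SIn hc k)), ?_⟩
  rw [hab, map_add, hp, hce]
  rw [show push (stretch v) u + prismOp H n (bd u) + w +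
      (bd e + (u + push (stretch v) u + prismOp H n (bd u))) = u + bd e + w +
      (push (stretch v) u + push (stretch v) u) + (prismOp H n (bd u) + prismOp H n (bd u)) by abel,
    ZModModule.add_self, ZModModule.add_self, add_zero, add_zero]

/-- Simplicial and singular chains of a complex have the same homology. -/
theorem relAcyclic {F : Set (Finset (Fin N))} (hF : IsLowerSet F) (hF0 : ∅ ∈ F) :
    RelAcyclic F := by
  suffices h : ∀ (W : Finset (Fin N)) (F : Set (Finset (Fin N))), IsLowerSet F → ∅ ∈ F →
      (∀ s ∈ F, s ⊆ W) → RelAcyclic F from h univ F hF hF0 fun s _ => subset_univ s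
  clear hF hF0 F
  intro W
  -- Induction on the vertices in use: the deletion of `v`, and its intersection with the star, i.e.
  -- the link, only use vertices of `W`, while the star is a cone.
  induction W using Finset.induction_on with
  | empty =>
    intro F _ _ hW n c hc _
    refine ⟨0, zero_mem _, 0, zero_mem _, ?_⟩
    rw [map_zero, add_zero, ← Submodule.mem_bot (ZMod 2)]
    refine map_mem_of_mem_SIn (L := LinearMap.id) (fun σ hσ => ?_) hc
    obtain ⟨-, h1, s, hs, hx⟩ := hσ (stdVertices (n + 1) 0)
    rw [sum_eq_zero fun v _ => hx v fun h => absurd (hW s hs h) (by simp)] at h1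
    exact absurd h1 zero_ne_one
  | insert v W _ ih =>
    intro F hF hF0 hW
    by_cases hvF : {v} ∈ F
    · rw [← deletion_union_starOf hF v]
      have hD := isLowerSet_deletion hF v
      have hS := isLowerSet_starOf hF v
      have hD0 : ∅ ∈ deletion F v := ⟨hF0, by simp⟩
      have hS0 : ∅ ∈ starOf F v := by simpa [starOf] using hvF
      have hDW : ∀ s ∈ deletion F v, s ⊆ W := fun s hs a ha =>
        (mem_insert.1 (hW s hs.1 ha)).resolve_left fun h => hs.2 (h ▸ ha)
      refine RelAcyclic.union hD hS hD0 hS0 (excisive_deletion_starOf hF v)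
        (ih _ hD hD0 hDW) (relAcyclic_of_cone hS hS0 (v := v) fun s hs => ?_)
        (ih _ (hD.inter hS) ⟨hD0, hS0⟩ fun s hs => hDW s hs.1)
      simpa [starOf] using hs
    · refine ih F hF hF0 fun s hs a ha => (mem_insert.1 (hW s hs ha)).resolve_left ?_
      rintro rfl
      exact hvF (hF (singleton_subset_iff.2 ha) hs)

end Comparison

/-! ### Tightness -/

section Lift

variable {X : Type*} [TopologicalSpace X]

/-- The inclusion of a subset. -/
def inclMap (A : Set X) : C(A, X) := ⟨Subtype.val, continuous_subtype_val⟩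

theorem push_inclMap_injective (A : Set X) (n : ℕ) :
    Function.Injective (push (inclMap A) : SChain A n →ₗ[ZMod 2] SChain X n) := by
  refine Finsupp.mapDomain_injective fun σ τ h => ?_
  ext1 x
  exact Subtype.ext (DFunLike.congr_fun h x)

theorem push_inclMap_mem (A : Set X) {n : ℕ} (c : SChain A n) : push (inclMap A) c ∈ SIn A n :=
  push_mem_SIn (A := Set.univ) (fun x _ => x.2) (SIn_univ n c)

theorem exists_push_inclMap_eq {A : Set X} {n : ℕ} {c : SChain X n} (hc : c ∈ SIn A n) :
    ∃ c' : SChain A n, push (inclMap A) c' = c := by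
  have : LinearMap.id (R := ZMod 2) c ∈
      LinearMap.range (push (inclMap A) : SChain A n →ₗ[ZMod 2] SChain X n) := by
    refine map_mem_of_mem_SIn (L := LinearMap.id) (fun σ hσ => ?_) hc
    refine ⟨Finsupp.single ⟨fun x => ⟨σ x, hσ x⟩, by fun_prop⟩ 1, ?_⟩
    rw [push_single, LinearMap.id_apply]
    congr 1
  exact this

end Lift

section Tight

variable {N : ℕ}

/-- The faces of a complex with vertices in `U`. -/
def inducedFaces {V : Type*} (F : Set (Finset V)) (U : Finset V) : Set (Finset V) :=
  {s | s ∈ F ∧ s ⊆ U}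

theorem isLowerSet_inducedFaces {V : Type*} {F : Set (Finset V)} (hF : IsLowerSet F)
    (U : Finset V) : IsLowerSet (inducedFaces F U) :=
  fun _ _ hst hs => ⟨hF hst hs.1, hst.trans hs.2⟩

/-- Tightness of a simplicial complex, in terms of simplicial chains mod 2. -/
def SimpliciallyTight {V : Type*} [DecidableEq V] (F : Set (Finset V)) : Prop :=
  ∀ (U : Finset V) (n : ℕ), ∀ t ∈ FIn F (n + 2), fbd t ∈ FIn (inducedFaces F U) (n + 1) →
    ∃ t' ∈ FIn (inducedFaces F U) (n + 2), fbd t' = fbd t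

theorem convex_of_isHalfSpace {E : Type} [NormedAddCommGroup E] [NormedSpace ℝ E] {h : Set E}
    (hh : IsHalfSpace h) : Convex ℝ h ∧ Convex ℝ hᶜ := by
  obtain ⟨l, c, -, rfl | rfl⟩ := hh
  · refine ⟨convex_halfSpace_lt l.toLinearMap.isLinear c, ?_⟩
    convert convex_halfSpace_ge l.toLinearMap.isLinear c using 1
    ext x
    simp
  · refine ⟨convex_halfSpace_le l.toLinearMap.isLinear c, ?_⟩
    convert convex_halfSpace_gt l.toLinearMap.isLinear c using 1
    ext x
    simp

theorem mem_of_convex {h : Set (EuclideanSpace ℝ (Fin N))} (hh : Convex ℝ h) {s : Finset (Fin N)}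
    {x : EuclideanSpace ℝ (Fin N)} (h0 : ∀ v, 0 ≤ x v) (h1 : ∑ v, x v = 1)
    (hx : ∀ v, v ∉ s → x v = 0) (hs : ∀ v ∈ s, EuclideanSpace.single v (1 : ℝ) ∈ h) : x ∈ h := by
  have hx' : x = ∑ v ∈ s, x v • EuclideanSpace.single v (1 : ℝ) := by
    ext w
    rw [WithLp.ofLp_sum, Finset.sum_apply]
    simp only [PiLp.smul_apply, PiLp.single_apply, smul_eq_mul, mul_ite, mul_one, mul_zero]
    rw [sum_ite_eq s w]
    split_ifs with hw
    · rfl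
    · exact hx w hw
  rw [hx']
  refine hh.sum_mem (fun v _ => h0 v) ?_ hs
  rw [← h1]
  exact sum_subset (subset_univ s) fun v _ hv => hx v hv

/-- The map `r` forgets the coordinates at vertices outside `h` and renormalises. It is joined to
the inclusion by segments inside `h` and inside faces, so `geom F ∩ h` may be replaced by the
induced subcomplex on `U`, where the simplicial hypothesis applies. -/
theorem isTight_geom {F : Set (Finset (Fin N))} (hF : IsLowerSet F) (hF0 : ∅ ∈ F)
    (hT : SimpliciallyTight F) : IsTight (ZMod 2) (geom F) := by
  classical
  intro _ h hh i _
  obtain ⟨hconv, hconv'⟩ := convex_of_isHalfSpace hh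
  refine injective_homologyInclusion _ i fun z e hze => ?_
  let A := geom F ∩ h
  let U : Finset (Fin N) := univ.filter fun v => EuclideanSpace.single v (1 : ℝ) ∈ h
  have hFU : IsLowerSet (inducedFaces F U) := isLowerSet_inducedFaces hF U
  have hFU0 : ∅ ∈ inducedFaces F U := ⟨hF0, empty_subset U⟩
  have hle : inducedFaces F U ⊆ F := fun s hs => hs.1
  have hgeomU : geom (inducedFaces F U) ⊆ A := by
    intro x hx
    refine ⟨geom_mono hle hx, ?_⟩
    obtain ⟨s, hs, hxs⟩ := hx.2.2
    exact mem_of_convex hconv hx.1 hx.2.1 hxs fun v hv => (mem_filter.1 (hs.2 hv)).2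
  -- Otherwise `x` would be a convex combination of vertices in the complement of `h`, which is
  -- convex as well.
  have hpos : ∀ x : A, 0 < ∑ v ∈ U, (x : EuclideanSpace ℝ (Fin N)) v := by
    intro x
    refine (sum_nonneg fun v _ => x.2.1.1 v).lt_of_ne fun h0 => ?_
    have hz := (sum_eq_zero_iff_of_nonneg fun v _ => x.2.1.1 v).1 h0.symm
    refine mem_of_convex (s := Uᶜ) hconv' x.2.1.1 x.2.1.2.1 (fun v hv => hz v ?_)
      (fun v hv => ?_) x.2.2
    · simpa using hv
    · simpa [U] using hv
  have hcoord : ∀ v : Fin N, Continuous fun x : A => (x : EuclideanSpace ℝ (Fin N)) v :=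
    fun v => by fun_prop
  let r : C(A, EuclideanSpace ℝ (Fin N)) :=
    { toFun := fun x => WithLp.toLp 2 fun v => if v ∈ U then
        (x : EuclideanSpace ℝ (Fin N)) v / ∑ v ∈ U, (x : EuclideanSpace ℝ (Fin N)) v else 0
      continuous_toFun := by
        refine (PiLp.continuous_toLp 2 _).comp (continuous_pi fun v => ?_)
        split_ifs
        · exact (hcoord v).div (continuous_finsetSum _ fun v _ => hcoord v)
            fun x => (hpos x).ne'
        · exact continuous_const }
  have hr : ∀ (x : A) (v : Fin N), r x v = if v ∈ U then
      (x : EuclideanSpace ℝ (Fin N)) v / ∑ v ∈ U, (x : EuclideanSpace ℝ (Fin N)) v else 0 :=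
    fun _ _ => rfl
  have hrs : ∀ (x : A) (v : Fin N), (x : EuclideanSpace ℝ (Fin N)) v = 0 → r x v = 0 := by
    intro x v hv
    rw [hr, hv, zero_div, ite_self]
  have hrmem : ∀ x : A, r x ∈ geom (inducedFaces F U) := by
    intro x
    obtain ⟨s, hs, hxs⟩ := x.2.1.2.2
    refine ⟨fun v => ?_, ?_, s ∩ U, ⟨hF inter_subset_left hs, inter_subset_right⟩,
      fun v hv => ?_⟩
    · rw [hr]
      split_ifs
      · exact div_nonneg (x.2.1.1 v) (hpos x).le
      · exact le_rfl
    · rw [sum_congr rfl fun v _ => hr x v, ← sum_filter, filter_mem_eq_inter, univ_inter,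
        ← sum_div, div_self (hpos x).ne']
    · by_cases hvU : v ∈ U
      · exact hrs x v (hxs v fun hvs => hv (mem_inter.2 ⟨hvs, hvU⟩))
      · rw [hr, if_neg hvU]
  let H := lineHomotopy (inclMap A) r
  have hHmem : ∀ (x : A) (t : unitInterval), H (x, t) ∈ A := by
    intro x t
    obtain ⟨s, hs, hxs⟩ := x.2.1.2.2
    refine ⟨lineHomotopy_mem_geom hs x.2.1 (geom_mono hle (hrmem x)) hxs
      (fun v hv => hrs x v (hxs v hv)) t, ?_⟩
    exact hconv x.2.2 (hgeomU (hrmem x)).2 (by linarith [t.2.2]) t.2.1 (by ring)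
  have hinc : push (inclMap A) z = bd (push (inclMap (geom F)) e) := by
    rw [bd_push, hze, push_push]
    rfl
  have hz : bd z = 0 := by
    apply push_inclMap_injective A i
    rw [← bd_push, hinc, bd_bd, map_zero]
  have hD := bd_prismOp_line (inclMap A) r z
  rw [hz, map_zero, add_zero] at hD
  have hDmem : prismOp H (i + 1) z ∈ SIn A (i + 2) :=
    prismOp_mem_SIn (A := Set.univ) (fun y _ t => hHmem y t) (SIn_univ _ z)
  have hrz : push r z ∈ SIn (geom (inducedFaces F U)) (i + 1) :=
    push_mem_SIn (A := Set.univ) (fun x _ => hrmem x) (SIn_univ _ z)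
  obtain ⟨_, ⟨t, ht, rfl⟩, f, hf, hsf⟩ := relAcyclic hFU hFU0 i _ hrz
    (by rw [bd_push, hz, map_zero]; exact zero_mem _)
  have hs : bd (push (inclMap (geom F)) e + prismOp H (i + 1) z + f) = toSing (i + 1) t := by
    rw [map_add, map_add, ← hinc, hD, hsf]
    rw [show ∀ a b c : SChain (EuclideanSpace ℝ (Fin N)) (i + 1),
      a + (a + (b + c)) + c = (a + a) + b + (c + c) from fun a b c => by abel,
      ZModModule.add_self, ZModModule.add_self, add_zero, zero_add]
  obtain ⟨_, ⟨t₂, ht₂, rfl⟩, g, -, hg⟩ := relAcyclic hF hF0 (i + 1) _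
    (add_mem (add_mem (push_inclMap_mem (geom F) e)
      (SIn_mono Set.inter_subset_left _ hDmem)) (SIn_mono (geom_mono hle) _ hf))
    (by rw [hs]; exact ⟨t, FIn_mono hle _ ht, rfl⟩)
  rw [hg, map_add, bd_bd, add_zero, bd_toSing ht₂] at hs
  have htt : fbd t₂ = t := toSing_injOn (fbd_mem_FIn hF ht₂) (FIn_mono hle _ ht) hs
  obtain ⟨t', ht', htt'⟩ := hT U i t₂ ht₂ (htt ▸ ht)
  -- The filling has three pieces: the simplicial filling `t'`, the correction `f` from singular to
  -- simplicial, and the trace of the deformation.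
  obtain ⟨e', he'⟩ := exists_push_inclMap_eq (A := A)
    (add_mem (add_mem (SIn_mono hgeomU _ (toSing_mem_SIn ht')) (SIn_mono hgeomU _ hf)) hDmem)
  refine ⟨e', push_inclMap_injective A _ ?_⟩
  rw [← bd_push, he', map_add, map_add, bd_toSing ht', htt', htt, hD, ← hsf,
    add_comm (push r z), add_assoc, ZModModule.add_self, add_zero]

theorem geom_insert_empty {V : Type} [Fintype V] (F : Set (Finset V)) :
    geom (insert ∅ F) = geom F := by
  refine Set.Subset.antisymm ?_ (geom_mono (Set.subset_insert _ _))
  rintro x ⟨h0, h1, s, rfl | hs, hx⟩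
  · rw [sum_eq_zero fun v _ => hx v (by simp)] at h1
    exact absurd h1 zero_ne_one
  · exact ⟨h0, h1, s, hs, hx⟩

end Tight

/-! ### More on simplicial chains -/

section FChainMore

variable {V : Type*} [DecidableEq V]

/-- The link of a vertex in a simplicial chain. -/
def flink (v : V) : FChain V →ₗ[ZMod 2] FChain V :=
  Finsupp.linearCombination (ZMod 2) fun s => if v ∈ s then Finsupp.single (s.erase v) 1 else 0

/-- The part of a simplicial chain which avoids a vertex. -/
def fdel (v : V) : FChain V →ₗ[ZMod 2] FChain V :=
  Finsupp.linearCombination (ZMod 2) fun s => if v ∈ s then 0 else Finsupp.single s 1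

theorem flink_single (v : V) (s : Finset V) : flink v (Finsupp.single s 1) =
    if v ∈ s then Finsupp.single (s.erase v) (1 : ZMod 2) else 0 := by
  simp [flink]

theorem fdel_single (v : V) (s : Finset V) : fdel v (Finsupp.single s 1) =
    if v ∈ s then 0 else Finsupp.single s (1 : ZMod 2) := by
  simp [fdel]

theorem fdel_add_fcone_flink (v : V) (c : FChain V) : fdel v c + fcone v (flink v c) = c := by
  refine SChain.hom_ext (f := fdel v + fcone v ∘ₗ flink v) (g := LinearMap.id) (fun s => ?_) c
  simp only [LinearMap.add_apply, LinearMap.comp_apply, fdel_single, flink_single,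
    LinearMap.id_apply]
  split_ifs with h
  · rw [fcone_single, if_neg (by simp), insert_erase h, zero_add]
  · rw [map_zero, add_zero]

theorem flink_fbd (v : V) (c : FChain V) : flink v (fbd c) = fbd (flink v c) := by
  refine SChain.hom_ext (f := flink v ∘ₗ fbd) (g := fbd ∘ₗ flink v) (fun s => ?_) c
  simp only [LinearMap.comp_apply, fbd_single, map_sum, flink_single, mem_erase]
  split_ifs with h
  · rw [fbd_single, ← add_sum_erase _ _ h, if_neg (by simp), zero_add]
    refine sum_congr rfl fun a ha => ?_
    rw [if_pos ⟨(ne_of_mem_erase ha).symm, h⟩, erase_right_comm]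
  · rw [LinearMap.map_zero fbd]
    refine sum_eq_zero fun a _ => ?_
    simp only [h, and_false, if_false]

theorem fbd_fbd (c : FChain V) : fbd (fbd c) = 0 := by
  have h : ∀ s : Finset V, fbd (fbd (Finsupp.single s 1)) = 0 := by
    intro s
    induction s using Finset.induction_on with
    | empty => simp [fbd_single]
    | insert a s ha ih =>
      have h : Finsupp.single (insert a s) (1 : ZMod 2) = fcone a (Finsupp.single s 1) := by
        rw [fcone_single, if_neg ha]
      rw [h, fbd_fcone, map_add, fbd_fcone, ih, map_zero, add_zero, ZModModule.add_self]
  have h' := SChain.hom_ext (f := fbd ∘ₗ fbd) (g := (0 : FChain V →ₗ[ZMod 2] FChain V))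
    (fun s => by rw [LinearMap.comp_apply, h, LinearMap.zero_apply]) c
  rwa [LinearMap.comp_apply, LinearMap.zero_apply] at h'

theorem flink_eq_zero {F : Set (Finset V)} {v : V} (hF : ∀ s ∈ F, v ∉ s) {n : ℕ} {c : FChain V}
    (hc : c ∈ FIn F n) : flink v c = 0 := by
  rw [← Submodule.mem_bot (ZMod 2)]
  refine map_mem_of_mem_supported (L := flink v) (fun s hs => ?_) hc
  rw [flink_single, if_neg (hF s hs.1)]
  exact zero_mem _

theorem flink_mem_FIn {F G : Set (Finset V)} {v : V} (h : ∀ s ∈ F, v ∈ s → s.erase v ∈ G) {n : ℕ}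
    {c : FChain V} (hc : c ∈ FIn F (n + 1)) : flink v c ∈ FIn G n := by
  refine map_mem_of_mem_supported (L := flink v) (fun s hs => ?_) hc
  rw [flink_single]
  split_ifs with hv
  · exact single_mem_FIn (h s hs.1 hv) (by rw [card_erase_of_mem hv, hs.2, Nat.add_sub_cancel])
  · exact zero_mem _

theorem fdel_mem_FIn {F G : Set (Finset V)} {v : V} (h : ∀ s ∈ F, v ∉ s → s ∈ G) {n : ℕ}
    {c : FChain V} (hc : c ∈ FIn F n) : fdel v c ∈ FIn G n := by
  refine map_mem_of_mem_supported (L := fdel v) (fun s hs => ?_) hc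
  rw [fdel_single]
  split_ifs with hv
  · exact zero_mem _
  · exact single_mem_FIn (h s hs.1 hv) hs.2

theorem fcone_mem_FIn' {F G : Set (Finset V)} {v : V}
    {n : ℕ} (h : ∀ s ∈ F, s.card = n → v ∉ s → insert v s ∈ G)
    {c : FChain V} (hc : c ∈ FIn F n) : fcone v c ∈ FIn G (n + 1) := by
  refine map_mem_of_mem_supported (L := fcone v) (fun s hs => ?_) hc
  rw [fcone_single]
  split_ifs with hv
  · exact zero_mem _
  · exact single_mem_FIn (h s hs.1 hs.2 hv) (by rw [card_insert_of_notMem hv, hs.2])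

theorem fbd_flink_eq_zero {F : Set (Finset V)} {v : V} (hF : ∀ s ∈ F, v ∉ s) {n : ℕ} {c : FChain V}
    (hc : fbd c ∈ FIn F n) : fbd (flink v c) = 0 := by
  rw [← flink_fbd, flink_eq_zero hF hc]

theorem fbd_apply [Fintype V] (c : FChain V) (r : Finset V) :
    fbd c r = ∑ a ∈ univ.filter (· ∉ r), c (insert a r) := by
  have h := SChain.hom_ext (f := Finsupp.lapply (R := ZMod 2) (M := ZMod 2) r ∘ₗ fbd)
    (g := ∑ a ∈ univ.filter (· ∉ r), Finsupp.lapply (insert a r)) (fun s => ?_) c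
  · simpa using h
  · rw [LinearMap.comp_apply, fbd_single, LinearMap.sum_apply, map_sum]
    simp only [Finsupp.lapply_apply, Finsupp.single_apply]
    rw [← sum_filter, ← sum_filter]
    congr 1
    ext a
    simp only [mem_filter, mem_univ, true_and]
    constructor
    · rintro ⟨ha, rfl⟩
      exact ⟨by simp, (insert_erase ha).symm⟩
    · rintro ⟨ha, rfl⟩
      exact ⟨mem_insert_self a r, erase_insert ha⟩

end FChainMore

/-! ### The faces of Walkup's complex -/

section Walkup

/-- The faces of Walkup's complex, including the empty face. -/
def IsFace (s : Finset (Fin 9)) : Prop :=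
  ∃ i : Fin 9, s ⊆ {i, i + 2, i + 3, i + 4} ∨ s ⊆ {i, i + 1, i + 3, i + 4} ∨
    s ⊆ {i, i + 1, i + 2, i + 4}

instance : DecidablePred IsFace := fun s => by unfold IsFace; infer_instance

theorem IsFace.mono {s t : Finset (Fin 9)} (h : s ⊆ t) (ht : IsFace t) : IsFace s :=
  ht.imp fun _ hi => hi.imp h.trans (Or.imp h.trans h.trans)

theorem isLowerSet_isFace : IsLowerSet {s | IsFace s} := fun _ _ h hs => IsFace.mono h hs

theorem exists_subset_walkupTetrahedra_iff (s : Finset (Fin 9)) :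
    (∃ t ∈ walkupTetrahedra, s ⊆ t) ↔ IsFace s := by
  simp only [walkupTetrahedra_eq, mem_biUnion, mem_univ, true_and, mem_insert, mem_singleton,
    IsFace]
  constructor
  · rintro ⟨t, ⟨i, rfl | rfl | rfl⟩, h⟩
    · exact ⟨i, Or.inl h⟩
    · exact ⟨i, Or.inr (Or.inl h)⟩
    · exact ⟨i, Or.inr (Or.inr h)⟩
  · rintro ⟨i, h | h | h⟩
    · exact ⟨_, ⟨i, Or.inl rfl⟩, h⟩
    · exact ⟨_, ⟨i, Or.inr (Or.inl rfl)⟩, h⟩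
    · exact ⟨_, ⟨i, Or.inr (Or.inr rfl)⟩, h⟩

theorem insert_empty_walkup_faces :
    insert ∅ walkup.toPreAbstractSimplicialComplex.faces = {s | IsFace s} := by
  ext s
  rw [Set.mem_insert_iff, Set.mem_ofPred_eq, ← exists_subset_walkupTetrahedra_iff]
  constructor
  · rintro (rfl | h)
    · rw [exists_subset_walkupTetrahedra_iff]
      exact ⟨0, Or.inl (empty_subset _)⟩
    · exact h.2
  · intro h
    rcases s.eq_empty_or_nonempty with hs | hs
    · exact Or.inl hs
    · exact Or.inr ⟨hs, h⟩

theorem realization_walkup :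
    realization walkup.toPreAbstractSimplicialComplex = geom {s | IsFace s} := by
  rw [← insert_empty_walkup_faces, geom_insert_empty]
  rfl

theorem isFace_pair : ∀ a b : Fin 9, IsFace {a, b} := by decide +kernel

/-- The links of the vertices have a perfect elimination ordering. -/
theorem isFace_elimination : ∀ v a b c : Fin 9, a - v + 4 < b - v + 4 ∧ b - v + 4 < c - v + 4 ∧
    IsFace {v, a, c} → IsFace {v, a, b} ∧ IsFace {v, b, c} ∧ IsFace {a, b, c} := by
  decide +kernel

/-- The tetrahedron `{i, …, i + 4} \ {i + k + 1}`. -/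
def tetra (p : Fin 9 × Fin 3) : Finset (Fin 9) :=
  ({p.1, p.1 + 1, p.1 + 2, p.1 + 3, p.1 + 4} : Finset (Fin 9)).erase (p.1 + 1 + ⟨p.2.1, by omega⟩)

theorem card_tetra : ∀ p, (tetra p).card = 4 := by decide +kernel

theorem isFace_iff_tetra (s : Finset (Fin 9)) : IsFace s ↔ ∃ p, s ⊆ tetra p := by
  have h0 : ∀ i, tetra (i, 0) = {i, i + 2, i + 3, i + 4} := by decide +kernel
  have h1 : ∀ i, tetra (i, 1) = {i, i + 1, i + 3, i + 4} := by decide +kernel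
  have h2 : ∀ i, tetra (i, 2) = {i, i + 1, i + 2, i + 4} := by decide +kernel
  constructor
  · rintro ⟨i, h | h | h⟩
    · exact ⟨(i, 0), (h0 i).symm ▸ h⟩
    · exact ⟨(i, 1), (h1 i).symm ▸ h⟩
    · exact ⟨(i, 2), (h2 i).symm ▸ h⟩
  · rintro ⟨⟨i, k⟩, h⟩
    fin_cases k
    · exact ⟨i, Or.inl (h0 i ▸ h)⟩
    · exact ⟨i, Or.inr (Or.inl (h1 i ▸ h))⟩
    · exact ⟨i, Or.inr (Or.inr (h2 i ▸ h))⟩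

theorem card_le_of_isFace {s : Finset (Fin 9)} (h : IsFace s) : s.card ≤ 4 := by
  obtain ⟨p, hp⟩ := (isFace_iff_tetra s).1 h
  exact (card_le_card hp).trans (card_tetra p).le

theorem exists_eq_tetra {s : Finset (Fin 9)} (h : IsFace s) (hs : s.card = 4) :
    ∃ p, s = tetra p := by
  obtain ⟨p, hp⟩ := (isFace_iff_tetra s).1 h
  exact ⟨p, eq_of_subset_of_card_le hp (by rw [card_tetra, hs])⟩

theorem isFace_tetra (p : Fin 9 × Fin 3) : IsFace (tetra p) :=
  (isFace_iff_tetra _).2 ⟨p, Subset.rfl⟩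

/-- Every triangle lies in exactly two tetrahedra. -/
theorem card_cofaces_erase : ∀ p : Fin 9 × Fin 3, ∀ b ∈ tetra p,
    (univ.filter fun a => a ∉ (tetra p).erase b ∧ IsFace (insert a ((tetra p).erase b))).card =
      2 := by
  decide +kernel

/-- The tetrahedra at `v` which are equal or adjacent to one in `S`. -/
def grow (v : Fin 9) (S : Finset (Fin 9 × Fin 3)) : Finset (Fin 9 × Fin 3) :=
  univ.filter fun p => v ∈ tetra p ∧ ∃ q ∈ S, p = q ∨ (tetra p ∩ tetra q).card = 3

theorem iterate_grow : ∀ v : Fin 9,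
    (grow v)^[4] {(v, 0)} = univ.filter (fun p => v ∈ tetra p) := by
  decide +kernel

theorem exists_tetra_mem_mem : ∀ v w : Fin 9, ∃ p, v ∈ tetra p ∧ w ∈ tetra p := by
  decide +kernel

/-- Every triangle lies in exactly two tetrahedra. -/
theorem card_cofaces {r : Finset (Fin 9)} (hr : IsFace r) (hc : r.card = 3) :
    (univ.filter fun a => a ∉ r ∧ IsFace (insert a r)).card = 2 := by
  obtain ⟨p, hp⟩ := (isFace_iff_tetra r).1 hr
  obtain ⟨b, hb, rfl⟩ : ∃ b ∈ tetra p, r = (tetra p).erase b := by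
    obtain ⟨b, hb⟩ : ∃ b, b ∈ tetra p \ r := by
      rw [← Finset.Nonempty, ← card_pos, card_sdiff_of_subset hp, card_tetra, hc]
      norm_num
    rw [mem_sdiff] at hb
    refine ⟨b, hb.1, eq_of_subset_of_card_le (subset_erase.2 ⟨hp, hb.2⟩) ?_⟩
    rw [card_erase_of_mem hb.1, card_tetra, hc]
  exact card_cofaces_erase p b hb

end Walkup

/-! ### Simplicial tightness of Walkup's complex -/

theorem eq_zero_of_mem_FIn {V : Type*} {F : Set (Finset V)} {n : ℕ} (h : ∀ s ∈ F, s.card ≠ n)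
    {c : FChain V} (hc : c ∈ FIn F n) : c = 0 := by
  rw [← Finsupp.support_eq_empty, Finset.eq_empty_iff_forall_notMem]
  intro s hs
  have := ((Finsupp.mem_supported _ _).1 hc) hs
  exact h s this.1 this.2

theorem apply_eq_zero_of_mem_FIn {V : Type*} {F : Set (Finset V)} {n : ℕ} {c : FChain V}
    (hc : c ∈ FIn F n) {s : Finset V} (hs : ¬(s ∈ F ∧ s.card = n)) : c s = 0 := by
  by_contra h
  exact hs (((Finsupp.mem_supported _ _).1 hc) (Finsupp.mem_support_iff.2 h))

/-- The part of the link of `v` in Walkup's complex on the vertices in `Y`. -/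
def linkFaces (v : Fin 9) (Y : Finset (Fin 9)) : Set (Finset (Fin 9)) :=
  {s | s ⊆ Y ∧ IsFace (insert v s)}

/-- Let `a` be the first vertex of `Y` and `b` its first neighbour there in the link of `v`. By
`isFace_elimination`, for every other neighbour `c` both `{v, b, c}` and `{a, b, c}` are faces.
Adding the boundaries of triangles `{a, b, c}` therefore pushes the cycle off `a` without leaving
the link, and the filling never uses `v`, which is not in `Y`. -/
theorem exists_fbd_eq_of_mem_linkFaces (v : Fin 9) (Y : Finset (Fin 9)) :
    v ∉ Y → ∀ u ∈ FIn (linkFaces v Y) 2, fbd u = 0 →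
      ∃ q ∈ FIn (inducedFaces {s | IsFace s} Y) 3, fbd q = u := by
  -- The key runs from 0 at `v - 4` to 8 at `v + 4`, so it cuts the cycle ℤ/9 open opposite to `v`.
  induction Y using Finset.induction_on_min_value (fun a => a - v + 4) with
  | empty =>
    intro _ u hu _
    refine ⟨0, zero_mem _, ?_⟩
    rw [map_zero, eq_zero_of_mem_FIn (fun s hs => ?_) hu]
    rw [subset_empty.1 hs.1]
    simp
  | insert a Y haY hmin ih =>
    intro hv u hu hu0
    rw [mem_insert, not_or] at hv
    have hlink : flink a u ∈ FIn {s | s ⊆ Y ∧ IsFace (insert v (insert a s))} 1 := by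
      refine flink_mem_FIn (G := {s | s ⊆ Y ∧ IsFace (insert v (insert a s))})
        (fun s hs has => ⟨?_, ?_⟩) hu
      · exact (erase_subset_erase a hs.1).trans (erase_insert_subset a Y)
      · rw [insert_erase has]
        exact hs.2
    have hlink0 : fbd (flink a u) = 0 := by rw [← flink_fbd, hu0, map_zero]
    rcases (Y.filter fun c => IsFace {v, a, c}).eq_empty_or_nonempty with hN | hN
    · have hρ : flink a u = 0 := by
        refine eq_zero_of_mem_FIn (fun s hs hcard => ?_) hlink
        obtain ⟨c, rfl⟩ := card_eq_one.1 hcard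
        have : c ∈ (Y.filter fun c => IsFace {v, a, c}) :=
          mem_filter.2 ⟨singleton_subset_iff.1 hs.1, hs.2⟩
        rw [hN] at this
        exact notMem_empty _ this
      have hu' : u ∈ FIn (linkFaces v Y) 2 := by
        rw [← fdel_add_fcone_flink a u, hρ, map_zero, add_zero]
        exact fdel_mem_FIn (G := linkFaces v Y)
          (fun s hs has => ⟨(subset_insert_iff_of_notMem has).1 hs.1, hs.2⟩) hu
      obtain ⟨q, hq, hqu⟩ := ih hv.2 u hu' hu0
      exact ⟨q, FIn_mono (G := inducedFaces _ _)
        (fun s hs => ⟨hs.1, hs.2.trans (subset_insert a Y)⟩) _ hq, hqu⟩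
    · obtain ⟨b, hbN, hb⟩ := exists_min_image _ (fun c => c - v + 4) hN
      rw [mem_filter] at hbN
      have hinj : ∀ {x y : Fin 9}, x - v + 4 = y - v + 4 → x = y := fun h =>
        sub_left_injective (add_left_injective _ h)
      have hab : a - v + 4 < b - v + 4 :=
        lt_of_le_of_ne (hmin b hbN.1) fun h => haY (hinj h ▸ hbN.1)
      have hface : ∀ s ⊆ Y, IsFace (insert v (insert a s)) → s.card = 1 → b ∉ s →
          IsFace (insert v (insert b s)) ∧ IsFace (insert a (insert b s)) := by
        intro s hs hs' hcard hbs
        obtain ⟨c, rfl⟩ := card_eq_one.1 hcard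
        have hbc : b - v + 4 < c - v + 4 :=
          lt_of_le_of_ne (hb c (mem_filter.2 ⟨singleton_subset_iff.1 hs, hs'⟩))
            fun h => hbs (mem_singleton.2 (hinj h))
        exact (isFace_elimination v a b c ⟨hab, hbc, hs'⟩).2
      have hcone : fcone b (flink a u) ∈
          FIn {s | s ⊆ Y ∧ IsFace (insert v s) ∧ IsFace (insert a s)} 2 := by
        refine fcone_mem_FIn'
          (G := {s | s ⊆ Y ∧ IsFace (insert v s) ∧ IsFace (insert a s)})
          (fun s hs hcard hbs => ⟨?_, hface s hs.1 hs.2 hcard hbs⟩) hlink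
        exact insert_subset hbN.1 hs.1
      have hq0 : fcone a (fcone b (flink a u)) ∈
          FIn (inducedFaces {s | IsFace s} (insert a Y)) 3 :=
        fcone_mem_FIn' (G := inducedFaces _ _)
          (fun s hs _ _ => ⟨hs.2.2, insert_subset_insert a hs.1⟩) hcone
      have hbdq : fbd (fcone a (fcone b (flink a u))) =
          fcone b (flink a u) + fcone a (flink a u) := by
        rw [fbd_fcone, fbd_fcone, hlink0, map_zero, add_zero]
      -- The edges at `a` cancel, and edges at `b` in the link of `v` take their place.
      have hu' : u + fbd (fcone a (fcone b (flink a u))) = fdel a u + fcone b (flink a u) := by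
        rw [hbdq]
        nth_rewrite 1 [← fdel_add_fcone_flink a u]
        rw [add_comm (fcone b _), add_assoc, ← add_assoc (fcone a _), ZModModule.add_self, zero_add]
      obtain ⟨q, hq, hqu⟩ := ih hv.2 (fdel a u + fcone b (flink a u))
        (add_mem (fdel_mem_FIn (G := linkFaces v Y)
          (fun s hs has => ⟨(subset_insert_iff_of_notMem has).1 hs.1, hs.2⟩)
          hu) (FIn_mono (G := linkFaces v Y) (fun s hs => ⟨hs.1, hs.2.1⟩) _ hcone))
        (by rw [← hu', map_add, hu0, fbd_fbd, add_zero])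
      refine ⟨q + fcone a (fcone b (flink a u)),
        add_mem (FIn_mono (G := inducedFaces _ _)
          (fun s hs => ⟨hs.1, hs.2.trans (subset_insert a Y)⟩) _ hq) hq0, ?_⟩
      rw [map_add, hqu, ← hu', add_assoc, ZModModule.add_self, add_zero]

/-- The set `D` holds the candidates for removal. If `v` is outside `U`, its link in `t` is a cycle
because the boundary of `t` avoids `v`; replacing the cone from `v` over it by a filling without `v`
keeps the boundary. -/
theorem exists_fbd_eq_of_triangles (U D : Finset (Fin 9)) :
    ∀ t ∈ FIn (inducedFaces {s | IsFace s} (D ∪ U)) 3,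
      fbd t ∈ FIn (inducedFaces {s | IsFace s} U) 2 →
      ∃ t' ∈ FIn (inducedFaces {s | IsFace s} U) 3, fbd t' = fbd t := by
  induction D using Finset.induction_on with
  | empty =>
    intro t ht _
    rw [empty_union] at ht
    exact ⟨t, ht, rfl⟩
  | insert v D hvD ih =>
    intro t ht htU
    by_cases hv : v ∈ U
    · rw [insert_union, insert_eq_of_mem (mem_union_right D hv)] at ht
      exact ih t ht htU
    have hvY : v ∉ D ∪ U := by simp [hv, hvD]
    rw [insert_union] at ht
    have hu0 : fbd (flink v t) = 0 :=
      fbd_flink_eq_zero (fun s hs hvs => hv (hs.2 hvs)) htU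
    obtain ⟨q, hq, hqu⟩ := exists_fbd_eq_of_mem_linkFaces v (D ∪ U) hvY (flink v t)
      (flink_mem_FIn (G := linkFaces v (D ∪ U)) (fun s hs hvs =>
        ⟨(erase_subset_erase v hs.2).trans (erase_insert_subset _ _),
        by rw [insert_erase hvs]; exact hs.1⟩) ht) hu0
    have hbd : fbd (fdel v t + q) = fbd t := by
      nth_rewrite 2 [← fdel_add_fcone_flink v t]
      rw [map_add, map_add, fbd_fcone, hu0, map_zero, add_zero, hqu]
    obtain ⟨t', ht', h⟩ := ih (fdel v t + q)
      (add_mem (fdel_mem_FIn (G := inducedFaces {s | IsFace s} (D ∪ U))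
        (fun s hs hvs => ⟨hs.1, (subset_insert_iff_of_notMem hvs).1 hs.2⟩) ht) hq)
      (by rwa [hbd])
    exact ⟨t', ht', h.trans hbd⟩

/-- The sum of all tetrahedra of Walkup's complex. -/
def fundamentalCycle : FChain (Fin 9) :=
  ∑ s ∈ univ.filter (fun s : Finset (Fin 9) => IsFace s ∧ s.card = 4), Finsupp.single s 1

theorem fundamentalCycle_apply (s : Finset (Fin 9)) :
    fundamentalCycle s = if IsFace s ∧ s.card = 4 then 1 else 0 := by
  rw [fundamentalCycle, Finsupp.finsetSum_apply]
  simp only [Finsupp.single_apply]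
  rw [sum_ite_eq']
  simp

theorem fundamentalCycle_mem : fundamentalCycle ∈ FIn {s | IsFace s} 4 :=
  Submodule.sum_mem _ fun _ hs => single_mem_FIn (mem_filter.1 hs).2.1 (mem_filter.1 hs).2.2

theorem fbd_apply_eq_sum {c : FChain (Fin 9)} (hc : c ∈ FIn {s | IsFace s} 4)
    (r : Finset (Fin 9)) :
    fbd c r = ∑ a ∈ univ.filter (fun a => a ∉ r ∧ IsFace (insert a r)), c (insert a r) := by
  rw [fbd_apply, ← filter_filter, sum_filter (fun a => IsFace (insert a r))]
  refine sum_congr rfl fun a _ => ?_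
  split_ifs with h
  · rfl
  · exact apply_eq_zero_of_mem_FIn hc fun h' => h h'.1

theorem fbd_fundamentalCycle : fbd fundamentalCycle = 0 := by
  ext r
  rw [fbd_apply_eq_sum fundamentalCycle_mem, Finsupp.zero_apply]
  by_cases hr : IsFace r ∧ r.card = 3
  · rw [sum_congr rfl (g := fun _ => (1 : ZMod 2)), sum_const, card_cofaces hr.1 hr.2]
    · rfl
    · intro a ha
      rw [mem_filter] at ha
      rw [fundamentalCycle_apply, if_pos ⟨ha.2.2, by rw [card_insert_of_notMem ha.2.1, hr.2]⟩]
  · refine sum_eq_zero fun a ha => ?_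
    rw [mem_filter] at ha
    rw [fundamentalCycle_apply, if_neg]
    rintro ⟨h1, h2⟩
    rw [card_insert_of_notMem ha.2.1] at h2
    exact hr ⟨h1.mono (subset_insert a r), by omega⟩

/-- The common triangle lies in no further tetrahedron, so its coefficient in the boundary is the
sum of the two values of `t`; it vanishes as the triangle is not inside `U`. -/
theorem apply_tetra_eq {U : Finset (Fin 9)} {t : FChain (Fin 9)} (ht : t ∈ FIn {s | IsFace s} 4)
    (htU : fbd t ∈ FIn (inducedFaces {s | IsFace s} U) 3) {p q : Fin 9 × Fin 3}
    (hpq : (tetra p ∩ tetra q).card = 3) (hU : ¬tetra p ∩ tetra q ⊆ U) :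
    t (tetra p) = t (tetra q) := by
  have key : ∀ p q : Fin 9 × Fin 3, (tetra p ∩ tetra q).card = 3 →
      ∃ a ∉ tetra p ∩ tetra q, insert a (tetra p ∩ tetra q) = tetra p := by
    intro p q h
    obtain ⟨a, ha⟩ : ∃ a, a ∈ tetra p \ (tetra p ∩ tetra q) := by
      rw [← Finset.Nonempty, ← card_pos, card_sdiff_of_subset inter_subset_left, card_tetra, h]
      norm_num
    rw [mem_sdiff] at ha
    refine ⟨a, ha.2, eq_of_subset_of_card_le (insert_subset ha.1 inter_subset_left) ?_⟩
    rw [card_insert_of_notMem ha.2, h, card_tetra]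
  obtain ⟨a, ha, hp⟩ := key p q hpq
  obtain ⟨b, hb, hq⟩ := key q p (by rwa [inter_comm])
  rw [inter_comm] at hb hq
  have hr : IsFace (tetra p ∩ tetra q) := (isFace_tetra p).mono inter_subset_left
  have h0 : fbd t (tetra p ∩ tetra q) = 0 := apply_eq_zero_of_mem_FIn htU fun h => hU h.1.2
  have hp' := isFace_tetra p
  have hq' := isFace_tetra q
  rw [← hp] at hp' ⊢
  rw [← hq] at hq'
  nth_rewrite 2 [← hq]
  generalize tetra p ∩ tetra q = r at *
  rcases eq_or_ne a b with rfl | hab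
  · rfl
  have hfil : ({a, b} : Finset (Fin 9)) =
      univ.filter (fun a => a ∉ r ∧ IsFace (insert a r)) := by
    refine eq_of_subset_of_card_le ?_ (by rw [card_cofaces hr hpq, card_pair hab])
    intro c hc
    rw [mem_insert, mem_singleton] at hc
    rw [mem_filter]
    rcases hc with rfl | rfl
    · exact ⟨mem_univ _, ha, hp'⟩
    · exact ⟨mem_univ _, hb, hq'⟩
  rw [fbd_apply_eq_sum ht, ← hfil, sum_pair hab] at h0
  rwa [← ZModModule.sub_eq_add, sub_eq_zero] at h0

/-- The tetrahedra at `v` are connected through triangles containing `v`, none of which is inside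
`U`; four rounds of `grow` reach all of them. -/
theorem apply_tetra_eq_of_mem {U : Finset (Fin 9)} {t : FChain (Fin 9)}
    (ht : t ∈ FIn {s | IsFace s} 4) (htU : fbd t ∈ FIn (inducedFaces {s | IsFace s} U) 3)
    {v : Fin 9} (hv : v ∉ U) {p : Fin 9 × Fin 3} (hp : v ∈ tetra p) :
    t (tetra p) = t (tetra (v, 0)) := by
  have key : ∀ k, ∀ p ∈ (grow v)^[k] {(v, 0)}, v ∈ tetra p ∧ t (tetra p) = t (tetra (v, 0)) := by
    intro k
    induction k with
    | zero =>
      intro p hp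
      rw [Function.iterate_zero, id_eq, mem_singleton] at hp
      rw [hp]
      exact ⟨by simp [tetra], rfl⟩
    | succ k ih =>
      intro p hp
      rw [Function.iterate_succ_apply', grow, mem_filter] at hp
      obtain ⟨-, hvp, q, hq, rfl | hpq⟩ := hp
      · exact ih _ hq
      · refine ⟨hvp, (apply_tetra_eq ht htU hpq fun h => hv (h ?_)).trans (ih q hq).2⟩
        exact mem_inter.2 ⟨hvp, (ih q hq).1⟩
  refine (key 4 p ?_).2
  rw [iterate_grow, mem_filter]
  exact ⟨mem_univ p, hp⟩

/-- Any two vertices outside `U` lie in a common tetrahedron, so `t` takes one value on all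
tetrahedra not inside `U`. Adding that multiple of the fundamental cycle clears them without
changing the boundary. -/
theorem exists_fbd_eq_of_tetrahedra (U : Finset (Fin 9)) (t : FChain (Fin 9))
    (ht : t ∈ FIn {s | IsFace s} 4) (htU : fbd t ∈ FIn (inducedFaces {s | IsFace s} U) 3) :
    ∃ t' ∈ FIn (inducedFaces {s | IsFace s} U) 4, fbd t' = fbd t := by
  by_cases hU : ∀ v, v ∈ U
  · exact ⟨t, FIn_mono (G := inducedFaces _ U) (fun s hs => ⟨hs, fun v _ => hU v⟩) _ ht, rfl⟩
  push Not at hU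
  obtain ⟨v, hv⟩ := hU
  have hconst : ∀ p, ¬tetra p ⊆ U → t (tetra p) = t (tetra (v, 0)) := by
    intro p hp
    obtain ⟨w, hwp, hw⟩ := not_subset.1 hp
    obtain ⟨q, hvq, hwq⟩ := exists_tetra_mem_mem v w
    rw [apply_tetra_eq_of_mem ht htU hw hwp, ← apply_tetra_eq_of_mem ht htU hw hwq,
      apply_tetra_eq_of_mem ht htU hv hvq]
  refine ⟨t + t (tetra (v, 0)) • fundamentalCycle, ?_, ?_⟩
  · have hmem : t + t (tetra (v, 0)) • fundamentalCycle ∈ FIn {s | IsFace s} 4 :=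
      add_mem ht (Submodule.smul_mem _ _ fundamentalCycle_mem)
    refine (Finsupp.mem_supported _ _).2 fun s hs => ?_
    have hs' := ((Finsupp.mem_supported _ _).1 hmem) hs
    refine ⟨⟨hs'.1, ?_⟩, hs'.2⟩
    by_contra hsU
    obtain ⟨p, rfl⟩ := exists_eq_tetra hs'.1 hs'.2
    refine Finsupp.mem_support_iff.1 hs ?_
    rw [Finsupp.add_apply, Finsupp.smul_apply, fundamentalCycle_apply,
      if_pos ⟨isFace_tetra p, card_tetra p⟩, hconst p hsU,
      smul_eq_mul, mul_one]
    exact ZModModule.add_self _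
  · rw [map_add, map_smul, fbd_fundamentalCycle, smul_zero, add_zero]

theorem simpliciallyTight_isFace : SimpliciallyTight {s | IsFace s} := by
  intro U n t ht htU
  match n with
  | 0 =>
    rcases U.eq_empty_or_nonempty with rfl | ⟨w, hw⟩
    · refine ⟨0, zero_mem _, ?_⟩
      rw [map_zero, eq_zero_of_mem_FIn (fun s hs => ?_) htU]
      rw [subset_empty.1 hs.2]
      simp
    -- Two vertices always span an edge, so the boundary can be coned off from any `w` in `U`.
    · refine ⟨fcone w (fbd t),
        fcone_mem_FIn' (G := inducedFaces _ U) (fun s hs hcard _ => ?_) htU, ?_⟩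
      · obtain ⟨a, rfl⟩ := card_eq_one.1 hcard
        exact ⟨isFace_pair w a, insert_subset hw hs.2⟩
      · rw [fbd_fcone, fbd_fbd, map_zero, add_zero]
  | 1 =>
    exact exists_fbd_eq_of_triangles U univ t
      (FIn_mono (G := inducedFaces _ _)
        (fun s hs => ⟨hs, fun v _ => mem_union_left U (mem_univ v)⟩) _ ht) htU
  | 2 => exact exists_fbd_eq_of_tetrahedra U t ht htU
  | n + 3 =>
    have : t = 0 := eq_zero_of_mem_FIn (fun s hs hcard => by
      have := card_le_of_isFace hs
      omega) ht
    exact ⟨0, zero_mem _, by rw [this]⟩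

theorem isTight_walkup :
    IsTight (ZMod 2) (realization walkup.toPreAbstractSimplicialComplex) := by
  rw [realization_walkup]
  exact isTight_geom isLowerSet_isFace ⟨0, Or.inl (empty_subset _)⟩ simpliciallyTight_isFace

/-! ### Stellar subdivisions and PL homeomorphisms -/

theorem convexHull_subset_geom {N : ℕ} {F : Set (Finset (Fin N))} {s : Finset (Fin N)}
    (hs : s ∈ F) :
    convexHull ℝ ((fun v => EuclideanSpace.single v (1 : ℝ)) '' (s : Set (Fin N))) ⊆ geom F := by
  have hconv : Convex ℝ {x : EuclideanSpace ℝ (Fin N) |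
      (∀ v, 0 ≤ x v) ∧ ∑ v, x v = 1 ∧ ∀ v, v ∉ s → x v = 0} := by
    rintro x ⟨hx0, hx1, hx2⟩ y ⟨hy0, hy1, hy2⟩ a b ha hb hab
    refine ⟨fun v => ?_, ?_, fun v hv => ?_⟩
    · have := mul_nonneg ha (hx0 v)
      have := mul_nonneg hb (hy0 v)
      simp only [PiLp.add_apply, PiLp.smul_apply, smul_eq_mul]
      positivity
    · simp only [PiLp.add_apply, PiLp.smul_apply, smul_eq_mul]
      rw [sum_add_distrib, ← mul_sum, ← mul_sum, hx1, hy1, mul_one, mul_one, hab]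
    · simp [hx2 v hv, hy2 v hv]
  refine (convexHull_min ?_ hconv).trans fun x hx => ⟨hx.1, hx.2.1, s, hs, hx.2.2⟩
  rintro _ ⟨v, hv, rfl⟩
  refine ⟨fun w => ?_, ?_, fun w hw => ?_⟩
  · rw [PiLp.single_apply]
    split_ifs <;> norm_num
  · simp [PiLp.single_apply]
  · rw [PiLp.single_apply, if_neg]
    rintro rfl
    exact hw hv

theorem isCompactPolyhedron_geom {N : ℕ} (F : Set (Finset (Fin N))) :
    IsCompactPolyhedron (geom F) := by
  classical
  refine ⟨(univ.filter (· ∈ F)).image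
    fun s : Finset (Fin N) => (fun v => EuclideanSpace.single v (1 : ℝ)) '' (s : Set (Fin N)),
    ?_, ?_⟩
  · intro A hA
    obtain ⟨s, -, rfl⟩ := mem_image.1 hA
    exact s.finite_toSet.image _
  · refine Set.Subset.antisymm (fun x hx => ?_) (Set.iUnion₂_subset fun A hA => ?_)
    · obtain ⟨h0, h1, s, hs, h2⟩ := hx
      refine Set.mem_iUnion₂.2 ⟨_, mem_image_of_mem _ (mem_filter.2 ⟨mem_univ s, hs⟩), ?_⟩
      exact mem_of_convex (convex_convexHull ℝ _) h0 h1 h2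
        fun v hv => subset_convexHull ℝ _ ⟨v, hv, rfl⟩
    · obtain ⟨s, hs, rfl⟩ := mem_image.1 hA
      exact convexHull_subset_geom (mem_filter.1 hs).2

theorem IsCompactPolyhedron.image {E E' : Type} [AddCommGroup E] [Module ℝ E] [AddCommGroup E']
    [Module ℝ E'] {A : Set E} (hA : IsCompactPolyhedron A) (L : E →ₗ[ℝ] E') :
    IsCompactPolyhedron (L '' A) := by
  classical
  obtain ⟨F, hF, rfl⟩ := hA
  refine ⟨F.image fun A => L '' A, fun A hA => ?_, ?_⟩
  · obtain ⟨B, hB, rfl⟩ := mem_image.1 hA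
    exact (hF B hB).image _
  · rw [set_biUnion_finset_image, Set.image_iUnion₂]
    simp only [L.image_convexHull]

theorem IsCompactPolyhedron.isCompact {E : Type} [AddCommGroup E] [Module ℝ E] [TopologicalSpace E]
    [IsTopologicalAddGroup E] [ContinuousSMul ℝ E] {A : Set E} (hA : IsCompactPolyhedron A) :
    IsCompact A := by
  obtain ⟨F, hF, rfl⟩ := hA
  exact F.isCompact_biUnion fun A h => (hF A h).isCompact_convexHull ℝ

/-- The graph is the image of `A` under the linear map `x ↦ (x, L x)`, and linear images of compact
polyhedra are compact polyhedra. -/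
theorem plHomeomorphic_of_bijOn {E E' : Type} [NormedAddCommGroup E] [NormedSpace ℝ E]
    [FiniteDimensional ℝ E] [NormedAddCommGroup E'] [NormedSpace ℝ E'] {A : Set E} {B : Set E'}
    (hA : IsCompactPolyhedron A) (L : E →ₗ[ℝ] E') (hL : Set.BijOn L A B) :
    PLHomeomorphic A B := by
  have : CompactSpace A := isCompact_iff_compactSpace.1 hA.isCompact
  have hc : Continuous (hL.equiv L) :=
    (L.continuous_of_finiteDimensional.comp continuous_subtype_val).subtype_mk _
  refine ⟨hc.homeoOfEquivCompactToT2, ?_⟩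
  have : {p : E × E' | ∃ x : A, p = ((x : E), (hc.homeoOfEquivCompactToT2 x : E'))} =
      (LinearMap.id.prod L) '' A := by
    ext p
    constructor
    · rintro ⟨x, rfl⟩
      exact ⟨x, x.2, rfl⟩
    · rintro ⟨x, hx, rfl⟩
      exact ⟨⟨x, hx⟩, rfl⟩
  rw [this]
  exact hA.image _

/-- Some linear map restricts to a bijection from `A` to `B`. -/
def LinearlyBijective {E E' : Type} [AddCommGroup E] [Module ℝ E] [AddCommGroup E'] [Module ℝ E']
    (A : Set E) (B : Set E') : Prop :=
  ∃ L : E →ₗ[ℝ] E', Set.BijOn L A B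

theorem LinearlyBijective.trans {E E' E'' : Type} [AddCommGroup E] [Module ℝ E] [AddCommGroup E']
    [Module ℝ E'] [AddCommGroup E''] [Module ℝ E''] {A : Set E} {B : Set E'} {C : Set E''}
    (h : LinearlyBijective A B) (h' : LinearlyBijective B C) : LinearlyBijective A C := by
  obtain ⟨L, hL⟩ := h
  obtain ⟨L', hL'⟩ := h'
  exact ⟨L' ∘ₗ L, hL'.comp hL⟩

/-- The coordinate map which belongs to a map of vertices. -/
def relabel {V W : Type} (f : W → V) : EuclideanSpace ℝ V →ₗ[ℝ] EuclideanSpace ℝ W where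
  toFun x := WithLp.toLp 2 fun i => x (f i)
  map_add' _ _ := rfl
  map_smul' _ _ := rfl

theorem linearlyBijective_relabel {V W : Type} [Fintype V] [Fintype W] {f : W ↪ V}
    {F : Set (Finset V)} {G : Set (Finset W)} (h : ∀ s ∈ F, ∃ t ∈ G, s = t.map f)
    (h' : ∀ t ∈ G, t.map f ∈ F) : LinearlyBijective (geom F) (geom G) := by
  classical
  have hout : ∀ x ∈ geom F, ∀ v, (∀ i, f i ≠ v) → x v = 0 := by
    rintro x ⟨-, -, s, hs, hx⟩ v hv
    obtain ⟨t, -, rfl⟩ := h s hs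
    refine hx v fun hvs => ?_
    obtain ⟨i, -, hi⟩ := mem_map.1 hvs
    exact hv i hi
  refine ⟨relabel f, ?_, ?_, ?_⟩
  · intro x hx
    refine ⟨fun i => hx.1 (f i), ?_, ?_⟩
    · rw [← hx.2.1]
      change ∑ i, x (f i) = _
      rw [← sum_map univ f (fun v => x v)]
      refine sum_subset (subset_univ _) fun v _ hv => hout x hx v fun i hi => hv ?_
      exact mem_map.2 ⟨i, mem_univ i, hi⟩
    · obtain ⟨s, hs, hxs⟩ := hx.2.2
      obtain ⟨t, ht, rfl⟩ := h s hs
      exact ⟨t, ht, fun i hi => hxs _ (by simpa using hi)⟩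
  · intro x hx y hy hxy
    ext v
    by_cases hv : ∃ i, f i = v
    · obtain ⟨i, rfl⟩ := hv
      exact congrFun (congrArg WithLp.ofLp hxy) i
    · push Not at hv
      rw [hout x hx v hv, hout y hy v hv]
  · rintro y ⟨hy0, hy1, t, ht, hyt⟩
    refine ⟨WithLp.toLp 2 (Function.extend f y 0), ⟨fun v => ?_, ?_, t.map f, h' t ht,
      fun v hv => ?_⟩, ?_⟩
    · by_cases hv : ∃ i, f i = v
      · obtain ⟨i, rfl⟩ := hv
        rw [PiLp.toLp_apply, f.injective.extend_apply]
        exact hy0 i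
      · rw [PiLp.toLp_apply, Function.extend_apply' _ _ _ hv, Pi.zero_apply]
    · rw [← hy1, ← sum_subset (subset_univ (univ.map f)), sum_map]
      · simp [f.injective.extend_apply]
      · intro v _ hv
        rw [PiLp.toLp_apply, Function.extend_apply', Pi.zero_apply]
        rintro ⟨i, rfl⟩
        simp at hv
    · by_cases hv' : ∃ i, f i = v
      · obtain ⟨i, rfl⟩ := hv'
        rw [PiLp.toLp_apply, f.injective.extend_apply]
        exact hyt i (by simpa using hv)
      · rw [PiLp.toLp_apply, Function.extend_apply' _ _ _ hv', Pi.zero_apply]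
    · ext i
      exact f.injective.extend_apply _ _ i

section Stellar

variable {V : Type} [DecidableEq V]

/-- The faces of the stellar subdivision of the face `σ`, with new vertex `w`. -/
def stellar (σ : Finset V) (w : V) (K : Set (Finset V)) : Set (Finset V) :=
  {s | ¬σ ⊆ s ∧ if w ∈ s then s.erase w ∪ σ ∈ K else s ∈ K}

/-- The linear map which sends the vertex `w` to the barycenter of `σ`. -/
def stellarMap (σ : Finset V) (w : V) : EuclideanSpace ℝ V →ₗ[ℝ] EuclideanSpace ℝ V where
  toFun x := WithLp.toLp 2 fun u => if u = w then 0 else x u + if u ∈ σ then x w / σ.card else 0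
  map_add' x y := by
    ext u
    simp only [PiLp.add_apply]
    split_ifs <;> ring
  map_smul' a x := by
    ext u
    simp only [PiLp.smul_apply, smul_eq_mul, RingHom.id_apply]
    split_ifs <;> ring

theorem stellarMap_apply (σ : Finset V) (w : V) (x : EuclideanSpace ℝ V) (u : V) :
    stellarMap σ w x u = if u = w then 0 else x u + if u ∈ σ then x w / σ.card else 0 := rfl

theorem sum_ite_mem_const [Fintype V] (σ : Finset V) (a : ℝ) :
    ∑ u, (if u ∈ σ then a else 0) = σ.card * a := by
  simp

/-- A face of the subdivision misses a vertex of `σ`, so `x w / σ.card` is the minimum over `σ` of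
the coordinates of the image; this recovers `x`. Conversely, the inverse subtracts that minimum on
`σ` and gives its `σ.card`-fold to `w`. -/
theorem linearlyBijective_stellar [Fintype V] {K : Set (Finset V)} (hK : IsLowerSet K)
    {σ : Finset V} {w : V} (hσ : σ ∈ K) (hσ0 : σ.Nonempty) (hw : ∀ s ∈ K, w ∉ s) :
    LinearlyBijective (geom (stellar σ w K)) (geom K) := by
  have hwσ : w ∉ σ := hw σ hσ
  have hcard : (σ.card : ℝ) ≠ 0 := by simpa using hσ0.ne_empty
  have hS : ∀ x u, u ≠ w → stellarMap σ w x u = x u + if u ∈ σ then x w / σ.card else 0 :=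
    fun x u hu => by rw [stellarMap_apply, if_neg hu]
  have hmin : ∀ x ∈ geom (stellar σ w K), ∃ e ∈ σ, stellarMap σ w x e = x w / σ.card := by
    rintro x ⟨-, -, s, hs, hx⟩
    obtain ⟨e, he, hes⟩ := not_subset.1 hs.1
    refine ⟨e, he, ?_⟩
    rw [hS x e (ne_of_mem_of_not_mem he hwσ), hx e hes, if_pos he, zero_add]
  refine ⟨stellarMap σ w, ?_, ?_, ?_⟩
  · rintro x ⟨h0, h1, s, ⟨hs1, hs2⟩, hx⟩
    refine ⟨fun u => ?_, ?_, ?_⟩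
    · rw [stellarMap_apply]
      have := h0 u
      have := h0 w
      split_ifs <;> positivity
    · have : ∀ u, stellarMap σ w x u =
          x u + (if u ∈ σ then x w / σ.card else 0) - if u = w then x w else 0 := by
        intro u
        rw [stellarMap_apply]
        split_ifs with h h' h'
        · exact absurd (h ▸ h') hwσ
        · rw [h]; ring
        · ring
        · ring
      simp only [this]
      rw [sum_sub_distrib, sum_add_distrib, h1, sum_ite_mem_const, mul_div_cancel₀ _ hcard,
        sum_ite_eq' univ w, if_pos (mem_univ w), add_sub_cancel_right]
    · split_ifs at hs2 with hws
      · refine ⟨_, hs2, fun u hu => ?_⟩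
        rw [mem_union, mem_erase, not_or] at hu
        rw [stellarMap_apply, if_neg hu.2, add_zero]
        split_ifs with huw
        · rfl
        · exact hx u fun h => hu.1 ⟨huw, h⟩
      · refine ⟨s, hs2, fun u hu => ?_⟩
        rw [stellarMap_apply, hx u hu, hx w hws]
        simp
  · intro x hx y hy hxy
    have hle : ∀ x ∈ geom (stellar σ w K), ∀ y ∈ geom (stellar σ w K),
        stellarMap σ w x = stellarMap σ w y → y w ≤ x w := by
      intro x hx y hy hxy
      obtain ⟨e, he, hxe⟩ := hmin x hx
      rw [hxy, hS y e (ne_of_mem_of_not_mem he hwσ), if_pos he] at hxe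
      have h1 : y w / σ.card ≤ x w / σ.card := by linarith [hy.1 e]
      rwa [div_le_div_iff_of_pos_right (by positivity)] at h1
    have hxyw : x w = y w := le_antisymm (hle y hy x hx hxy.symm) (hle x hx y hy hxy)
    ext u
    rcases eq_or_ne u w with rfl | hu
    · exact hxyw
    · have := congrFun (congrArg WithLp.ofLp hxy) u
      rw [hS x u hu, hS y u hu, hxyw] at this
      exact add_right_cancel this
  · rintro y ⟨h0, h1, s, hs, hy⟩
    obtain ⟨e, he, hmin⟩ := exists_min_image σ (fun u => y u) hσ0
    have hyw : y w = 0 := hy w (hw s hs)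
    have hew : e ≠ w := ne_of_mem_of_not_mem he hwσ
    set x : EuclideanSpace ℝ V := WithLp.toLp 2 fun u =>
      (y u - if u ∈ σ then y e else 0) + if u = w then σ.card * y e else 0 with hx
    have hxu : ∀ u, x u = (y u - if u ∈ σ then y e else 0) + if u = w then σ.card * y e else 0 :=
      fun u => rfl
    have hxw : x w = σ.card * y e := by rw [hxu, hyw, if_neg hwσ, if_pos rfl]; ring
    refine ⟨x, ⟨fun u => ?_, ?_, ?_⟩, ?_⟩
    · rw [hxu]
      have h2 := h0 u
      have h3 := h0 e
      have h4 : 0 ≤ y u - if u ∈ σ then y e else 0 := by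
        split_ifs with h
        · linarith [hmin u h]
        · linarith
      split_ifs at h4 ⊢ <;> positivity
    · simp only [hxu]
      rw [sum_add_distrib, sum_sub_distrib, h1, sum_ite_mem_const, sum_ite_eq' univ w,
        if_pos (mem_univ w)]
      ring
    · by_cases hσs : σ ⊆ s
      -- The coordinate at the minimiser `e` becomes zero, so `e` may be dropped; then the face no
      -- longer contains `σ`.
      · refine ⟨insert w (s.erase e), ⟨fun h => ?_, ?_⟩, fun u hu => ?_⟩
        · have := h he
          rw [mem_insert] at this
          exact this.elim hew (notMem_erase e s)
        · rw [if_pos (mem_insert_self _ _), erase_insert fun h => hw s hs (mem_of_mem_erase h)]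
          exact hK (union_subset (erase_subset e s) hσs) hs
        · rw [mem_insert, mem_erase, not_or] at hu
          rw [hxu, if_neg hu.1, add_zero]
          rcases eq_or_ne u e with rfl | hue
          · rw [if_pos he, sub_self]
          · have hus : u ∉ s := fun h => hu.2 ⟨hue, h⟩
            rw [if_neg fun h => hus (hσs h), hy u hus, sub_zero]
      · refine ⟨s, ⟨hσs, by rwa [if_neg (hw s hs)]⟩, fun u hu => ?_⟩
        obtain ⟨d, hd, hds⟩ := not_subset.1 hσs
        have hye : y e = 0 := le_antisymm ((hmin d hd).trans (hy d hds).le) (h0 e)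
        rw [hxu, hy u hu, hye]
        simp
    · ext u
      rcases eq_or_ne u w with rfl | hu
      · rw [stellarMap_apply, if_pos rfl, hyw]
      · rw [hS x u hu, hxw, hxu, if_neg hu, mul_div_cancel_left₀ _ hcard]
        ring

theorem isLowerSet_stellar {K : Set (Finset V)} (hK : IsLowerSet K) (σ : Finset V) (w : V) :
    IsLowerSet (stellar σ w K) := by
  rintro s t hts ⟨h1, h2⟩
  refine ⟨fun h => h1 (h.trans hts), ?_⟩
  split_ifs with hwt
  · rw [if_pos (hts hwt)] at h2
    exact hK (union_subset_union_left (erase_subset_erase w hts)) h2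
  · split_ifs at h2 with hws
    · exact hK ((subset_erase.2 ⟨hts, hwt⟩).trans subset_union_left) h2
    · exact hK hts h2

end Stellar

/-! ### The links of the vertices -/

/-- The faces of the link of the vertex `v` in Walkup's complex, including the empty face. -/
def vertexLink (v : Fin 9) : Set (Finset (Fin 9)) :=
  {s | v ∉ s ∧ IsFace (insert v s)}

theorem realization_link_walkup (v : Fin 9) :
    realization (link walkup.toPreAbstractSimplicialComplex v) = geom (vertexLink v) := by
  have : vertexLink v = insert ∅ (link walkup.toPreAbstractSimplicialComplex v).faces := by
    ext s
    have h : insert v s ∈ walkup.toPreAbstractSimplicialComplex.faces ↔ IsFace (insert v s) := by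
      rw [← Set.mem_ofPred_eq (p := IsFace), ← insert_empty_walkup_faces, Set.mem_insert_iff,
        or_iff_right (insert_ne_empty v s)]
    rw [Set.mem_insert_iff]
    constructor
    · intro hs
      rcases s.eq_empty_or_nonempty with hs' | hs'
      · exact Or.inl hs'
      · exact Or.inr ⟨hs', hs.1, h.2 hs.2⟩
    · rintro (rfl | hs)
      · refine ⟨notMem_empty v, ?_⟩
        have := isFace_pair v v
        rwa [pair_eq_singleton] at this
      · exact ⟨hs.2.1, h.1 hs.2.2⟩
  rw [this, geom_insert_empty]
  rfl

theorem IsFace.map_add {s : Finset (Fin 9)} (h : IsFace s) (v : Fin 9) :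
    IsFace (s.map (addRightEmbedding v)) := by
  obtain ⟨i, h⟩ := h
  have hmap : ∀ a b c, s ⊆ {i, i + a, i + b, i + c} →
      s.map (addRightEmbedding v) ⊆ {i + v, i + v + a, i + v + b, i + v + c} := by
    intro a b c hs
    rw [← map_subset_map (f := addRightEmbedding v)] at hs
    rwa [map_insert, map_insert, map_insert, map_singleton, addRightEmbedding_apply,
      addRightEmbedding_apply, addRightEmbedding_apply, addRightEmbedding_apply,
      add_right_comm i a, add_right_comm i b, add_right_comm i c] at hs
  exact ⟨i + v, h.imp (hmap 2 3 4) (Or.imp (hmap 1 3 4) (hmap 1 2 4))⟩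

/-- Translation by `v` is an automorphism of the complex that takes `0` to `v`. -/
theorem linearlyBijective_vertexLink (v : Fin 9) :
    LinearlyBijective (geom (vertexLink v)) (geom (vertexLink 0)) := by
  have hcomp : ∀ (v : Fin 9) (s : Finset (Fin 9)),
      (s.map (addRightEmbedding v)).map (addRightEmbedding (-v)) = s := by
    intro v s
    ext x
    simp [mem_map]
  have key : ∀ (v : Fin 9) (a : Fin 9), ∀ s ∈ vertexLink a,
      s.map (addRightEmbedding v) ∈ vertexLink (a + v) := by
    rintro v a s ⟨h1, h2⟩
    refine ⟨by simpa [mem_map] using h1, ?_⟩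
    have := h2.map_add v
    rwa [map_insert] at this
  refine linearlyBijective_relabel (f := addRightEmbedding v) (fun s hs => ?_) fun t ht => ?_
  · refine ⟨s.map (addRightEmbedding (-v)), ?_, ?_⟩
    · have := key (-v) v s hs
      rwa [add_neg_cancel] at this
    · have := hcomp (-v) s
      rw [neg_neg] at this
      exact this.symm
  · have := key v 0 t ht
    rwa [zero_add] at this

/-- The boundary complex of a simplex, including the empty face. -/
def properSubsets {V : Type} (σ : Finset V) : Set (Finset V) :=
  {s | s ⊂ σ}

theorem isLowerSet_properSubsets {V : Type} (σ : Finset V) : IsLowerSet (properSubsets σ) :=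
  fun _ _ h hs => lt_of_le_of_lt h hs

instance {V : Type} [DecidableEq V] (σ s : Finset V) : Decidable (s ∈ properSubsets σ) :=
  inferInstanceAs (Decidable (s ⊂ σ))

instance {V : Type} [DecidableEq V] (σ : Finset V) (w : V) (K : Set (Finset V))
    [DecidablePred (· ∈ K)] : DecidablePred (· ∈ stellar σ w K) :=
  fun s => inferInstanceAs (Decidable (¬σ ⊆ s ∧ if w ∈ s then s.erase w ∪ σ ∈ K else s ∈ K))

/-- The link is a stacked sphere. -/
theorem vertexLink_eq : vertexLink 0 = stellar {1, 2, 3} 4 (stellar {8, 1, 2} 3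
    (stellar {7, 8, 1} 2 (stellar {6, 7, 8} 1 (properSubsets {5, 6, 7, 8})))) := by
  ext s
  change (0 ∉ s ∧ IsFace (insert 0 s)) ↔ _
  revert s
  decide +kernel

theorem linearlyBijective_properSubsets :
    LinearlyBijective (geom (properSubsets ({5, 6, 7, 8} : Finset (Fin 9))))
      (realization (simplexBoundary 4)) := by
  have h : (univ : Finset (Fin 4)).map (Fin.natAddEmb 5) = ({5, 6, 7, 8} : Finset (Fin 9)) := by
    decide
  have : realization (simplexBoundary 4) =
      geom (properSubsets (univ : Finset (Fin 4))) := by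
    have : properSubsets (univ : Finset (Fin 4)) = insert ∅ (simplexBoundary 4).faces := by
      ext s
      rw [Set.mem_insert_iff]
      change s ⊂ univ ↔ s = ∅ ∨ s.Nonempty ∧ s ≠ univ
      rw [ssubset_univ_iff]
      rcases s.eq_empty_or_nonempty with rfl | hs
      · simp [eq_comm (a := (∅ : Finset (Fin 4))), univ_eq_empty_iff]
      · simp [hs, hs.ne_empty]
    rw [this, geom_insert_empty]
    rfl
  rw [this, ← h]
  refine linearlyBijective_relabel (f := (Fin.natAddEmb 5 : Fin 4 ↪ Fin 9)) (fun s hs => ?_)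
    fun t ht => ?_
  · obtain ⟨t, -, rfl⟩ := subset_map_iff.1 hs.1
    exact ⟨t, map_ssubset_map.1 hs, rfl⟩
  · exact map_ssubset_map.2 ht

theorem linearlyBijective_vertexLink_simplexBoundary :
    LinearlyBijective (geom (vertexLink 0)) (realization (simplexBoundary 4)) := by
  rw [vertexLink_eq]
  have h0 := isLowerSet_properSubsets ({5, 6, 7, 8} : Finset (Fin 9))
  have h1 := isLowerSet_stellar h0 {6, 7, 8} 1
  have h2 := isLowerSet_stellar h1 {7, 8, 1} 2
  have h3 := isLowerSet_stellar h2 {8, 1, 2} 3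
  refine (linearlyBijective_stellar h3 ?_ (insert_nonempty _ _) ?_).trans
    ((linearlyBijective_stellar h2 ?_ (insert_nonempty _ _) ?_).trans
    ((linearlyBijective_stellar h1 ?_ (insert_nonempty _ _) ?_).trans
    ((linearlyBijective_stellar h0 ?_ (insert_nonempty _ _) ?_).trans
    linearlyBijective_properSubsets)))
  all_goals decide +kernel

theorem isCombinatorialManifold_walkup :
    IsCombinatorialManifold 3 walkup.toPreAbstractSimplicialComplex := by
  intro v _
  rw [realization_link_walkup]
  obtain ⟨L, hL⟩ :=
    (linearlyBijective_vertexLink v).trans linearlyBijective_vertexLink_simplexBoundary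
  exact plHomeomorphic_of_bijOn (isCompactPolyhedron_geom _) L hL

/-! ### The infinite stacked strip -/

/-- The barycentric coordinates of a point in the boundary of a tetrahedron, indexed by the
integers modulo 4. -/
structure IsProfile (Y : ℤ → ℝ) : Prop where
  periodic : ∀ k, Y (k + 4) = Y k
  nonneg : ∀ k, 0 ≤ Y k
  sum_eq : Y 0 + Y 1 + Y 2 + Y 3 = 1
  exists_eq_zero : ∃ k, Y k = 0

/-- The height at which the vertex `i` of the strip is replaced by `i + 4`. -/
def moment (Y : ℤ → ℝ) (i : ℤ) : ℝ :=
  i * Y i + (i + 1) * Y (i + 1) + (i + 2) * Y (i + 2) + (i + 3) * Y (i + 3)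

/-- The part of the coordinate `Y i` which has passed from `i` to `i + 4` at height `t`. -/
def flow (Y : ℤ → ℝ) (t : ℝ) (i : ℤ) : ℝ :=
  max 0 (min ((t - moment Y i) / 4) (Y i))

/-- The point of the strip above the profile `Y` at height `t`. -/
def strip (Y : ℤ → ℝ) (t : ℝ) (k : ℤ) : ℝ :=
  flow Y t (k - 4) - flow Y t k

namespace IsProfile

variable {Y : ℤ → ℝ} {t : ℝ} {i : ℤ}

theorem periodic_mul (hY : IsProfile Y) (k n : ℤ) : Y (k + 4 * n) = Y k := by
  have := Function.Periodic.int_mul (f := Y) (c := 4) hY.periodic n k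
  rwa [mul_comm] at this

theorem sub_four (hY : IsProfile Y) (k : ℤ) : Y (k - 4) = Y k := by
  have := hY.periodic (k - 4)
  rw [sub_add_cancel] at this
  exact this.symm

theorem sum_eq_one (hY : IsProfile Y) (i : ℤ) : Y i + Y (i + 1) + Y (i + 2) + Y (i + 3) = 1 := by
  induction i using Int.induction_on with
  | zero => simpa using hY.sum_eq
  | succ i ih =>
    have := hY.periodic i
    rw [add_assoc _ 1 1, add_assoc _ 1 2, add_assoc _ 1 3]
    norm_num
    linarith
  | pred i ih =>
    have := hY.periodic (-i - 1)
    have e1 : (-i - 1 + 1 : ℤ) = -i := by ring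
    have e2 : (-i - 1 + 2 : ℤ) = -i + 1 := by ring
    have e3 : (-i - 1 + 3 : ℤ) = -i + 2 := by ring
    have e4 : (-i - 1 + 4 : ℤ) = -i + 3 := by ring
    rw [e4] at this
    rw [e1, e2, e3]
    linarith

theorem shift (hY : IsProfile Y) (n : ℤ) : IsProfile fun k => Y (k + n) where
  periodic k := by rw [add_right_comm, hY.periodic]
  nonneg k := hY.nonneg _
  sum_eq := by
    have := hY.sum_eq_one n
    rwa [zero_add, add_comm 1 n, add_comm 2 n, add_comm 3 n]
  exists_eq_zero := by
    obtain ⟨k, hk⟩ := hY.exists_eq_zero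
    exact ⟨k - n, by rwa [sub_add_cancel]⟩

/-- Moving the mass `Y i` from the vertex `i` to `i + 4` raises the first moment by four times that
mass. -/
theorem moment_succ (hY : IsProfile Y) (i : ℤ) : moment Y (i + 1) = moment Y i + 4 * Y i := by
  have := hY.periodic i
  unfold moment
  rw [add_assoc _ 1 1, add_assoc _ 1 2, add_assoc _ 1 3]
  norm_num
  rw [this]
  ring

theorem monotone_moment (hY : IsProfile Y) : Monotone (moment Y) :=
  monotone_int_of_le_succ fun i => by
    have := hY.nonneg i
    rw [hY.moment_succ]
    linarith

theorem le_moment (hY : IsProfile Y) (i : ℤ) : (i : ℝ) ≤ moment Y i := by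
  have h := hY.sum_eq_one i
  have : moment Y i = i * (Y i + Y (i + 1) + Y (i + 2) + Y (i + 3)) + Y (i + 1) + 2 * Y (i + 2)
      + 3 * Y (i + 3) := by
    unfold moment
    ring
  rw [this, h]
  linarith [hY.nonneg (i + 1), hY.nonneg (i + 2), hY.nonneg (i + 3)]

theorem moment_le (hY : IsProfile Y) (i : ℤ) : moment Y i ≤ i + 3 := by
  have h := hY.sum_eq_one i
  have : moment Y i = (i + 3) * (Y i + Y (i + 1) + Y (i + 2) + Y (i + 3)) - 3 * Y i
      - 2 * Y (i + 1) - Y (i + 2) := by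
    unfold moment
    ring
  rw [this, h]
  linarith [hY.nonneg i, hY.nonneg (i + 1), hY.nonneg (i + 2)]

theorem exists_window (hY : IsProfile Y) (t : ℝ) : ∃ i, moment Y i ≤ t ∧ t < moment Y (i + 1) := by
  obtain ⟨i, hi, hmax⟩ := Int.exists_greatest_of_bdd (P := fun i => moment Y i ≤ t)
    ⟨⌈t⌉, fun i hi => Int.cast_le.1 ((hY.le_moment i).trans (hi.trans (Int.le_ceil t)))⟩
    ⟨⌊t⌋ - 3, by
      have h1 := hY.moment_le (⌊t⌋ - 3)
      have h2 := Int.floor_le t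
      push_cast at h1
      linarith⟩
  exact ⟨i, hi, lt_of_not_ge fun h => by have := hmax _ h; omega⟩

theorem moment_shift (hY : IsProfile Y) (n i : ℤ) :
    moment (fun k => Y (k + n)) i = moment Y (i + n) - n := by
  have h := hY.sum_eq_one (i + n)
  simp only [moment, add_right_comm i _ n]
  push_cast
  linear_combination (-(n : ℝ)) * h

theorem strip_shift (hY : IsProfile Y) (n : ℤ) (t : ℝ) (k : ℤ) :
    strip (fun k => Y (k + n)) (t - n) k = strip Y t (k + n) := by
  unfold strip flow
  rw [hY.moment_shift, hY.moment_shift, sub_sub_sub_cancel_right, sub_sub_sub_cancel_right]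
  simp only [sub_add_eq_add_sub]

theorem flow_of_le {t : ℝ} {j : ℤ} (h : t ≤ moment Y j) : flow Y t j = 0 := by
  unfold flow
  rw [max_eq_left]
  exact (min_le_left _ _).trans (by linarith)

theorem flow_of_ge (hY : IsProfile Y) {t : ℝ} {j : ℤ} (h : moment Y (j + 1) ≤ t) :
    flow Y t j = Y j := by
  rw [hY.moment_succ] at h
  unfold flow
  rw [min_eq_right (by linarith), max_eq_right (hY.nonneg j)]

theorem flow_of_lt (hY : IsProfile Y) (h1 : moment Y i ≤ t) {j : ℤ} (hj : j < i) :
    flow Y t j = Y j :=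
  hY.flow_of_ge ((hY.monotone_moment (by omega)).trans h1)

theorem flow_of_gt (hY : IsProfile Y) (h2 : t ≤ moment Y (i + 1)) {j : ℤ} (hj : i < j) :
    flow Y t j = 0 :=
  flow_of_le (h2.trans (hY.monotone_moment (by omega)))

theorem flow_eq (hY : IsProfile Y) (h1 : moment Y i ≤ t)
    (h2 : t ≤ moment Y (i + 1)) :
    flow Y t i = (t - moment Y i) / 4 := by
  rw [hY.moment_succ] at h2
  unfold flow
  rw [min_eq_left (by linarith), max_eq_right (by linarith)]

theorem strip_eq_zero (hY : IsProfile Y) (h1 : moment Y i ≤ t)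
    (h2 : t ≤ moment Y (i + 1)) {k : ℤ} (hk : k < i ∨ i + 4 < k) : strip Y t k = 0 := by
  unfold strip
  rcases hk with hk | hk
  · rw [hY.flow_of_lt h1 hk, hY.flow_of_lt h1 (by omega), hY.sub_four, sub_self]
  · rw [hY.flow_of_gt h2 (by omega), hY.flow_of_gt h2 (by omega), sub_self]

theorem strip_left (hY : IsProfile Y) (h1 : moment Y i ≤ t)
    (h2 : t ≤ moment Y (i + 1)) :
    strip Y t i = Y i - (t - moment Y i) / 4 := by
  unfold strip
  rw [hY.flow_of_lt h1 (by omega), hY.flow_eq h1 h2, hY.sub_four]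

theorem strip_right (hY : IsProfile Y) (h1 : moment Y i ≤ t)
    (h2 : t ≤ moment Y (i + 1)) :
    strip Y t (i + 4) = (t - moment Y i) / 4 := by
  unfold strip
  rw [add_sub_cancel_right, hY.flow_of_gt (j := i + 4) h2 (by omega), hY.flow_eq h1 h2, sub_zero]

theorem strip_middle (hY : IsProfile Y) (h1 : moment Y i ≤ t)
    (h2 : t ≤ moment Y (i + 1)) {k : ℤ} (hk : i < k) (hk' : k < i + 4) : strip Y t k = Y k := by
  unfold strip
  rw [hY.flow_of_lt h1 (by omega), hY.flow_of_gt h2 hk, hY.sub_four, sub_zero]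

theorem strip_nonneg (hY : IsProfile Y) (h1 : moment Y i ≤ t)
    (h2 : t ≤ moment Y (i + 1)) (k : ℤ) : 0 ≤ strip Y t k := by
  by_cases hk : k < i ∨ i + 4 < k
  · rw [hY.strip_eq_zero h1 h2 hk]
  · have hs := hY.moment_succ i
    rcases eq_or_ne k i with rfl | hki
    · rw [hY.strip_left h1 h2]
      linarith
    · rcases eq_or_ne k (i + 4) with rfl | hki'
      · rw [hY.strip_right h1 h2]
        linarith
      · rw [hY.strip_middle h1 h2 (by omega) (by omega)]
        exact hY.nonneg k

theorem sum_strip (hY : IsProfile Y) (h1 : moment Y i ≤ t)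
    (h2 : t ≤ moment Y (i + 1)) :
    strip Y t i + strip Y t (i + 1) + strip Y t (i + 2) + strip Y t (i + 3) +
    strip Y t (i + 4) = 1 := by
  rw [hY.strip_left h1 h2, hY.strip_right h1 h2, hY.strip_middle h1 h2 (by omega) (by omega),
    hY.strip_middle h1 h2 (by omega) (by omega), hY.strip_middle h1 h2 (by omega) (by omega)]
  linarith [hY.sum_eq_one i]

/-- In a window with `t` strictly below the next moment, `Y i` is positive; so the zero of the
profile sits in the residue class of an inner vertex. -/
theorem exists_strip_eq_zero (hY : IsProfile Y) (h1 : moment Y i ≤ t)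
    (h2 : t < moment Y (i + 1)) :
    strip Y t (i + 1) = 0 ∨ strip Y t (i + 2) = 0 ∨ strip Y t (i + 3) = 0 := by
  rw [hY.strip_middle h1 h2.le (by omega) (by omega),
    hY.strip_middle h1 h2.le (by omega) (by omega), hY.strip_middle h1 h2.le (by omega) (by omega)]
  have hYi : Y i ≠ 0 := by
    rw [hY.moment_succ] at h2
    intro h
    linarith
  obtain ⟨k, hk⟩ := hY.exists_eq_zero
  have h : ∀ d, (k - i) % 4 = d → Y (i + d) = 0 := by
    intro d hd
    rw [← hk, ← hY.periodic_mul (i + d) ((k - i) / 4)]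
    congr 1
    omega
  have h4 : (k - i) % 4 = 0 ∨ (k - i) % 4 = 1 ∨ (k - i) % 4 = 2 ∨ (k - i) % 4 = 3 := by omega
  rcases h4 with h4 | h4 | h4 | h4
  · have := h 0 h4
    rw [add_zero] at this
    exact absurd this hYi
  · exact Or.inl (h 1 h4)
  · exact Or.inr (Or.inl (h 2 h4))
  · exact Or.inr (Or.inr (h 3 h4))

/-- The strip is the difference of flows four steps apart, and flows vanish far to the right, so it
determines the flow. Far to the left the flow is `Y`, and inside the window it increases strictly
with `t`. -/
theorem strip_injective {Y' : ℤ → ℝ} {t' : ℝ} (hY : IsProfile Y) (hY' : IsProfile Y')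
    (h : strip Y t = strip Y' t') : Y = Y' ∧ t = t' := by
  obtain ⟨i, hi1, hi2⟩ := hY.exists_window t
  obtain ⟨i', hi1', hi2'⟩ := hY'.exists_window t'
  have hdiff : ∀ k, flow Y t (k - 4) - flow Y' t' (k - 4) = flow Y t k - flow Y' t' k := by
    intro k
    have := congrFun h k
    unfold strip at this
    linarith
  have hflow0 : ∀ n : ℕ, ∀ k, max i i' < k + 4 * n → flow Y t k - flow Y' t' k = 0 := by
    intro n
    induction n with
    | zero =>
      intro k hk
      rw [hY.flow_of_gt hi2.le (by omega), hY'.flow_of_gt hi2'.le (by omega), sub_zero]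
    | succ n ih =>
      intro k hk
      have := hdiff (k + 4)
      rw [add_sub_cancel_right] at this
      rw [this, ih (k + 4) (by push_cast at hk; omega)]
  have hflow : ∀ k, flow Y t k = flow Y' t' k := fun k =>
    sub_eq_zero.1 (hflow0 (max i i' - k + 1).toNat k (by omega))
  have hYY : Y = Y' := by
    ext k
    obtain ⟨n, hn, hn'⟩ : ∃ n, k + 4 * n < i ∧ k + 4 * n < i' :=
      ⟨-(|k - i| + |k - i'| + 1), by
        have := le_abs_self (k - i)
        have := abs_nonneg (k - i')
        have := abs_nonneg (k - i)
        omega, by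
        have := le_abs_self (k - i')
        have := abs_nonneg (k - i')
        have := abs_nonneg (k - i)
        omega⟩
    rw [← hY.periodic_mul k n, ← hY'.periodic_mul k n, ← hY.flow_of_lt hi1 hn,
      ← hY'.flow_of_lt hi1' hn', hflow]
  refine ⟨hYY, ?_⟩
  subst hYY
  have hlt : ∀ t t', (∀ k, flow Y t k = flow Y t' k) → ¬t < t' := by
    intro t t' hflow htt
    obtain ⟨i, hi1, hi2⟩ := hY.exists_window t
    have h1 := hY.flow_eq hi1 hi2.le
    rw [hY.moment_succ] at hi2
    have h2 : (t - moment Y i) / 4 < min ((t' - moment Y i) / 4) (Y i) :=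
      lt_min (by linarith) (by linarith)
    exact absurd (hflow i) (h1.trans_lt (h2.trans_le (le_max_right _ _))).ne
  exact le_antisymm (not_lt.1 (hlt t' t fun k => (hflow k).symm)) (not_lt.1 (hlt t t' hflow))

end IsProfile

/-! ### The strip modulo 9 -/

/-- The strip, wrapped around modulo 9. -/
def wrap (Y : ℤ → ℝ) (t : ℝ) : EuclideanSpace ℝ (Fin 9) :=
  WithLp.toLp 2 fun j => strip Y t ((j : ℕ) - 9) + strip Y t (j : ℕ) + strip Y t ((j : ℕ) + 9)

namespace IsProfile

variable {Y : ℤ → ℝ} {t : ℝ} {i : ℤ}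

/-- For `0 ≤ t ≤ 9` the window starts between -4 and 9, so its support is covered by the
representatives `j - 9`, `j`, `j + 9`; as it has only five places, at most one of these matters. -/
theorem wrap_apply (hY : IsProfile Y) (h1 : moment Y i ≤ t) (h2 : t ≤ moment Y (i + 1))
    (h0 : 0 ≤ t) (h9 : t ≤ 9) (j : Fin 9) :
    wrap Y t j = strip Y t (i + ((j : ℕ) - i) % 9) := by
  have hi : i ≤ 9 := by
    have := (hY.le_moment i).trans (h1.trans h9)
    exact_mod_cast this
  have hi' : -4 ≤ i := by
    have := h0.trans (h2.trans (hY.moment_le (i + 1)))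
    have h : (-4 : ℝ) ≤ i := by push_cast at this; linarith
    exact_mod_cast h
  have hj := j.2
  have hz : ∀ {k}, k < i ∨ i + 4 < k → strip Y t k = 0 := hY.strip_eq_zero h1 h2
  change strip Y t ((j : ℕ) - 9) + strip Y t (j : ℕ) + strip Y t ((j : ℕ) + 9) = _
  have hcases : i + ((j : ℕ) - i) % 9 = (j : ℕ) - 9 ∨ i + ((j : ℕ) - i) % 9 = (j : ℕ) ∨
      i + ((j : ℕ) - i) % 9 = (j : ℕ) + 9 := by omega
  rcases hcases with h | h | h
  · rw [h, hz (k := (j : ℕ)) (by omega), hz (k := (j : ℕ) + 9) (by omega), add_zero, add_zero]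
  · rw [h, hz (k := (j : ℕ) - 9) (by omega), hz (k := (j : ℕ) + 9) (by omega), add_zero, zero_add]
  · rw [h, hz (k := (j : ℕ) - 9) (by omega), hz (k := (j : ℕ)) (by omega), add_zero, zero_add]

/-- The support lies among the nine consecutive integers around `a`, which represent every residue
once; one nonzero position thus recovers the strip from its image mod 9. -/
theorem strip_eq_wrap (hY : IsProfile Y) (h0 : 0 ≤ t) (h9 : t ≤ 9) {a : ℤ} (ha : strip Y t a ≠ 0)
    {k : ℤ} {j : Fin 9} (hj : ((j : ℕ) : ℤ) = k % 9) :
    strip Y t k = if |k - a| ≤ 4 then wrap Y t j else 0 := by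
  obtain ⟨i, h1, h2⟩ := hY.exists_window t
  have hz : ∀ {k}, k < i ∨ i + 4 < k → strip Y t k = 0 := hY.strip_eq_zero h1 h2.le
  have ha' : ¬(a < i ∨ i + 4 < a) := fun h => ha (hz h)
  split_ifs with hk
  · rw [abs_le] at hk
    rw [hY.wrap_apply h1 h2.le h0 h9, hj]
    by_cases hki : i ≤ k
    · congr 1
      omega
    · rw [hz (Or.inl (by omega)), hz (Or.inr (by omega))]
  · rw [abs_le] at hk
    exact hz (by omega)

theorem exists_strip_ne_zero (hY : IsProfile Y) (t : ℝ) : ∃ a, strip Y t a ≠ 0 := by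
  obtain ⟨i, h1, h2⟩ := hY.exists_window t
  by_contra! h
  have := hY.sum_strip h1 h2.le
  simp [h] at this

/-- Deck transformations: matching one nonzero position identifies the two strips up to a
translation by `9 * n`, after which `strip_injective` applies. -/
theorem wrap_eq_wrap {Y' : ℤ → ℝ} {t' : ℝ} (hY : IsProfile Y) (hY' : IsProfile Y') (h0 : 0 ≤ t)
    (h9 : t ≤ 9) (h0' : 0 ≤ t') (h9' : t' ≤ 9) (h : wrap Y t = wrap Y' t') :
    ∃ n : ℤ, (∀ k, Y k = Y' (k + 9 * n)) ∧ t = t' - 9 * n := by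
  have hfin : ∀ k : ℤ, ∃ j : Fin 9, ((j : ℕ) : ℤ) = k % 9 := fun k =>
    ⟨⟨(k % 9).toNat, by omega⟩, by simp; omega⟩
  obtain ⟨a, ha⟩ := hY.exists_strip_ne_zero t
  obtain ⟨j, hj⟩ := hfin a
  have hwa : wrap Y' t' j ≠ 0 := by
    rw [← h]
    rw [hY.strip_eq_wrap h0 h9 ha hj] at ha
    simpa using ha
  obtain ⟨i', h1', h2'⟩ := hY'.exists_window t'
  rw [hY'.wrap_apply h1' h2'.le h0' h9'] at hwa
  obtain ⟨n, hn⟩ : ∃ n, i' + ((j : ℕ) - i') % 9 = a + 9 * n :=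
    ⟨(i' + ((j : ℕ) - i') % 9 - a) / 9, by omega⟩
  rw [hn] at hwa
  have hstrip : strip Y t = strip (fun k => Y' (k + 9 * n)) (t' - (9 * n : ℤ)) := by
    ext k
    obtain ⟨j, hj⟩ := hfin k
    rw [hY'.strip_shift, hY.strip_eq_wrap h0 h9 ha hj,
      hY'.strip_eq_wrap h0' h9' hwa (k := k + 9 * n) (j := j) (by omega), h,
      add_sub_add_right_eq_sub]
  obtain ⟨hYY, htt⟩ := strip_injective hY (hY'.shift (9 * n)) hstrip
  exact ⟨n, congrFun hYY, by rw [htt]; push_cast; ring⟩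

theorem wrap_mem_geom (hY : IsProfile Y) (h0 : 0 ≤ t) (h9 : t ≤ 9) :
    wrap Y t ∈ geom {s | IsFace s} := by
  obtain ⟨i, h1, h2⟩ := hY.exists_window t
  have happly := hY.wrap_apply h1 h2.le h0 h9
  have hz : ∀ {k}, k < i ∨ i + 4 < k → strip Y t k = 0 := hY.strip_eq_zero h1 h2.le
  obtain ⟨a, ha⟩ : ∃ a : Fin 9, ((a : ℕ) : ℤ) = i % 9 :=
    ⟨⟨(i % 9).toNat, by omega⟩, by simp; omega⟩
  have hval : ∀ d : Fin 9, (((a + d : Fin 9) : ℕ) - i) % 9 = ((d : ℕ) : ℤ) := by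
    intro d
    have := d.2
    rw [Fin.val_add]
    omega
  have hadd : ∀ d : Fin 9, wrap Y t (a + d) = strip Y t (i + (d : ℕ)) := by
    intro d
    rw [happly, hval]
  have hsum : ∑ v, wrap Y t v = 1 := by
    rw [← Equiv.sum_comp (Equiv.addLeft a)]
    simp only [Equiv.coe_addLeft, hadd]
    rw [← hY.sum_strip h1 h2.le, Fin.sum_univ_eq_sum_range (fun k => strip Y t (i + k)) 9]
    simp only [sum_range_succ, sum_range_zero]
    rw [hz (k := i + (5 : ℕ)) (by omega), hz (k := i + (6 : ℕ)) (by omega),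
      hz (k := i + (7 : ℕ)) (by omega), hz (k := i + (8 : ℕ)) (by omega)]
    simp
  refine ⟨fun v => ?_, hsum, ?_⟩
  · rw [happly]
    exact hY.strip_nonneg h1 h2.le _
  · have hface : ∀ s : Finset (Fin 9), (∀ d : Fin 9, a + d ∉ s → strip Y t (i + (d : ℕ)) = 0) →
        ∀ v, v ∉ s → wrap Y t v = 0 := by
      intro s hs v hv
      have := hs (v - a) (by rwa [add_sub_cancel])
      rwa [← hadd, add_sub_cancel] at this
    have hge : ∀ d : Fin 9, 5 ≤ (d : ℕ) → strip Y t (i + (d : ℕ)) = 0 :=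
      fun d hd => hz (Or.inr (by omega))
    have hcases : ∀ d : Fin 9, d = 0 ∨ d = 1 ∨ d = 2 ∨ d = 3 ∨ d = 4 ∨ 5 ≤ (d : ℕ) := by decide
    rcases hY.exists_strip_eq_zero h1 h2 with h | h | h
    · refine ⟨_, ⟨a, Or.inl Subset.rfl⟩, hface _ fun d hd => ?_⟩
      rcases hcases d with rfl | rfl | rfl | rfl | rfl | hd5
      all_goals first | exact h | exact hge d hd5 | simp at hd
    · refine ⟨_, ⟨a, Or.inr (Or.inl Subset.rfl)⟩, hface _ fun d hd => ?_⟩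
      rcases hcases d with rfl | rfl | rfl | rfl | rfl | hd5
      all_goals first | exact h | exact hge d hd5 | simp at hd
    · refine ⟨_, ⟨a, Or.inr (Or.inr Subset.rfl)⟩, hface _ fun d hd => ?_⟩
      rcases hcases d with rfl | rfl | rfl | rfl | rfl | hd5
      all_goals first | exact h | exact hge d hd5 | simp at hd

end IsProfile

/-! ### Surjectivity of the wrapped strip -/

/-- The function on the integers with period 4 and given values at `0, 1, 2, 3`. -/
def periodize (y : Fin 4 → ℝ) (k : ℤ) : ℝ :=
  y ⟨(k % 4).toNat, by omega⟩

theorem isProfile_periodize {y : Fin 4 → ℝ} (h0 : ∀ c, 0 ≤ y c) (h1 : y 0 + y 1 + y 2 + y 3 = 1)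
    (h2 : ∃ c, y c = 0) : IsProfile (periodize y) where
  periodic k := by
    unfold periodize
    congr 3
    omega
  nonneg k := h0 _
  sum_eq := h1
  exists_eq_zero := by
    obtain ⟨c, hc⟩ := h2
    refine ⟨(c : ℕ), ?_⟩
    rw [← hc]
    unfold periodize
    congr 1
    ext
    have := c.2
    simp only
    omega

/-- The vertices of a face lie in a window of length five, without one of the inner vertices. -/
theorem exists_window_of_mem_geom {z : EuclideanSpace ℝ (Fin 9)} (hz : z ∈ geom {s | IsFace s}) :
    ∃ a : Fin 9, (∀ d : Fin 9, 5 ≤ (d : ℕ) → z (a + d) = 0) ∧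
      (z (a + 1) = 0 ∨ z (a + 2) = 0 ∨ z (a + 3) = 0) := by
  obtain ⟨-, -, s, ⟨a, h⟩, hs⟩ := hz
  have h1 : ∀ a d : Fin 9, 5 ≤ (d : ℕ) → a + d ∉ ({a, a + 2, a + 3, a + 4} : Finset (Fin 9)) ∧
      a + d ∉ ({a, a + 1, a + 3, a + 4} : Finset (Fin 9)) ∧
      a + d ∉ ({a, a + 1, a + 2, a + 4} : Finset (Fin 9)) := by decide +kernel
  have h2 : ∀ a : Fin 9, a + 1 ∉ ({a, a + 2, a + 3, a + 4} : Finset (Fin 9)) ∧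
      a + 2 ∉ ({a, a + 1, a + 3, a + 4} : Finset (Fin 9)) ∧
      a + 3 ∉ ({a, a + 1, a + 2, a + 4} : Finset (Fin 9)) := by decide +kernel
  refine ⟨a, ?_⟩
  rcases h with h | h | h
  · exact ⟨fun d hd => hs _ fun hm => (h1 a d hd).1 (h hm), Or.inl (hs _ fun hm => (h2 a).1 (h hm))⟩
  · exact ⟨fun d hd => hs _ fun hm => (h1 a d hd).2.1 (h hm),
      Or.inr (Or.inl (hs _ fun hm => (h2 a).2.1 (h hm)))⟩
  · exact ⟨fun d hd => hs _ fun hm => (h1 a d hd).2.2 (h hm),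
      Or.inr (Or.inr (hs _ fun hm => (h2 a).2.2 (h hm)))⟩

/-- The profile is read off by merging the two end vertices `a` and `a + 4` of the window, which
agree mod 4; the mass at `a + 4` is what has already flowed. -/
theorem exists_wrap_eq {z : EuclideanSpace ℝ (Fin 9)} (hz : z ∈ geom {s | IsFace s}) :
    ∃ Y t, IsProfile Y ∧ 0 ≤ t ∧ t ≤ 9 ∧ wrap Y t = z := by
  obtain ⟨a, hge, hzero⟩ := exists_window_of_mem_geom hz
  obtain ⟨h0, h1, -⟩ := hz
  have hsum : z a + z (a + 4) + z (a + 1) + z (a + 2) + z (a + 3) = 1 := by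
    have h9 : ∀ f : Fin 9 → ℝ, ∑ d, f d =
        f 0 + f 1 + f 2 + f 3 + f 4 + f 5 + f 6 + f 7 + f 8 := by
      intro f
      rw [Fin.sum_univ_castSucc, Fin.sum_univ_eight]
      rfl
    rw [← h1, ← Equiv.sum_comp (Equiv.addLeft a), h9]
    simp only [Equiv.coe_addLeft]
    rw [hge 5 (by decide), hge 6 (by decide), hge 7 (by decide), hge 8 (by decide), add_zero a]
    ring
  set y : Fin 4 → ℝ := ![z a + z (a + 4), z (a + 1), z (a + 2), z (a + 3)] with hy
  have hy0 : IsProfile (periodize y) := by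
    refine isProfile_periodize (fun c => ?_) hsum ?_
    · have := add_nonneg (h0 a) (h0 (a + 4))
      fin_cases c
      exacts [this, h0 _, h0 _, h0 _]
    · rcases hzero with h | h | h
      exacts [⟨1, h⟩, ⟨2, h⟩, ⟨3, h⟩]
  have hY := hy0.shift (-(a : ℕ))
  set Y : ℤ → ℝ := fun k => periodize y (k + -(a : ℕ)) with hYdef
  have hYv : ∀ d : ℤ, Y ((a : ℕ) + d) = periodize y d := by
    intro d
    simp only [hYdef]
    congr 1
    ring
  have hYa : Y (a : ℕ) = z a + z (a + 4) := by
    have := hYv 0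
    rw [add_zero] at this
    exact this
  set t := moment Y (a : ℕ) + 4 * z (a + 4) with ht
  have ht1 : moment Y (a : ℕ) ≤ t := by linarith [h0 (a + 4)]
  have ht2 : t ≤ moment Y ((a : ℕ) + 1) := by
    rw [hY.moment_succ, hYa]
    linarith [h0 a]
  have hstrip : ∀ d : Fin 9, strip Y t ((a : ℕ) + (d : ℕ)) = z (a + d) := by
    intro d
    have hcases : ∀ d : Fin 9, d = 0 ∨ d = 1 ∨ d = 2 ∨ d = 3 ∨ d = 4 ∨ 5 ≤ (d : ℕ) := by decide
    have h4 : (t - moment Y (a : ℕ)) / 4 = z (a + 4) := by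
      rw [ht]
      ring
    rcases hcases d with rfl | rfl | rfl | rfl | rfl | hd
    · have := hY.strip_left ht1 ht2
      rw [h4, hYa] at this
      rw [Fin.val_zero, Nat.cast_zero, add_zero, add_zero, this]
      ring
    · exact (hY.strip_middle ht1 ht2 (by omega) (by norm_num)).trans (hYv 1)
    · exact (hY.strip_middle ht1 ht2 (by norm_num) (by norm_num)).trans (hYv 2)
    · exact (hY.strip_middle ht1 ht2 (by norm_num) (by norm_num)).trans (hYv 3)
    · exact (hY.strip_right ht1 ht2).trans h4
    · rw [hge d hd]
      exact hY.strip_eq_zero ht1 ht2 (Or.inr (by omega))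
  have hmod : ∀ j : Fin 9, strip Y t ((a : ℕ) + ((j : ℕ) - (a : ℕ)) % 9) = z j := by
    intro j
    have := hstrip (j - a)
    rw [add_sub_cancel] at this
    rw [← this]
    congr 2
    have := Fin.intCast_val_sub_eq_sub_add_ite j a
    split_ifs at this <;> omega
  have hta : t ≤ 12 := by
    have := hY.moment_le ((a : ℕ) + 1)
    have ha : ((a : ℕ) : ℝ) ≤ 8 := by exact_mod_cast Nat.le_of_lt_succ a.2
    push_cast at this
    linarith
  have hta' : 0 ≤ t := (Nat.cast_nonneg (a : ℕ)).trans ((by exact_mod_cast hY.le_moment (a : ℕ) :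
    ((a : ℕ) : ℝ) ≤ _).trans ht1)
  -- Windows that cross the cut give heights up to 12; these are translated back by 9.
  rcases le_or_gt t 9 with h9 | h9
  · refine ⟨Y, t, hY, hta', h9, ?_⟩
    ext j
    rw [hY.wrap_apply ht1 ht2 hta' h9, hmod]
  · refine ⟨_, t - (9 : ℤ), hY.shift 9, ?_, ?_, ?_⟩
    · push_cast
      linarith
    · push_cast
      linarith
    · ext j
      rw [(hY.shift 9).wrap_apply (i := (a : ℕ) - 9), hY.strip_shift, ← hmod j]
      · congr 1
        omega
      · rw [hY.moment_shift, sub_add_cancel]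
        linarith
      · rw [hY.moment_shift, show ((a : ℕ) : ℤ) - 9 + 1 + 9 = (a : ℕ) + 1 by ring]
        linarith
      · push_cast
        linarith
      · push_cast
        linarith

end

end TightTriangulation

namespace TightTriangulation

noncomputable section

open Finset Real

/-! ### Walkup's complex triangulates the twisted sphere bundle -/

/-- Linear functions of `x` whose coefficient vectors, for `k = 0, 1, 2, 3`, are the vertices of a
tetrahedron, rotated by a quarter turn while `s` runs from `0` to `1`. -/
def wave (x : EuclideanSpace ℝ (Fin 3)) (s : ℝ) (k : ℤ) : ℝ :=
  cos (π * k) * x 2 + (cos (π / 2 * (s + k)) * x 0 + sin (π / 2 * (s + k)) * x 1)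

theorem wave_add_four (x : EuclideanSpace ℝ (Fin 3)) (s : ℝ) (k : ℤ) :
    wave x s (k + 4) = wave x s k := by
  have h1 : π * ((k + 4 : ℤ) : ℝ) = π * k + (2 : ℕ) * (2 * π) := by push_cast; ring
  have h2 : π / 2 * (s + ((k + 4 : ℤ) : ℝ)) = π / 2 * (s + k) + 2 * π := by push_cast; ring
  rw [wave, wave, h1, h2, cos_add_nat_mul_two_pi, cos_add_two_pi, sin_add_two_pi]

theorem wave_add_four_mul (x : EuclideanSpace ℝ (Fin 3)) (s : ℝ) (k n : ℤ) :
    wave x s (k + 4 * n) = wave x s k := by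
  have := Function.Periodic.int_mul (f := wave x s) (c := 4) (wave_add_four x s) n k
  rwa [mul_comm] at this

/-- Raising both `s` and `k` by one makes two quarter turns, hence a half turn, and flips the
vertical sign: together the antipodal map. -/
theorem wave_neg (x : EuclideanSpace ℝ (Fin 3)) (k : ℤ) : wave (-x) 1 (k + 1) = wave x 0 k := by
  have h1 : π * ((k + 1 : ℤ) : ℝ) = π * k + π := by push_cast; ring
  have h2 : π / 2 * (1 + ((k + 1 : ℤ) : ℝ)) = π / 2 * (0 + k) + π := by push_cast; ring
  rw [wave, wave, h1, h2, cos_add_pi, cos_add_pi, sin_add_pi]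
  simp only [PiLp.neg_apply]
  ring

/-- The first horizontal coordinate after a rotation. -/
def rotFst (x : EuclideanSpace ℝ (Fin 3)) (s : ℝ) : ℝ :=
  cos (π / 2 * s) * x 0 + sin (π / 2 * s) * x 1

/-- The second horizontal coordinate after a rotation. -/
def rotSnd (x : EuclideanSpace ℝ (Fin 3)) (s : ℝ) : ℝ :=
  -sin (π / 2 * s) * x 0 + cos (π / 2 * s) * x 1

theorem wave_zero (x : EuclideanSpace ℝ (Fin 3)) (s : ℝ) : wave x s 0 = x 2 + rotFst x s := by
  simp [wave, rotFst]

theorem wave_one (x : EuclideanSpace ℝ (Fin 3)) (s : ℝ) : wave x s 1 = -x 2 + rotSnd x s := by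
  have h : π / 2 * (s + ((1 : ℤ) : ℝ)) = π / 2 * s + π / 2 := by push_cast; ring
  rw [wave, rotSnd, h, cos_add_pi_div_two, sin_add_pi_div_two]
  simp

theorem wave_two (x : EuclideanSpace ℝ (Fin 3)) (s : ℝ) : wave x s 2 = x 2 - rotFst x s := by
  have h : π / 2 * (s + ((2 : ℤ) : ℝ)) = π / 2 * s + π := by push_cast; ring
  have h' : π * ((2 : ℤ) : ℝ) = 2 * π := by push_cast; ring
  rw [wave, rotFst, h, h', cos_add_pi, sin_add_pi, cos_two_pi]
  ring

theorem wave_three (x : EuclideanSpace ℝ (Fin 3)) (s : ℝ) : wave x s 3 = -x 2 - rotSnd x s := by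
  have h : π / 2 * (s + ((3 : ℤ) : ℝ)) = π / 2 * s + π / 2 + π := by push_cast; ring
  have h' : π * ((3 : ℤ) : ℝ) = π + 2 * π := by push_cast; ring
  rw [wave, rotSnd, h, h', cos_add_pi, sin_add_pi, cos_add_two_pi, cos_pi, cos_add_pi_div_two,
    sin_add_pi_div_two]
  ring

theorem sq_add_sq_rot (x : EuclideanSpace ℝ (Fin 3)) (s : ℝ) :
    rotFst x s ^ 2 + rotSnd x s ^ 2 + x 2 ^ 2 = ‖x‖ ^ 2 := by
  rw [EuclideanSpace.norm_sq_eq, Fin.sum_univ_three]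
  simp only [norm_eq_abs, sq_abs, rotFst, rotSnd]
  linear_combination (x 0 ^ 2 + x 1 ^ 2) * cos_sq_add_sin_sq (π / 2 * s)

theorem ext_rot {x y : EuclideanSpace ℝ (Fin 3)} {s : ℝ} (h1 : rotFst x s = rotFst y s)
    (h2 : rotSnd x s = rotSnd y s) (h3 : x 2 = y 2) : x = y := by
  have h := sq_add_sq_rot (x - y) s
  have e1 : rotFst (x - y) s = 0 := by
    rw [← sub_eq_zero] at h1
    rw [← h1]
    simp only [rotFst, PiLp.sub_apply]
    ring
  have e2 : rotSnd (x - y) s = 0 := by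
    rw [← sub_eq_zero] at h2
    rw [← h2]
    simp only [rotSnd, PiLp.sub_apply]
    ring
  rw [e1, e2, PiLp.sub_apply, h3] at h
  rw [← sub_eq_zero, ← norm_eq_zero]
  have : ‖x - y‖ ^ 2 = 0 := by rw [← h]; ring
  exact pow_eq_zero_iff two_ne_zero |>.1 this

/-- The minimum of the four functions. -/
def waveMin (x : EuclideanSpace ℝ (Fin 3)) (s : ℝ) : ℝ :=
  min (min (wave x s 0) (wave x s 1)) (min (wave x s 2) (wave x s 3))

theorem exists_wave_eq (x : EuclideanSpace ℝ (Fin 3)) (s : ℝ) (k : ℤ) :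
    wave x s k = wave x s 0 ∨ wave x s k = wave x s 1 ∨ wave x s k = wave x s 2 ∨
      wave x s k = wave x s 3 := by
  have h : ∀ r, k % 4 = r → wave x s k = wave x s r := by
    intro r hr
    rw [← wave_add_four_mul x s r (k / 4)]
    congr 1
    omega
  have : k % 4 = 0 ∨ k % 4 = 1 ∨ k % 4 = 2 ∨ k % 4 = 3 := by omega
  exact this.imp (h 0) (Or.imp (h 1) (Or.imp (h 2) (h 3)))

theorem waveMin_le (x : EuclideanSpace ℝ (Fin 3)) (s : ℝ) (k : ℤ) : waveMin x s ≤ wave x s k := by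
  unfold waveMin
  rcases exists_wave_eq x s k with h | h | h | h <;> rw [h] <;> simp

theorem exists_wave_eq_waveMin (x : EuclideanSpace ℝ (Fin 3)) (s : ℝ) :
    ∃ k, wave x s k = waveMin x s := by
  unfold waveMin
  rcases min_choice (min (wave x s 0) (wave x s 1)) (min (wave x s 2) (wave x s 3)) with h | h
  · rw [h]
    rcases min_choice (wave x s 0) (wave x s 1) with h | h
    exacts [⟨0, h.symm⟩, ⟨1, h.symm⟩]
  · rw [h]
    rcases min_choice (wave x s 2) (wave x s 3) with h | h
    exacts [⟨2, h.symm⟩, ⟨3, h.symm⟩]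

theorem waveMin_unique {x : EuclideanSpace ℝ (Fin 3)} {s m : ℝ} (h : ∀ k, m ≤ wave x s k)
    (h' : ∃ k, wave x s k = m) : waveMin x s = m := by
  obtain ⟨k, hk⟩ := h'
  obtain ⟨l, hl⟩ := exists_wave_eq_waveMin x s
  exact le_antisymm (hk ▸ waveMin_le x s k) (hl ▸ h l)

theorem waveMin_neg_apply (x : EuclideanSpace ℝ (Fin 3)) : waveMin (-x) 1 = waveMin x 0 := by
  refine waveMin_unique (fun k => ?_) ?_
  · have := waveMin_le x 0 (k - 1)
    rwa [← wave_neg, sub_add_cancel] at this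
  · obtain ⟨k, hk⟩ := exists_wave_eq_waveMin x 0
    exact ⟨k + 1, by rw [wave_neg, hk]⟩

/-- The four values sum to zero, so if none is negative they all vanish, and they determine `x`. -/
theorem waveMin_lt_zero {x : EuclideanSpace ℝ (Fin 3)} (hx : x ≠ 0) (s : ℝ) : waveMin x s < 0 := by
  by_contra! h
  have h0 := h.trans (waveMin_le x s 0)
  have h1 := h.trans (waveMin_le x s 1)
  have h2 := h.trans (waveMin_le x s 2)
  have h3 := h.trans (waveMin_le x s 3)
  rw [wave_zero] at h0
  rw [wave_one] at h1
  rw [wave_two] at h2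
  rw [wave_three] at h3
  have e1 : rotFst x s = 0 := by linarith
  have e2 : rotSnd x s = 0 := by linarith
  have e3 : x 2 = 0 := by linarith
  refine hx (ext_rot (s := s) ?_ ?_ ?_)
  · rw [e1]
    simp [rotFst]
  · rw [e2]
    simp [rotSnd]
  · simp [e3]

/-- The point of the boundary of the tetrahedron in the direction of `x`. -/
def profile (x : EuclideanSpace ℝ (Fin 3)) (s : ℝ) (k : ℤ) : ℝ :=
  (wave x s k - waveMin x s) / (-4 * waveMin x s)

theorem profile_neg (x : EuclideanSpace ℝ (Fin 3)) (k : ℤ) :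
    profile (-x) 1 (k + 1) = profile x 0 k := by
  rw [profile, profile, wave_neg, waveMin_neg_apply]

theorem isProfile_profile {x : EuclideanSpace ℝ (Fin 3)} (hx : x ≠ 0) (s : ℝ) :
    IsProfile (profile x s) where
  periodic k := by rw [profile, profile, wave_add_four]
  nonneg k := div_nonneg (sub_nonneg.2 (waveMin_le x s k)) (by linarith [waveMin_lt_zero hx s])
  sum_eq := by
    have := (waveMin_lt_zero hx s).ne
    simp only [profile, wave_zero, wave_one, wave_two, wave_three]
    field_simp
    ring
  exists_eq_zero := by
    obtain ⟨k, hk⟩ := exists_wave_eq_waveMin x s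
    exact ⟨k, by rw [profile, hk, sub_self, zero_div]⟩

/-- Equal profiles make the waves, hence the vectors, proportional with ratio the quotient of the
minima. The norms agree and both minima are negative, so the ratio is 1. -/
theorem profile_injective {x y : EuclideanSpace ℝ (Fin 3)} {s : ℝ} (hx : ‖x‖ = 1) (hy : ‖y‖ = 1)
    (h : profile x s = profile y s) : x = y := by
  have hx0 := waveMin_lt_zero (x := x) (by rintro rfl; simp at hx) s
  have hy0 := waveMin_lt_zero (x := y) (by rintro rfl; simp at hy) s
  have hxs := sq_add_sq_rot x s
  have hys := sq_add_sq_rot y s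
  rw [hx] at hxs
  rw [hy] at hys
  have key : ∀ k, waveMin y s * wave x s k = waveMin x s * wave y s k := by
    intro k
    have := congrFun h k
    unfold profile at this
    rw [div_eq_div_iff (by linarith) (by linarith)] at this
    linarith
  have h0 := key 0
  have h1 := key 1
  have h2 := key 2
  have h3 := key 3
  rw [wave_zero, wave_zero] at h0
  rw [wave_one, wave_one] at h1
  rw [wave_two, wave_two] at h2
  rw [wave_three, wave_three] at h3
  have e1 : waveMin y s * rotFst x s = waveMin x s * rotFst y s := by linarith
  have e2 : waveMin y s * rotSnd x s = waveMin x s * rotSnd y s := by linarith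
  have e3 : waveMin y s * x 2 = waveMin x s * y 2 := by linarith
  have hsq : waveMin y s ^ 2 = waveMin x s ^ 2 := by
    linear_combination (-waveMin y s ^ 2) * hxs + waveMin x s ^ 2 * hys +
      (waveMin y s * rotFst x s + waveMin x s * rotFst y s) * e1 +
      (waveMin y s * rotSnd x s + waveMin x s * rotSnd y s) * e2 +
      (waveMin y s * x 2 + waveMin x s * y 2) * e3
  have hm : waveMin y s = waveMin x s := by
    rcases sq_eq_sq_iff_eq_or_eq_neg.1 hsq with h | h
    · exact h
    · linarith
  rw [hm] at e1 e2 e3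
  exact ext_rot (mul_left_cancel₀ hx0.ne e1) (mul_left_cancel₀ hx0.ne e2)
    (mul_left_cancel₀ hx0.ne e3)

theorem exists_profile_eq {Y : ℤ → ℝ} (hY : IsProfile Y) (s : ℝ) :
    ∃ x : EuclideanSpace ℝ (Fin 3), ‖x‖ = 1 ∧ profile x s = Y := by
  set P := (Y 0 - Y 2) / 2 with hP
  set Q := (Y 1 - Y 3) / 2 with hQ
  -- Solves `wave v s k = Y k - 1/4`, with the rotation undone; normalising `v` does not change its
  -- profile.
  set v : EuclideanSpace ℝ (Fin 3) := !₂[cos (π / 2 * s) * P - sin (π / 2 * s) * Q,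
    sin (π / 2 * s) * P + cos (π / 2 * s) * Q, (Y 0 + Y 2) / 2 - 1 / 4] with hv
  have hcs := cos_sq_add_sin_sq (π / 2 * s)
  have hsum := hY.sum_eq
  have hper : ∀ a : EuclideanSpace ℝ (Fin 3), ∀ c : ℝ,
      (∀ k : ℤ, k = 0 ∨ k = 1 ∨ k = 2 ∨ k = 3 → wave a s k = c * (Y k - 1 / 4)) →
      ∀ k, wave a s k = c * (Y k - 1 / 4) := by
    intro a c h k
    have h1 := wave_add_four_mul a s (k % 4) (k / 4)
    have h2 := hY.periodic_mul (k % 4) (k / 4)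
    have hk : k % 4 + 4 * (k / 4) = k := Int.emod_add_mul_ediv k 4
    rw [hk] at h1
    rw [hk] at h2
    rw [h1, h2]
    exact h _ (by omega)
  have hsmul : ∀ c : ℝ, ∀ k, wave (c • v) s k = c * (Y k - 1 / 4) := by
    intro c
    refine hper _ _ ?_
    have f1 : rotFst (c • v) s = c * P := by
      simp only [rotFst, PiLp.smul_apply, smul_eq_mul, hv, Matrix.cons_val_zero,
        Matrix.cons_val_one]
      linear_combination c * P * hcs
    have f2 : rotSnd (c • v) s = c * Q := by
      simp only [rotSnd, PiLp.smul_apply, smul_eq_mul, hv, Matrix.cons_val_zero,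
        Matrix.cons_val_one]
      linear_combination c * Q * hcs
    have f3 : (c • v) 2 = c * ((Y 0 + Y 2) / 2 - 1 / 4) := rfl
    rintro k (rfl | rfl | rfl | rfl)
    · rw [wave_zero, f1, f3]
      ring
    · rw [wave_one, f2, f3]
      linear_combination (-c / 2) * hsum
    · rw [wave_two, f1, f3]
      ring
    · rw [wave_three, f2, f3]
      linear_combination (-c / 2) * hsum
  obtain ⟨k0, hk0⟩ := hY.exists_eq_zero
  have hv0 : v ≠ 0 := by
    intro h
    have := hsmul 1 k0
    rw [h, hk0, smul_zero] at this
    simp [wave] at this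
  have hn : ‖v‖ ≠ 0 := norm_ne_zero_iff.2 hv0
  have hn' : 0 < ‖v‖ := norm_pos_iff.2 hv0
  refine ⟨‖v‖⁻¹ • v, ?_, ?_⟩
  · rw [norm_smul, norm_inv, norm_norm, inv_mul_cancel₀ hn]
  · have hmin : waveMin (‖v‖⁻¹ • v) s = ‖v‖⁻¹ * (0 - 1 / 4) := by
      refine waveMin_unique (fun k => ?_) ⟨k0, by rw [hsmul, hk0]⟩
      rw [hsmul]
      have := hY.nonneg k
      gcongr
    ext k
    rw [profile, hmin, hsmul]
    field_simp
    ring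

/-! ### The map from the bundle to the complex -/

theorem continuous_wave (k : ℤ) :
    Continuous fun p : EuclideanSpace ℝ (Fin 3) × ℝ => wave p.1 p.2 k := by
  unfold wave
  fun_prop

theorem continuous_waveMin :
    Continuous fun p : EuclideanSpace ℝ (Fin 3) × ℝ => waveMin p.1 p.2 := by
  unfold waveMin
  exact ((continuous_wave 0).min (continuous_wave 1)).min
    ((continuous_wave 2).min (continuous_wave 3))

theorem ne_zero_of_mem_sphere (x : S2) : (x : EuclideanSpace ℝ (Fin 3)) ≠ 0 :=
  ne_zero_of_mem_unit_sphere x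

/-- The map from `S² × [0, 1]` to Walkup's complex. -/
def bundleMap (p : S2 × unitInterval) : EuclideanSpace ℝ (Fin 9) :=
  wrap (profile p.1 p.2) (9 * p.2)

theorem continuous_bundleMap : Continuous bundleMap := by
  have hpair : Continuous fun p : S2 × unitInterval =>
      ((p.1 : EuclideanSpace ℝ (Fin 3)), (p.2 : ℝ)) := by fun_prop
  have hprof : ∀ k, Continuous fun p : S2 × unitInterval => profile p.1 p.2 k := by
    intro k
    have h1 := (continuous_wave k).comp hpair
    have h2 := continuous_waveMin.comp hpair
    refine (h1.sub h2).div (continuous_const.mul h2) fun p => ?_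
    exact mul_ne_zero (by norm_num) (waveMin_lt_zero (ne_zero_of_mem_sphere p.1) p.2).ne
  have hstrip : ∀ k, Continuous fun p : S2 × unitInterval =>
      strip (profile p.1 p.2) (9 * p.2) k := by
    intro k
    unfold strip flow moment
    fun_prop
  unfold bundleMap wrap
  refine (PiLp.continuous_toLp 2 _).comp (continuous_pi fun j => ?_)
  exact ((hstrip _).add (hstrip _)).add (hstrip _)

theorem bundleMap_mem (p : S2 × unitInterval) : bundleMap p ∈ geom {s | IsFace s} :=
  (isProfile_profile (ne_zero_of_mem_sphere p.1) p.2).wrap_mem_geom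
    (mul_nonneg (by norm_num) p.2.2.1) (by linarith [p.2.2.2])

/-- Nine is two full periods of four plus one, and the single remaining step is the antipodal map.
-/
theorem profile_neg_nine (x : S2) :
    (fun k => profile (-x : S2) 1 (k + 9)) = profile x 0 := by
  have h := isProfile_profile (ne_zero_of_mem_sphere x) 0
  ext k
  rw [show k + 9 = k + 4 + 4 + 1 by ring, coe_neg_sphere, profile_neg, h.periodic,
    h.periodic]

/-- Translation by 9 lowers the height from 9 to 0 and takes the profile of `-x` at time 1 to that
of `x` at time 0, without changing the residues mod 9. -/
theorem bundleMap_eq_of_gluing {p q : S2 × unitInterval} (h : TwistedGluing p q) :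
    bundleMap p = bundleMap q := by
  obtain ⟨x⟩ := h
  have hx := isProfile_profile (ne_zero_of_mem_sphere x) 0
  have hy := isProfile_profile (ne_zero_of_mem_sphere (-x)) 1
  obtain ⟨i, h1, h2⟩ := hy.exists_window 9
  have hshift := hy.moment_shift 9
  have hstrip := hy.strip_shift 9 9
  rw [profile_neg_nine] at hshift hstrip
  push_cast at hshift hstrip
  rw [sub_self] at hstrip
  ext j
  simp only [bundleMap, Set.Icc.coe_zero, Set.Icc.coe_one, mul_zero, mul_one]
  rw [hy.wrap_apply h1 h2.le (by norm_num) le_rfl,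
    hx.wrap_apply (i := i - 9) _ _ le_rfl (by norm_num),
    hstrip]
  · congr 1
    omega
  · rw [hshift, sub_add_cancel]
    linarith
  · rw [hshift, show i - 9 + 1 + 9 = i + 1 by ring]
    linarith

/-- Points with the same image differ by a translation by `9 * n`; heights in `[0, 9]` leave only `n
= 0`, where the points agree, and `n = 1` or `-1`, which pairs the two ends of the interval. -/
theorem gluing_of_bundleMap_eq {p q : S2 × unitInterval} (h : bundleMap p = bundleMap q) :
    p = q ∨ TwistedGluing p q ∨ TwistedGluing q p := by
  obtain ⟨x, s⟩ := p
  obtain ⟨y, t⟩ := q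
  have hx : ∀ x : S2, ‖(x : EuclideanSpace ℝ (Fin 3))‖ = 1 := fun x => norm_eq_of_mem_sphere x
  have hglue : ∀ x y : S2, ∀ s t : unitInterval, (s : ℝ) = t - 1 →
      (∀ k, profile x s k = profile y t (k + 9)) → TwistedGluing (x, s) (y, t) := by
    intro x y s t hst hprof
    have hs : s = 0 := Subtype.ext (le_antisymm (by linarith [t.2.2] : (s : ℝ) ≤ 0) s.2.1)
    have ht : t = 1 := by
      subst hs
      rw [Set.Icc.coe_zero] at hst
      exact Subtype.ext (by rw [Set.Icc.coe_one]; linarith)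
    subst hs ht
    have h1 := profile_neg_nine (-y)
    rw [neg_neg] at h1
    have : x = -y := Subtype.ext (profile_injective (hx x) (hx (-y)) (s := 0) (h1 ▸ funext hprof))
    have hyx : y = -x := by rw [this, neg_neg]
    rw [hyx]
    exact TwistedGluing.glue x
  obtain ⟨n, hn, hst⟩ := (isProfile_profile (ne_zero_of_mem_sphere x) s).wrap_eq_wrap
    (isProfile_profile (ne_zero_of_mem_sphere y) t) (mul_nonneg (by norm_num) s.2.1)
    (by linarith [s.2.2]) (mul_nonneg (by norm_num) t.2.1) (by linarith [t.2.2]) h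
  have hst' : (s : ℝ) = t - n := by linarith
  have hn1 : n ≤ 1 := by
    have : (n : ℝ) ≤ 1 := by linarith [s.2.1, t.2.2]
    exact_mod_cast this
  have hn2 : -1 ≤ n := by
    have : (-1 : ℝ) ≤ n := by linarith [s.2.2, t.2.1]
    exact_mod_cast this
  obtain rfl | rfl | rfl : n = 0 ∨ n = 1 ∨ n = -1 := by omega
  · left
    have hs : s = t := Subtype.ext (by simpa using hst')
    subst hs
    have : x = y := Subtype.ext (profile_injective (hx x) (hx y) (s := s)
      (by simpa using funext hn))
    rw [this]
  · exact Or.inr (Or.inl (hglue x y s t (by simpa using hst') (by simpa using hn)))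
  · refine Or.inr (Or.inr (hglue y x t s (by push_cast at hst'; linarith) fun k => ?_))
    rw [hn, mul_neg, mul_one, add_neg_cancel_right]

theorem exists_bundleMap_eq {z : EuclideanSpace ℝ (Fin 9)} (hz : z ∈ geom {s | IsFace s}) :
    ∃ p, bundleMap p = z := by
  obtain ⟨Y, t, hY, h0, h9, rfl⟩ := exists_wrap_eq hz
  obtain ⟨x, hx, rfl⟩ := exists_profile_eq hY (t / 9)
  refine ⟨⟨⟨x, mem_sphere_zero_iff_norm.2 hx⟩, ⟨t / 9, by positivity, by linarith⟩⟩, ?_⟩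
  unfold bundleMap
  rw [mul_div_cancel₀ t (by norm_num)]

theorem nonempty_homeomorph_twistedSphereBundle :
    Nonempty (realization walkup.toPreAbstractSimplicialComplex ≃ₜ TwistedSphereBundle) := by
  rw [realization_walkup]
  let f : TwistedSphereBundle → geom {s | IsFace s} :=
    Quot.lift (fun p => ⟨bundleMap p, bundleMap_mem p⟩)
      fun p q h => Subtype.ext (bundleMap_eq_of_gluing h)
  have hf : Continuous f :=
    continuous_quot_lift _ (continuous_bundleMap.subtype_mk bundleMap_mem)
  have hbij : Function.Bijective f := by
    refine ⟨fun a b => ?_, fun z => ?_⟩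
    · induction a using Quot.ind with | _ p
      induction b using Quot.ind with | _ q
      intro h
      rcases gluing_of_bundleMap_eq (congrArg Subtype.val h) with h | h | h
      · rw [h]
      · exact Quot.sound h
      · exact (Quot.sound h).symm
    · obtain ⟨p, hp⟩ := exists_bundleMap_eq z.2
      exact ⟨Quot.mk _ p, Subtype.ext hp⟩
  exact ⟨(Continuous.homeoOfEquivCompactToT2 (f := Equiv.ofBijective f hbij) hf).symm⟩

end

end TightTriangulation

theorem mainTheorem7 :
    TightTriangulation.IsCombinatorialManifold 3
        TightTriangulation.walkup.toPreAbstractSimplicialComplex ∧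
      Nonempty (TightTriangulation.realization
          TightTriangulation.walkup.toPreAbstractSimplicialComplex ≃ₜ
        TightTriangulation.TwistedSphereBundle) ∧
      TightTriangulation.IsTight (ZMod 2) (TightTriangulation.realization
        TightTriangulation.walkup.toPreAbstractSimplicialComplex) :=
  ⟨TightTriangulation.isCombinatorialManifold_walkup,
    TightTriangulation.nonempty_homeomorph_twistedSphereBundle, TightTriangulation.isTight_walkup⟩
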